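/- Let $0<p\le 1$ and let $\mathbb X$ be a separable infinite-dimensional $p$-Banach space over $\mathbb F=\mathbb R$ or $\mathbb C$. Let $\mathcal X=(\mathbf x_n)_{n\in\mathbb N}$ be a bounded basis of $\mathbb X$ with bounded dual basis, that is, $\mathbb X=\overline{\langle \mathbf x_n:n\in\mathbb N\rangle}$, there are $\mathbf x_n^*\in\mathbb X^*$ with $\mathbf x_j^*(\mathbf x_k)=\delta_{j,k}$, and $\sup_n\|\mathbf x_n\|<\infty$, $\sup_n\|\mathbf x_n^*\|<\infty$. A greedy set of $f\in\mathbb X$ of cardinality $m$ is a set $A\subset\mathbb N$ with $|A|=m$ and $|\mathbf x_n^*(f)|\ge|\mathbf x_k^*(f)|$ for all $n\in A$, $k\notin A$; let $GS(f,m)$ be the set of these. For $m\in\mathbb N$ put $$\sigma_m(f)=\inf\Big\{\Big\|f-\sum_{n\in B}a_n\mathbf x_n\Big\|: |B|\le m,\ a_n\in\mathbb F\Big\},\qquad \vartheta_m(f)=\sup_{A\in GS(f,m)}\ \inf_{g\in\langle \mathbf x_n:n\in A\rangle}\|f-g\|.$$ Let $0<q\le\infty$ and let $w=(w(n))_{n\ge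 1}$ be a non-decreasing sequence of positive numbers that is doubling ($w(2n)\le Cw(n)$ for all $n$ and some $C>0$) and satisfies $$i_w:=\sup_{m>1}\frac{\log\varphi_w(m)}{\log m}>0,\qquad \varphi_w(m):=\inf_{k\in\mathbb N}\frac{w(km)}{w(k)}.$$ For $f\in\mathbb X$ put $$\|f\|_{\mathcal A^w_q}=\|f\|+\Big(\sum_{n\ge1}\frac{(w(n)\sigma_n(f))^q}{n}\Big)^{1/q},\qquad \|f\|_{\mathcal{CG}^w_q}=\|f\|+\Big(\sum_{n\ge1}\frac{(w(n)\vartheta_n(f))^q}{n}\Big)^{1/q}$$ (with $\sup_n w(n)\sigma_n(f)$ and $\sup_n w(n)\vartheta_n(f)$ in place of the sums if $q=\infty$); these may be infinite. Let $\mathcal A^w_q$ and $\mathcal{CG}^w_q$ be the sets of those $f\in\mathbb X$ for which the respective quantity is finite. Suppose that $\mathcal A^w_q=\mathcal{CG}^w_q$ as sets, and that at least one of the following holds: (i) $\mathcal X$ is truncation quasi-greedy: there is $C>0$ such that $\min_{n\in A}|\mathbf x_n^*(f)|\,\big\|\sum_{n\in A}\operatorname{sgn}(\mathbf x_n^*(f))\mathbf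 x_n\big\|\le C\|f\|$ for all $f\in\mathbb X$, $m\ge 1$ and $A\in GS(f,m)$, where $\operatorname{sgn}(z)=z/|z|$ for $z\ne0$ and $\operatorname{sgn}(0)=1$; (ii) $\mathcal X$ has the finite dimensional separation property: there is $C>0$ such that for every separable subspace $\mathbb Z\subset\mathbb X$ and every $\epsilon>0$ there is a subsequence $(\mathbf x_{i_k})_{k}$ of $\mathcal X$ that is a Schauder basic sequence with basis constant at most $C+\epsilon$ and such that for every finite-dimensional subspace $\mathbb Y\subset\mathbb Z$ there is $j\in\mathbb N$ with $\|f\|\le(C+\epsilon)\|f+g\|$ for all $f\in\mathbb Y$ and all $g\in\overline{\langle \mathbf x_{i_k}:k>j\rangle}$. Then $\mathcal A^w_q\approx\mathcal{CG}^w_q$, i.e. there is $C>0$ with $\|f\|_{\mathcal{CG}^w_q}\le C\|f\|_{\mathcal A^w_q}$ and $\|f\|_{\mathcal A^w_q}\le C\|f\|_{\mathcal{CG}^w_q}$ for all $f\in\mathbb X$; and $\mathcal X$ is superdemocratic, i.e. there is $C>0$ such that $$\Big\|\sum_{n\in A}\varepsilon_n\mathbf x_n\Big\|\le C\Big\|\sum_{n\in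 B}\varepsilon'_n\mathbf x_n\Big\|$$ for all finite $A,B\subset\mathbb N$ with $|A|\le|B|$ and all $\varepsilon_n,\varepsilon_n'\in\mathbb F$ of modulus $1$. -/

import Mathlib

open scoped ENNReal

noncomputable section

namespace GreedyClasses

/-- A `p`-norm, `0 < p ≤ 1`, on a vector space `X` over `𝕜 = ℝ` or `ℂ`. -/
structure PNorm (𝕜 : Type*) [RCLike 𝕜] (X : Type*) [AddCommGroup X] [Module 𝕜 X] (p : ℝ) where
  toFun : X → ℝ
  pos_p : 0 < p
  p_le_one : p ≤ 1
  nonneg : ∀ f, 0 ≤ toFun f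
  eq_zero : ∀ f, toFun f = 0 → f = 0
  smul : ∀ (c : 𝕜) f, toFun (c • f) = ‖c‖ * toFun f
  add_rpow_le : ∀ f g, toFun (f + g) ^ p ≤ toFun f ^ p + toFun g ^ p

variable {𝕜 : Type*} [RCLike 𝕜] {X : Type*} [AddCommGroup X] [Module 𝕜 X] {p : ℝ}

instance : CoeFun (PNorm 𝕜 X p) (fun _ => X → ℝ) := ⟨PNorm.toFun⟩

namespace PNorm

/-- Closure of a set in the topology of the `p`-norm. -/
def closure (N : PNorm 𝕜 X p) (S : Set X) : Set X :=
  {f | ∀ ε : ℝ, 0 < ε → ∃ g ∈ S, N (f - g) < ε}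

/-- Completeness; a space with a complete `p`-norm is a `p`-Banach space. -/
def Complete (N : PNorm 𝕜 X p) : Prop :=
  ∀ s : ℕ → X,
    (∀ ε : ℝ, 0 < ε → ∃ M : ℕ, ∀ m n : ℕ, M ≤ m → M ≤ n → N (s m - s n) < ε) →
    ∃ f : X, Filter.Tendsto (fun n => N (s n - f)) Filter.atTop (nhds 0)

/-- Separability of a subset, in the topology of the `p`-norm. -/
def Separable (N : PNorm 𝕜 X p) (S : Set X) : Prop :=
  ∃ D : Set X, D.Countable ∧ D ⊆ S ∧ S ⊆ N.closure D

theorem exists_add_lt (N : PNorm 𝕜 X p) (ε : ℝ) (hε : 0 < ε) :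
    ∃ δ : ℝ, 0 < δ ∧ ∀ f g : X, N f < δ → N g < δ → N (f + g) < ε := by
  have hp := N.pos_p
  have h2 : 0 < ε ^ p / 2 := by positivity
  refine ⟨(ε ^ p / 2) ^ (1 / p), by positivity, fun f g hf hg => ?_⟩
  have key : ∀ h : X, N h < (ε ^ p / 2) ^ (1 / p) → N h ^ p < ε ^ p / 2 := by
    intro h hh
    have := Real.rpow_lt_rpow (N.nonneg h) hh hp
    rwa [← Real.rpow_mul h2.le, one_div_mul_cancel hp.ne', Real.rpow_one] at this
  have h3 := N.add_rpow_le f g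
  have h4 := key f hf
  have h5 := key g hg
  exact (Real.rpow_lt_rpow_iff (N.nonneg _) hε.le hp).1 (by linarith)

/-- The closed linear span of a set. -/
def closedSpan (N : PNorm 𝕜 X p) (S : Set X) : Submodule 𝕜 X where
  carrier := N.closure (Submodule.span 𝕜 S : Set X)
  zero_mem' := by
    intro ε hε
    refine ⟨0, Submodule.zero_mem _, ?_⟩
    have h := N.smul 0 0
    simp only [smul_zero, norm_zero, zero_mul] at h
    simpa [h] using hε
  add_mem' := by
    intro a b ha hb ε hε
    obtain ⟨δ, hδ, h⟩ := N.exists_add_lt ε hε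
    obtain ⟨a', ha', h1⟩ := ha δ hδ
    obtain ⟨b', hb', h2⟩ := hb δ hδ
    refine ⟨a' + b', Submodule.add_mem _ ha' hb', ?_⟩
    have h3 := h _ _ h1 h2
    rwa [sub_add_sub_comm] at h3
  smul_mem' := by
    intro c a ha ε hε
    have hc : 0 < ‖c‖ + 1 := by positivity
    obtain ⟨a', ha', h1⟩ := ha (ε / (‖c‖ + 1)) (by positivity)
    refine ⟨c • a', Submodule.smul_mem _ _ ha', ?_⟩
    rw [← smul_sub, N.smul]
    rw [lt_div_iff₀ hc] at h1
    nlinarith [N.nonneg (a - a'), norm_nonneg c]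

/-- `u` is a Schauder basic sequence with basis constant at most `K`: there are coordinate
functionals on the closed span of `u`, biorthogonal to `u`, whose partial sum operators are
bounded by `K`. (Continuity of the functionals and their totality on the closed span are
consequences of the uniform bound.) -/
def IsSchauderBasic (N : PNorm 𝕜 X p) (u : ℕ → X) (K : ℝ) : Prop :=
  ∃ φ : ℕ → (N.closedSpan (Set.range u) →ₗ[𝕜] 𝕜),
    (∀ (j k : ℕ) (hk : u k ∈ N.closedSpan (Set.range u)),
      φ j ⟨u k, hk⟩ = if j = k then 1 else 0) ∧
    ∀ (m : ℕ) (f : N.closedSpan (Set.range u)),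
      N (∑ k ∈ Finset.range m, φ k f • u k) ≤ K * N (f : X)

/-- The finite dimensional separation property with constant `C` of a sequence `u`. -/
def HasFDSPWith (N : PNorm 𝕜 X p) (u : ℕ → X) (C : ℝ) : Prop :=
  ∀ Z : Submodule 𝕜 X, N.Separable (Z : Set X) → ∀ ε : ℝ, 0 < ε →
    ∃ i : ℕ → ℕ, StrictMono i ∧ N.IsSchauderBasic (fun k => u (i k)) (C + ε) ∧
      ∀ Y : Submodule 𝕜 X, Y ≤ Z → FiniteDimensional 𝕜 Y →
        ∃ j : ℕ, ∀ f ∈ Y, ∀ g ∈ N.closedSpan {v | ∃ k : ℕ, j < k ∧ v = u (i k)},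
          N f ≤ (C + ε) * N (f + g)

/-- The finite dimensional separation property. -/
def HasFDSP (N : PNorm 𝕜 X p) (u : ℕ → X) : Prop :=
  ∃ C : ℝ, 0 < C ∧ N.HasFDSPWith u C

end PNorm

/-- A (bounded) basis of `X` together with its (bounded) dual basis. The dual basis is not
required to be total. -/
structure Basis (N : PNorm 𝕜 X p) where
  vec : ℕ → X
  coord : ℕ → (X →ₗ[𝕜] 𝕜)
  biorthogonal : ∀ j k : ℕ, coord j (vec k) = if j = k then 1 else 0
  dense_span : ∀ f : X, f ∈ N.closedSpan (Set.range vec)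
  vec_bounded : ∃ C : ℝ, ∀ n, N (vec n) ≤ C
  coord_bounded : ∃ C : ℝ, ∀ n f, ‖coord n f‖ ≤ C * N f

/-- The sign of a scalar, equal to `1` at `0`. -/
def sgn (z : 𝕜) : 𝕜 := open Classical in if z = 0 then 1 else z / (‖z‖ : 𝕜)

namespace Basis

variable {N : PNorm 𝕜 X p}

/-- The indicator sum `∑_{n ∈ A} ε n • x n`. -/
def indicator (B : Basis N) (ε : ℕ → 𝕜) (A : Finset ℕ) : X := ∑ n ∈ A, ε n • B.vec n

/-- `C`-superdemocracy for some `C > 0`. -/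
def Superdemocratic (B : Basis N) : Prop :=
  ∃ C : ℝ, 0 < C ∧ ∀ (A D : Finset ℕ) (ε ε' : ℕ → 𝕜), A.card ≤ D.card →
    (∀ n, ‖ε n‖ = 1) → (∀ n, ‖ε' n‖ = 1) →
    N (B.indicator ε A) ≤ C * N (B.indicator ε' D)

/-- `A` is a greedy set of `f` of cardinality `m`. -/
def IsGreedySet (B : Basis N) (f : X) (m : ℕ) (A : Finset ℕ) : Prop :=
  A.card = m ∧ ∀ n ∈ A, ∀ k ∉ A, ‖B.coord k f‖ ≤ ‖B.coord n f‖

/-- `C`-truncation quasi-greediness for some `C > 0`. -/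
def TruncationQuasiGreedy (B : Basis N) : Prop :=
  ∃ C : ℝ, 0 < C ∧ ∀ (f : X) (m : ℕ) (A : Finset ℕ) (hA : A.Nonempty), B.IsGreedySet f m A →
    A.inf' hA (fun n => ‖B.coord n f‖) * N (B.indicator (fun n => sgn (B.coord n f)) A)
      ≤ C * N f

/-- The best `m`-term approximation error `σ_m(f)`. -/
def bestError (B : Basis N) (f : X) (m : ℕ) : ℝ≥0∞ :=
  ⨅ (A : Finset ℕ) (_ : A.card ≤ m) (a : ℕ → 𝕜), ENNReal.ofReal (N (f - ∑ n ∈ A, a n • B.vec n))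

/-- The Chebyshev-greedy error `ϑ_m(f)`. -/
def chebyshevError (B : Basis N) (f : X) (m : ℕ) : ℝ≥0∞ :=
  ⨆ (A : Finset ℕ) (_ : B.IsGreedySet f m A),
    ⨅ g ∈ Submodule.span 𝕜 (B.vec '' (A : Set ℕ)), ENNReal.ofReal (N (f - g))

end Basis

/-- The weighted sequence quasi-norm `(∑_n (w(n) e(n))^q / n)^(1/q)`, or `sup_n w(n) e(n)`
when `q = ∞`. -/
def weightedNorm (w : ℕ+ → ℝ) (q : ℝ≥0∞) (e : ℕ → ℝ≥0∞) : ℝ≥0∞ :=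
  open Classical in
  if q = ∞ then ⨆ n : ℕ+, ENNReal.ofReal (w n) * e n
  else (∑' n : ℕ+, (ENNReal.ofReal (w n) * e n) ^ q.toReal / ((n : ℕ) : ℝ≥0∞)) ^ (1 / q.toReal)

namespace Basis

variable {N : PNorm 𝕜 X p}

/-- `‖f‖` in the approximation class `𝒜^w_q`, possibly infinite. -/
def approxNorm (B : Basis N) (w : ℕ+ → ℝ) (q : ℝ≥0∞) (f : X) : ℝ≥0∞ :=
  ENNReal.ofReal (N f) + weightedNorm w q (B.bestError f)

/-- `‖f‖` in the Chebyshev-greedy class `𝒞𝒢^w_q`, possibly infinite. -/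
def chebyshevNorm (B : Basis N) (w : ℕ+ → ℝ) (q : ℝ≥0∞) (f : X) : ℝ≥0∞ :=
  ENNReal.ofReal (N f) + weightedNorm w q (B.chebyshevError f)

/-- The approximation class `𝒜^w_q`. -/
def approxClass (B : Basis N) (w : ℕ+ → ℝ) (q : ℝ≥0∞) : Set X :=
  {f | B.approxNorm w q f < ∞}

/-- The Chebyshev-greedy class `𝒞𝒢^w_q`. -/
def chebyshevClass (B : Basis N) (w : ℕ+ → ℝ) (q : ℝ≥0∞) : Set X :=
  {f | B.chebyshevNorm w q f < ∞}

end Basis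

/-- The class with (extended) norm `n₁` embeds in the one with norm `n₂`. -/
def Embeds {X : Type*} (n₁ n₂ : X → ℝ≥0∞) : Prop :=
  ∃ C : ℝ, 0 < C ∧ ∀ f, n₂ f ≤ ENNReal.ofReal C * n₁ f

/-- Embeddings in both directions. -/
def EquivNorms {X : Type*} (n₁ n₂ : X → ℝ≥0∞) : Prop := Embeds n₁ n₂ ∧ Embeds n₂ n₁

/-- `φ_w(m) = inf_k w(km) / w(k)`. -/
def lowerDilation (w : ℕ+ → ℝ) (m : ℕ+) : ℝ := ⨅ k : ℕ+, w (k * m) / w k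

/-- The index `i_w = sup_{m > 1} log φ_w(m) / log m`. -/
def lowerIndex (w : ℕ+ → ℝ) : EReal :=
  ⨆ (m : ℕ+) (_ : 1 < m), ((Real.log (lowerDilation w m) / Real.log ((m : ℕ) : ℝ) : ℝ) : EReal)

/-- The class of non-decreasing doubling weights `w` (sequences of positive numbers) with
`i_w > 0`. -/
structure IsWeightIDPlus (w : ℕ+ → ℝ) : Prop where
  pos : ∀ n, 0 < w n
  mono : Monotone w
  doubling : ∃ C : ℝ, 0 < C ∧ ∀ n, w (2 * n) ≤ C * w n
  lowerIndex_pos : 0 < lowerIndex w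

end GreedyClasses

end

noncomputable section

namespace GreedyClasses

/-! Since `w` is doubling and both errors are non-increasing, the class quasi-norms are equivalent
to the dyadic quantities `anorm` and `gnorm`, which sample the errors at `0, 1, 2, 4, …`. The
condition `i_w > 0` says that `w` grows geometrically along powers of two. Hence the first `L`
weights together are comparable to the last one, and a fixed dilation multiplies the weight by any
prescribed factor. The inequality `anorm ≤ gnorm` is trivial, because best errors lie below greedy
ones; everything concerns its converse.

On the span of the basis, `exists_gnorm_le_anorm_on_span` turns the equality of sets into a uniform
bound by a gliding hump. If the bound failed, there would be finite blocks, tiny for `anorm` and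
huge for `gnorm`. They are added up so that each has larger coordinates than all later ones. Then
the old support together with a greedy set of the current block is greedy for the whole sum, and
forgetting the old support costs only a best approximation error (`exists_distOn_le_distOn_union`).
The sum lies in one class but not in the other.

Superdemocracy follows by testing this bound on the sum of an indicator `u` over `A` and an
indicator `v` over a disjoint, much larger set `D`. All coordinates have modulus one, so `D` is
greedy, and the greedy error dominates `‖u‖` once `u` is separated from the span over `D`; either
alternative in the hypothesis provides such separation. The best errors are about `‖u‖ + ‖v‖` below
`|A|` terms and `‖v‖` beyond. If `w` has grown enough between `|A|` and `|D|`, the terms in `‖u‖`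
are absorbed and `‖u‖ ≲ ‖v‖` remains (`exists_indicator_le_of_dyadic_card`).

To pass to arbitrary `f`, finitely many greedy sets of `f` are made greedy sets of a nearby vector
of the span (`exists_gnorm_le_of_greedilyPerturbable`). This is direct if `f` has infinitely many
nonzero coordinates. If it has finitely many, `f` may still lie outside the span, because the dual
basis need not be total. For truncation quasi-greedy bases this is impossible within the class
(`TruncationQuasiGreedy.mem_spanOn`). Under the separation property the support is padded by
separated basis vectors that hardly help to approximate `f`
(`exists_greedilyPerturbable_of_hasFDSP`). -/

/-! ### Weighted dyadic sequence quasi-norms -/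

/-- The `ℓ_q` quasi-norm of a sequence of extended nonnegative reals. -/
def lq (q : ℝ≥0∞) (e : ℕ → ℝ≥0∞) : ℝ≥0∞ :=
  open Classical in
  if q = ∞ then ⨆ k, e k else (∑' k, e k ^ q.toReal) ^ (1 / q.toReal)

section lq

variable {q : ℝ≥0∞}

theorem lq_top (e : ℕ → ℝ≥0∞) : lq ∞ e = ⨆ k, e k := by simp [lq]

theorem lq_of_ne_top (hq : q ≠ ∞) (e : ℕ → ℝ≥0∞) :
    lq q e = (∑' k, e k ^ q.toReal) ^ (1 / q.toReal) := by simp [lq, hq]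

theorem lq_mono {e e' : ℕ → ℝ≥0∞} (h : ∀ k, e k ≤ e' k) : lq q e ≤ lq q e' := by
  by_cases hq : q = ∞
  · subst hq; rw [lq_top, lq_top]; exact iSup_mono h
  · rw [lq_of_ne_top hq, lq_of_ne_top hq]
    gcongr with k
    exact h k

theorem lq_const_mul (hq : 0 < q) (c : ℝ≥0∞) (e : ℕ → ℝ≥0∞) :
    lq q (fun k => c * e k) = c * lq q e := by
  by_cases hq' : q = ∞
  · subst hq'; rw [lq_top, lq_top, ENNReal.mul_iSup]
  · have hr : 0 < q.toReal := ENNReal.toReal_pos hq.ne' hq'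
    rw [lq_of_ne_top hq', lq_of_ne_top hq']
    simp_rw [ENNReal.mul_rpow_of_nonneg _ _ hr.le]
    rw [ENNReal.tsum_mul_left, ENNReal.mul_rpow_of_nonneg _ _ (by positivity), ← ENNReal.rpow_mul,
      mul_one_div_cancel hr.ne', ENNReal.rpow_one]

theorem add_rpow_le_two_rpow_mul (a b : ℝ≥0∞) {r : ℝ} (hr : 0 ≤ r) :
    (a + b) ^ r ≤ 2 ^ r * (a ^ r + b ^ r) := by
  rcases le_total a b with h | h
  · calc (a + b) ^ r ≤ (2 * b) ^ r := by rw [two_mul]; gcongr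
      _ = 2 ^ r * b ^ r := ENNReal.mul_rpow_of_nonneg _ _ hr
      _ ≤ _ := by gcongr; exact le_add_self
  · calc (a + b) ^ r ≤ (2 * a) ^ r := by rw [two_mul]; gcongr
      _ = 2 ^ r * a ^ r := ENNReal.mul_rpow_of_nonneg _ _ hr
      _ ≤ _ := by gcongr; exact le_self_add

theorem le_lq (hq : 0 < q) (e : ℕ → ℝ≥0∞) (k : ℕ) : e k ≤ lq q e := by
  by_cases hq' : q = ∞
  · subst hq'; rw [lq_top]; exact le_iSup e k
  · have hr : 0 < q.toReal := ENNReal.toReal_pos hq.ne' hq'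
    rw [lq_of_ne_top hq']
    calc e k = (e k ^ q.toReal) ^ (1 / q.toReal) := by
          rw [← ENNReal.rpow_mul, mul_one_div_cancel hr.ne', ENNReal.rpow_one]
      _ ≤ _ := by gcongr; exact ENNReal.le_tsum k

theorem lq_add_le (hq : 0 < q) : ∃ C : NNReal, ∀ e e' : ℕ → ℝ≥0∞,
    lq q (fun k => e k + e' k) ≤ C * (lq q e + lq q e') := by
  by_cases hq' : q = ∞
  · subst hq'
    refine ⟨1, fun e e' => ?_⟩
    simp only [lq_top, ENNReal.coe_one, one_mul]
    exact iSup_le fun k => add_le_add (le_iSup e k) (le_iSup e' k)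
  · have hr : 0 < q.toReal := ENNReal.toReal_pos hq.ne' hq'
    refine ⟨2 * 2 ^ (1 / q.toReal), fun e e' => ?_⟩
    simp only [lq_of_ne_top hq']
    calc (∑' k, (e k + e' k) ^ q.toReal) ^ (1 / q.toReal)
        ≤ (∑' k, 2 ^ q.toReal * (e k ^ q.toReal + e' k ^ q.toReal)) ^ (1 / q.toReal) := by
          gcongr with k
          exact add_rpow_le_two_rpow_mul _ _ hr.le
      _ = 2 * (∑' k, e k ^ q.toReal + ∑' k, e' k ^ q.toReal) ^ (1 / q.toReal) := by
          rw [ENNReal.tsum_mul_left, ENNReal.tsum_add,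
            ENNReal.mul_rpow_of_nonneg _ _ (by positivity), ← ENNReal.rpow_mul,
            mul_one_div_cancel hr.ne', ENNReal.rpow_one]
      _ ≤ 2 * (2 ^ (1 / q.toReal) * ((∑' k, e k ^ q.toReal) ^ (1 / q.toReal)
            + (∑' k, e' k ^ q.toReal) ^ (1 / q.toReal))) := by
          gcongr
          exact add_rpow_le_two_rpow_mul _ _ (by positivity)
      _ = _ := by
          rw [← mul_assoc]
          congr 1
          rw [ENNReal.coe_mul, ENNReal.coe_rpow_of_nonneg _ (by positivity)]
          simp

/-- Monotone convergence. It permits perturbation arguments in which the perturbation depends on the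
number `L` of entries considered, as long as the final bound does not. -/
theorem lq_le_of_truncations {e : ℕ → ℝ≥0∞} {M : ℝ≥0∞} (hq : 0 < q)
    (h : ∀ L : ℕ, lq q (fun k => if k < L then e k else 0) ≤ M) : lq q e ≤ M := by
  by_cases hq' : q = ∞
  · subst hq'
    simp only [lq_top] at h ⊢
    refine iSup_le fun k => le_trans ?_ ((le_iSup _ k).trans (h (k + 1)))
    simp
  · have hr : 0 < q.toReal := ENNReal.toReal_pos hq.ne' hq'
    rw [lq_of_ne_top hq', one_div, ENNReal.rpow_inv_le_iff hr, ENNReal.tsum_eq_iSup_nat]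
    refine iSup_le fun L => ?_
    have h1 := h L
    rw [lq_of_ne_top hq', one_div, ENNReal.rpow_inv_le_iff hr] at h1
    refine le_trans ?_ h1
    refine le_trans (le_of_eq ?_) (ENNReal.sum_le_tsum (Finset.range L))
    refine Finset.sum_congr rfl fun k hk => ?_
    rw [if_pos (Finset.mem_range.1 hk)]

theorem lq_le_succ (hq : 0 < q) : ∃ C : NNReal, ∀ e : ℕ → ℝ≥0∞,
    lq q e ≤ C * (e 0 + lq q (fun k => e (k + 1))) := by
  by_cases hq' : q = ∞
  · subst hq'
    refine ⟨1, fun e => ?_⟩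
    simp only [lq_top, ENNReal.coe_one, one_mul]
    refine iSup_le fun k => ?_
    cases k with
    | zero => exact le_self_add
    | succ k => exact (le_iSup (fun k => e (k + 1)) k).trans le_add_self
  · have hr : 0 < q.toReal := ENNReal.toReal_pos hq.ne' hq'
    refine ⟨2 ^ (1 / q.toReal), fun e => ?_⟩
    simp only [lq_of_ne_top hq']
    rw [tsum_eq_zero_add' ENNReal.summable]
    refine (add_rpow_le_two_rpow_mul _ _ (by positivity)).trans (le_of_eq ?_)
    rw [ENNReal.coe_rpow_of_nonneg _ (by positivity)]
    congr 2
    rw [← ENNReal.rpow_mul, mul_one_div_cancel hr.ne', ENNReal.rpow_one]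

theorem lq_shift_le (hq : 0 < q) : ∃ C : NNReal, ∀ e : ℕ → ℝ≥0∞,
    lq q (fun k => e (k - 1)) ≤ C * lq q e := by
  obtain ⟨C, hC⟩ := lq_le_succ hq
  refine ⟨C * 2, fun e => (hC _).trans ?_⟩
  rw [ENNReal.coe_mul, mul_assoc]
  gcongr
  -- Truncated subtraction makes the first entry occur twice; this is the factor `2`.
  simp only [zero_tsub, add_tsub_cancel_right]
  rw [ENNReal.coe_ofNat, two_mul]
  gcongr
  exact le_lq hq e 0

/-- A sequence that grows geometrically has partial `ℓ_q` quasi-norms dominated by its terms. -/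
theorem lq_truncation_le_of_growth (hq : 0 < q) {W : ℕ → ℝ≥0∞} (hW : Monotone W)
    (hgrow : ∀ Γ : NNReal, ∃ b : ℕ, ∀ k, Γ * W k ≤ W (k + b)) :
    ∃ C : NNReal, ∀ L : ℕ, lq q (fun k => if k < L then W k else 0) ≤ C * W L := by
  by_cases hq' : q = ∞
  · subst hq'
    refine ⟨1, fun L => ?_⟩
    simp only [lq_top, ENNReal.coe_one, one_mul]
    refine iSup_le fun k => ?_
    split_ifs with h
    · exact hW h.le
    · exact zero_le
  · have hr : 0 < q.toReal := ENNReal.toReal_pos hq.ne' hq'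
    set r := q.toReal with hrdef
    -- This factor becomes `2` after raising to the power `r`.
    obtain ⟨b₀, hb₀⟩ := hgrow (2 ^ (1 / r))
    obtain ⟨b, hbpos, hb⟩ : ∃ b : ℕ, 0 < b ∧
        ∀ k, ((2 ^ (1 / r) : NNReal) : ℝ≥0∞) * W k ≤ W (k + b) :=
      ⟨b₀ + 1, by omega, fun k => (hb₀ k).trans (hW (by omega))⟩
    have hb' : ∀ k, 2 * W k ^ r ≤ W (k + b) ^ r := by
      intro k
      have := ENNReal.rpow_le_rpow (hb k) hr.le
      rwa [ENNReal.mul_rpow_of_nonneg _ _ hr.le, ← ENNReal.coe_rpow_of_nonneg _ hr.le,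
        ← NNReal.rpow_mul, one_div_mul_cancel hr.ne', NNReal.rpow_one] at this
    -- The constant reproduces itself: the last `b` terms contribute at most `b`, and doubling over
    -- `b` steps turns `2b + 1 ≤ 2(b + 1)` into `b + 1`.
    have key : ∀ L, ∑ k ∈ Finset.range L, W k ^ r ≤ (2 * b + 1 : ℕ) * W L ^ r := by
      intro L
      induction L using Nat.strong_induction_on with
      | _ L ih =>
        by_cases hL : L ≤ b
        · calc ∑ k ∈ Finset.range L, W k ^ r ≤ ∑ k ∈ Finset.range L, W L ^ r := by
                gcongr with k hk
                exact hW (Finset.mem_range.1 hk).le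
            _ = (L : ℕ) * W L ^ r := by simp
            _ ≤ _ := by gcongr; omega
        · obtain ⟨m, rfl⟩ : ∃ m, L = m + b := ⟨L - b, by omega⟩
          rw [Finset.sum_range_add]
          have h1 := ih m (by omega)
          calc ∑ k ∈ Finset.range m, W k ^ r + ∑ x ∈ Finset.range b, W (m + x) ^ r
              ≤ (2 * b + 1 : ℕ) * W m ^ r + ∑ x ∈ Finset.range b, W (m + b) ^ r := by
                gcongr with x hx
                exact hW (by have := Finset.mem_range.1 hx; omega)
            _ ≤ (b + 1 : ℕ) * (2 * W m ^ r) + b * W (m + b) ^ r := by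
                rw [← mul_assoc]
                gcongr
                · exact_mod_cast (by omega : 2 * b + 1 ≤ (b + 1) * 2)
                · simp
            _ ≤ (b + 1 : ℕ) * W (m + b) ^ r + b * W (m + b) ^ r := by gcongr; exact hb' m
            _ = _ := by push_cast; ring
    refine ⟨((2 * b + 1 : ℕ) : NNReal) ^ (1 / r), fun L => ?_⟩
    rw [lq_of_ne_top hq', ← hrdef]
    have h1 : ∑' k, (if k < L then W k else 0) ^ r = ∑ k ∈ Finset.range L, W k ^ r := by
      rw [tsum_eq_sum (s := Finset.range L)]
      · exact Finset.sum_congr rfl fun k hk => by rw [if_pos (Finset.mem_range.1 hk)]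
      · intro k hk
        rw [if_neg (by simpa using hk), ENNReal.zero_rpow_of_pos hr]
    rw [h1]
    calc _ ≤ ((2 * b + 1 : ℕ) * W L ^ r) ^ (1 / r) := by gcongr; exact key L
      _ = _ := by
        rw [ENNReal.mul_rpow_of_nonneg _ _ (by positivity), ← ENNReal.rpow_mul,
          mul_one_div_cancel hr.ne', ENNReal.rpow_one,
          ENNReal.coe_rpow_of_nonneg _ (by positivity)]
        simp

end lq

/-- The indices `0, 1, 2, 4, 8, …`. -/
def dyadic (k : ℕ) : ℕ := 2 ^ k / 2

@[simp] theorem dyadic_zero : dyadic 0 = 0 := rfl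

@[simp] theorem dyadic_succ (k : ℕ) : dyadic (k + 1) = 2 ^ k := by simp [dyadic, pow_succ]

theorem dyadic_add_self_le (k : ℕ) : dyadic k + dyadic k ≤ dyadic (k + 1) := by
  cases k <;> simp [pow_succ]; omega

theorem dyadic_lt_succ (k : ℕ) : dyadic k < dyadic (k + 1) := by
  cases k with
  | zero => simp
  | succ k => simp [pow_succ]

theorem dyadic_strictMono : StrictMono dyadic := strictMono_nat_of_lt_succ dyadic_lt_succ

/-- The weight at the dyadic indices. -/
def dyadicWeight (w : ℕ+ → ℝ) (k : ℕ) : ℝ≥0∞ := ENNReal.ofReal (w (2 ^ (k - 1)))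

/-- The `ℓ_q` quasi-norm with weight `dyadicWeight w`. -/
def dyadicNorm (w : ℕ+ → ℝ) (q : ℝ≥0∞) (e : ℕ → ℝ≥0∞) : ℝ≥0∞ :=
  lq q (fun k => dyadicWeight w k * e k)

/-! ### Growth and doubling of the weight along dyadic indices. -/

section weight

variable {w : ℕ+ → ℝ} {q : ℝ≥0∞}

theorem IsWeightIDPlus.dyadicWeight_mono (hw : IsWeightIDPlus w) : Monotone (dyadicWeight w) := by
  intro a b hab
  refine ENNReal.ofReal_le_ofReal (hw.mono ?_)
  exact pow_le_pow_right' (one_le (a := (2 : ℕ+))) (by omega)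

theorem IsWeightIDPlus.dyadicWeight_ne_zero (hw : IsWeightIDPlus w) (k : ℕ) :
    dyadicWeight w k ≠ 0 := by
  simpa [dyadicWeight] using hw.pos _

theorem dyadicWeight_ne_top (k : ℕ) : dyadicWeight w k ≠ ∞ := ENNReal.ofReal_ne_top

theorem IsWeightIDPlus.dyadicWeight_succ_le (hw : IsWeightIDPlus w) :
    ∃ C : NNReal, ∀ k, dyadicWeight w (k + 1) ≤ C * dyadicWeight w k := by
  obtain ⟨C, hC, h⟩ := hw.doubling
  refine ⟨Real.toNNReal C + 1, fun k => ?_⟩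
  cases k with
  -- The indices `0` and `1` both carry the weight `w 1`; the summand `1` in the constant covers
  -- this case.
  | zero =>
    simp only [dyadicWeight]
    rw [ENNReal.coe_add, add_mul]
    simp
  | succ k =>
    simp only [dyadicWeight, Nat.add_sub_cancel]
    calc ENNReal.ofReal (w (2 ^ (k + 1))) ≤ ENNReal.ofReal (C * w (2 ^ k)) := by
          refine ENNReal.ofReal_le_ofReal ?_
          rw [pow_succ, mul_comm]
          exact h _
      _ = ENNReal.ofReal C * ENNReal.ofReal (w (2 ^ k)) := ENNReal.ofReal_mul hC.le
      _ ≤ _ := by gcongr; rw [ENNReal.ofReal]; exact_mod_cast le_self_add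

theorem IsWeightIDPlus.exists_dilation (hw : IsWeightIDPlus w) :
    ∃ (m : ℕ+) (γ : ℝ), 1 < γ ∧ ∀ k, γ * w k ≤ w (k * m) := by
  have h := hw.lowerIndex_pos
  simp only [lowerIndex, lt_iSup_iff] at h
  obtain ⟨m, hm, h⟩ := h
  have h' : 0 < Real.log (lowerDilation w m) / Real.log ((m : ℕ) : ℝ) := by exact_mod_cast h
  have hlog : 0 < Real.log ((m : ℕ) : ℝ) := Real.log_pos (by exact_mod_cast hm)
  have h1 : 0 < Real.log (lowerDilation w m) := by
    rcases div_pos_iff.1 h' with h | h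
    · exact h.1
    · linarith [h.2]
  -- `Real.log` is positive below `-1` too, so nonnegativity is needed to conclude that the infimum
  -- exceeds `1`.
  have h0 : 0 ≤ lowerDilation w m :=
    Real.iInf_nonneg fun k => div_nonneg (hw.pos _).le (hw.pos _).le
  refine ⟨m, lowerDilation w m, (Real.log_pos_iff h0).1 h1, fun k => ?_⟩
  rw [← le_div_iff₀ (hw.pos k)]
  exact ciInf_le ⟨0, by rintro _ ⟨k, rfl⟩; exact div_nonneg (hw.pos _).le (hw.pos _).le⟩ k

theorem IsWeightIDPlus.dyadicWeight_growth (hw : IsWeightIDPlus w) (Γ : NNReal) :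
    ∃ b : ℕ, ∀ k, Γ * dyadicWeight w k ≤ dyadicWeight w (k + b) := by
  obtain ⟨m, γ, hγ, h⟩ := hw.exists_dilation
  have hpow : ∀ i k, γ ^ i * w k ≤ w (k * m ^ i) := by
    intro i
    induction i with
    | zero => intro k; simp
    | succ i ih =>
      intro k
      calc γ ^ (i + 1) * w k = γ * (γ ^ i * w k) := by ring
        _ ≤ γ * w (k * m ^ i) := by gcongr; exact ih k
        _ ≤ _ := by rw [pow_succ, ← mul_assoc]; exact h _
  obtain ⟨i, hi⟩ := pow_unbounded_of_one_lt (Γ : ℝ) hγ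
  obtain ⟨b, hb⟩ := pow_unbounded_of_one_lt (m ^ i : ℕ) one_lt_two
  -- The extra step compensates the truncated exponent `k - 1` at `k = 0`.
  refine ⟨b + 1, fun k => ?_⟩
  have hΓ : (Γ : ℝ≥0∞) = ENNReal.ofReal Γ := by simp
  rw [dyadicWeight, dyadicWeight, hΓ, ← ENNReal.ofReal_mul Γ.coe_nonneg]
  refine ENNReal.ofReal_le_ofReal ?_
  calc (Γ : ℝ) * w (2 ^ (k - 1)) ≤ γ ^ i * w (2 ^ (k - 1)) := by
        have := hw.pos (2 ^ (k - 1)); gcongr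
    _ ≤ w (2 ^ (k - 1) * m ^ i) := hpow _ _
    _ ≤ _ := by
      refine hw.mono ?_
      calc (2 : ℕ+) ^ (k - 1) * m ^ i ≤ 2 ^ (k - 1) * 2 ^ b := by
            refine mul_le_mul' le_rfl ?_
            rw [← PNat.coe_le_coe]
            simpa using hb.le
        _ = 2 ^ (k - 1 + b) := (pow_add _ _ _).symm
        _ ≤ _ := pow_le_pow_right' (one_le (a := (2 : ℕ+))) (by omega)

theorem dyadicNorm_mono {e e' : ℕ → ℝ≥0∞} (h : ∀ k, e k ≤ e' k) :
    dyadicNorm w q e ≤ dyadicNorm w q e' := lq_mono fun k => by gcongr; exact h k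

theorem dyadicNorm_const_mul (hq : 0 < q) (c : ℝ≥0∞) (e : ℕ → ℝ≥0∞) :
    dyadicNorm w q (fun k => c * e k) = c * dyadicNorm w q e := by
  rw [dyadicNorm, dyadicNorm, ← lq_const_mul hq]
  congr 1; ext k; ring

theorem dyadicNorm_add_le (w : ℕ+ → ℝ) (hq : 0 < q) : ∃ C : NNReal, ∀ e e' : ℕ → ℝ≥0∞,
    dyadicNorm w q (fun k => e k + e' k) ≤ C * (dyadicNorm w q e + dyadicNorm w q e') := by
  obtain ⟨C, hC⟩ := lq_add_le hq
  refine ⟨C, fun e e' => ?_⟩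
  simp only [dyadicNorm, mul_add]
  simpa only [mul_add] using hC _ _

theorem le_dyadicNorm (hq : 0 < q) (e : ℕ → ℝ≥0∞) (k : ℕ) :
    dyadicWeight w k * e k ≤ dyadicNorm w q e :=
  le_lq hq (fun k => dyadicWeight w k * e k) k

theorem dyadicNorm_le_of_truncations {e : ℕ → ℝ≥0∞} {M : ℝ≥0∞} (hq : 0 < q)
    (h : ∀ L : ℕ, dyadicNorm w q (fun k => if k < L then e k else 0) ≤ M) :
    dyadicNorm w q e ≤ M := by
  refine lq_le_of_truncations hq fun L => le_trans (le_of_eq ?_) (h L)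
  simp only [dyadicNorm]
  congr 1; ext k; split_ifs <;> simp

/-- Errors of a sum with `2n` terms are controlled by errors of the summands with `n` terms. On
dyadic indices this is a shift by one, which doubling makes harmless. -/
theorem IsWeightIDPlus.dyadicNorm_shift_le (hw : IsWeightIDPlus w) (hq : 0 < q) :
    ∃ C : NNReal, ∀ e : ℕ → ℝ≥0∞,
      dyadicNorm w q (fun k => e (k - 1)) ≤ C * dyadicNorm w q e := by
  obtain ⟨C, hC⟩ := lq_shift_le hq
  obtain ⟨C', hC'⟩ := hw.dyadicWeight_succ_le
  refine ⟨(C' + 1) * C, fun e => ?_⟩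
  calc dyadicNorm w q (fun k => e (k - 1))
      ≤ lq q (fun k => ((C' + 1 : NNReal) : ℝ≥0∞) * (dyadicWeight w (k - 1) * e (k - 1))) := by
        refine lq_mono fun k => ?_
        rw [← mul_assoc]
        gcongr
        cases k with
        | zero =>
          rw [ENNReal.coe_add, add_mul]
          simp
        | succ k =>
          refine (hC' k).trans ?_
          simp only [Nat.add_sub_cancel]
          gcongr
          exact le_self_add
    _ = (C' + 1 : NNReal) * lq q (fun k => dyadicWeight w (k - 1) * e (k - 1)) :=
        lq_const_mul hq _ _
    _ ≤ (C' + 1 : NNReal) * (C * dyadicNorm w q e) := by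
        gcongr
        exact hC (fun k => dyadicWeight w k * e k)
    _ = _ := by rw [ENNReal.coe_mul, mul_assoc]

theorem IsWeightIDPlus.dyadicNorm_truncation_le (hw : IsWeightIDPlus w) (hq : 0 < q) :
    ∃ C : NNReal, ∀ L : ℕ,
      dyadicNorm w q (fun k => if k < L then 1 else 0) ≤ C * dyadicWeight w L := by
  obtain ⟨C, hC⟩ := lq_truncation_le_of_growth hq hw.dyadicWeight_mono hw.dyadicWeight_growth
  refine ⟨C, fun L => le_trans (le_of_eq ?_) (hC L)⟩
  simp only [dyadicNorm]
  congr 1; ext k; split_ifs <;> simp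

theorem IsWeightIDPlus.dyadicNorm_truncation_ne_top (hw : IsWeightIDPlus w) (hq : 0 < q) (L : ℕ) :
    dyadicNorm w q (fun k => if k < L then 1 else 0) ≠ ∞ := by
  obtain ⟨C, hC⟩ := hw.dyadicNorm_truncation_le hq
  exact ne_top_of_le_ne_top (ENNReal.mul_ne_top ENNReal.coe_ne_top (dyadicWeight_ne_top _)) (hC L)

theorem IsWeightIDPlus.exists_growth (hw : IsWeightIDPlus w) (Γ : NNReal) :
    ∃ b : ℕ, ∀ j : ℕ, (Γ : ℝ) ^ j * w 1 ≤ w (2 ^ (j * b)) := by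
  obtain ⟨b, hb⟩ := hw.dyadicWeight_growth Γ
  have hb' : ∀ k : ℕ, (Γ : ℝ) * w (2 ^ k) ≤ w (2 ^ (k + b)) := by
    intro k
    have := hb (k + 1)
    rw [dyadicWeight, dyadicWeight, ← ENNReal.ofReal_coe_nnreal,
      ← ENNReal.ofReal_mul NNReal.zero_le_coe, ENNReal.ofReal_le_ofReal_iff (hw.pos _).le] at this
    rwa [Nat.add_sub_cancel, show k + 1 + b - 1 = k + b by omega] at this
  refine ⟨b, fun j => ?_⟩
  induction j with
  | zero => simp
  | succ j ih =>
    calc (Γ : ℝ) ^ (j + 1) * w 1 = Γ * (Γ ^ j * w 1) := by ring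
      _ ≤ Γ * w (2 ^ (j * b)) := by gcongr
      _ ≤ w (2 ^ (j * b + b)) := hb' _
      _ = _ := by rw [add_mul, one_mul]

/-! ### Comparison with the non-dyadic quasi-norm -/

/-- The index `Nat.succPNat (2 ^ k - 1 + j)` is `2 ^ k + j`. -/
theorem tsum_pnat_eq_tsum_dyadic_blocks (F : ℕ+ → ℝ≥0∞) :
    ∑' n, F n = ∑' k : ℕ, ∑ j ∈ Finset.range (2 ^ k), F (Nat.succPNat (2 ^ k - 1 + j)) := by
  rw [← Equiv.pnatEquivNat.symm.tsum_eq]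
  change ∑' n : ℕ, F (Nat.succPNat n) = _
  have hlim : Filter.Tendsto (fun K : ℕ => 2 ^ K - 1) Filter.atTop Filter.atTop :=
    Filter.tendsto_atTop_mono (fun K => Nat.le_sub_one_of_lt K.lt_two_pow_self) Filter.tendsto_id
  rw [ENNReal.tsum_eq_iSup_nat' hlim, ENNReal.tsum_eq_iSup_nat]
  congr 1; ext K
  induction K with
  | zero => simp
  | succ K ih =>
    have : 2 ^ (K + 1) - 1 = (2 ^ K - 1) + 2 ^ K := by
      have := Nat.one_le_two_pow (n := K); rw [pow_succ]; omega
    rw [this, Finset.sum_range_add, ih, Finset.sum_range_succ]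

theorem two_pow_le_succPNat (k j : ℕ) : (2 : ℕ+) ^ k ≤ Nat.succPNat (2 ^ k - 1 + j) := by
  rw [← PNat.coe_le_coe]
  have := Nat.one_le_two_pow (n := k)
  simp; omega

theorem succPNat_le_two_pow {k j : ℕ} (hj : j < 2 ^ k) :
    Nat.succPNat (2 ^ k - 1 + j) ≤ (2 : ℕ+) ^ (k + 1) := by
  rw [← PNat.coe_le_coe]
  have := Nat.one_le_two_pow (n := k)
  simp [pow_succ]; omega

theorem IsWeightIDPlus.term_le (hw : IsWeightIDPlus w) {C : NNReal}
    (hC : ∀ k, dyadicWeight w (k + 1) ≤ C * dyadicWeight w k) {e : ℕ → ℝ≥0∞} (he : Antitone e)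
    {k : ℕ} {n : ℕ+} (h1 : 2 ^ k ≤ n) (h2 : n ≤ 2 ^ (k + 1)) :
    ENNReal.ofReal (w n) * e n ≤ C * (dyadicWeight w (k + 1) * e (dyadic (k + 1))) := by
  rw [← mul_assoc]
  refine mul_le_mul' ((ENNReal.ofReal_le_ofReal (hw.mono h2)).trans (hC (k + 1))) (he ?_)
  rw [dyadic_succ]
  simpa using PNat.coe_le_coe _ _ |>.2 h1

theorem IsWeightIDPlus.le_term (hw : IsWeightIDPlus w) {C : NNReal}
    (hC : ∀ k, dyadicWeight w (k + 1) ≤ C * dyadicWeight w k) {e : ℕ → ℝ≥0∞} (he : Antitone e)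
    {k : ℕ} {n : ℕ+} (h1 : 2 ^ k ≤ n) (h2 : n ≤ 2 ^ (k + 1)) :
    dyadicWeight w (k + 2) * e (dyadic (k + 2)) ≤ C * (ENNReal.ofReal (w n) * e n) := by
  rw [← mul_assoc]
  refine mul_le_mul' ((hC (k + 1)).trans ?_) (he ?_)
  · gcongr
    exact ENNReal.ofReal_le_ofReal (hw.mono h1)
  · rw [dyadic_succ]
    simpa using PNat.coe_le_coe _ _ |>.2 h2

theorem IsWeightIDPlus.weightedNorm_le_dyadicNorm (hw : IsWeightIDPlus w) (hq : 0 < q) :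
    ∃ C : NNReal, ∀ e : ℕ → ℝ≥0∞, Antitone e →
      e 0 + weightedNorm w q e ≤ C * dyadicNorm w q (e ∘ dyadic) := by
  obtain ⟨C, hC⟩ := hw.dyadicWeight_succ_le
  refine ⟨(dyadicWeight w 0)⁻¹.toNNReal + C, fun e he => ?_⟩
  rw [ENNReal.coe_add, add_mul,
    ENNReal.coe_toNNReal (ENNReal.inv_ne_top.2 (hw.dyadicWeight_ne_zero 0))]
  refine add_le_add ?_ ?_
  · calc e 0 = (dyadicWeight w 0)⁻¹ * (dyadicWeight w 0 * e 0) := by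
          rw [← mul_assoc,
            ENNReal.inv_mul_cancel (hw.dyadicWeight_ne_zero 0) (dyadicWeight_ne_top 0), one_mul]
      _ ≤ _ := by gcongr; exact le_dyadicNorm hq (e ∘ dyadic) 0
  · by_cases hq' : q = ∞
    · subst hq'
      simp only [weightedNorm, if_true]
      refine iSup_le fun n => ?_
      refine (hw.term_le hC he (k := Nat.log 2 n) ?_ ?_).trans ?_
      · rw [← PNat.coe_le_coe]
        simpa using Nat.pow_log_le_self 2 n.ne_zero
      · rw [← PNat.coe_le_coe]
        simpa using (Nat.lt_pow_succ_log_self one_lt_two n).le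
      · gcongr
        exact le_dyadicNorm hq (e ∘ dyadic) _
    · have hr : 0 < q.toReal := ENNReal.toReal_pos hq.ne' hq'
      rw [weightedNorm, if_neg hq', dyadicNorm, ← lq_const_mul hq, lq_of_ne_top hq',
        tsum_pnat_eq_tsum_dyadic_blocks]
      refine ENNReal.rpow_le_rpow ?_ (by positivity)
      rw [tsum_eq_zero_add' (f := fun k => (C * (dyadicWeight w k * (e ∘ dyadic) k)) ^ q.toReal)
        ENNReal.summable]
      refine le_trans ?_ le_add_self
      gcongr with k
      calc _ ≤ ∑ j ∈ Finset.range (2 ^ k),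
            (C * (dyadicWeight w (k + 1) * e (dyadic (k + 1)))) ^ q.toReal / (2 ^ k : ℕ) := by
            refine Finset.sum_le_sum fun j hj =>
              ENNReal.div_le_div (ENNReal.rpow_le_rpow ?_ hr.le) ?_
            · exact hw.term_le hC he (two_pow_le_succPNat k j)
                (succPNat_le_two_pow (Finset.mem_range.1 hj))
            · exact_mod_cast PNat.coe_le_coe _ _ |>.2 (two_pow_le_succPNat k j)
        _ = _ := by
            rw [Finset.sum_const, Finset.card_range, nsmul_eq_mul, ENNReal.mul_div_cancel]
            · rfl
            · simp
            · simp

theorem IsWeightIDPlus.dyadicNorm_le_weightedNorm (hw : IsWeightIDPlus w) (hq : 0 < q) :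
    ∃ C : NNReal, ∀ e : ℕ → ℝ≥0∞, Antitone e →
      dyadicNorm w q (e ∘ dyadic) ≤ C * (e 0 + weightedNorm w q e) := by
  obtain ⟨C, hC⟩ := hw.dyadicWeight_succ_le
  obtain ⟨C₁, hC₁⟩ := lq_le_succ hq
  -- The block starting at `2 ^ k` bounds the dyadic term `k + 2`, so the terms `0` and `1` are left
  -- over; both are at most `w 1 * e 0`.
  suffices h : ∃ C₂ : NNReal, ∀ e : ℕ → ℝ≥0∞, Antitone e →
      lq q (fun k => dyadicWeight w (k + 2) * e (dyadic (k + 2))) ≤ C₂ * weightedNorm w q e by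
    obtain ⟨C₂, hC₂⟩ := h
    set W := (dyadicWeight w 0).toNNReal with hWdef
    have hW : (W : ℝ≥0∞) = dyadicWeight w 0 := ENNReal.coe_toNNReal (dyadicWeight_ne_top 0)
    refine ⟨C₁ * (W + C₁ * (W + C₂)), fun e he => ?_⟩
    have h1 : dyadicWeight w 1 * e (dyadic 1) ≤ W * e 0 := by
      rw [hW]
      exact mul_le_mul' le_rfl (he (Nat.zero_le _))
    calc dyadicNorm w q (e ∘ dyadic) ≤ C₁ * (dyadicWeight w 0 * e (dyadic 0) +
          lq q (fun k => dyadicWeight w (k + 1) * e (dyadic (k + 1)))) := hC₁ _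
      _ ≤ C₁ * (W * e 0 + C₁ * (W * e 0 + C₂ * weightedNorm w q e)) := by
          rw [← hW]
          refine mul_le_mul' le_rfl (add_le_add le_rfl ((hC₁ _).trans ?_))
          refine mul_le_mul' le_rfl (add_le_add h1 (hC₂ e he))
      _ ≤ C₁ * (W * (e 0 + weightedNorm w q e) + C₁ * (W * (e 0 + weightedNorm w q e) +
            C₂ * (e 0 + weightedNorm w q e))) := by
          gcongr
          · exact le_self_add
          · exact le_self_add
          · exact le_add_self
      _ = _ := by push_cast; ring
  by_cases hq' : q = ∞
  · subst hq'
    refine ⟨C, fun e he => ?_⟩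
    simp only [weightedNorm, if_true, lq_top]
    refine iSup_le fun k => ?_
    refine (hw.le_term hC he (n := 2 ^ k) le_rfl
      (pow_le_pow_right' (one_le (a := (2 : ℕ+))) (by omega))).trans ?_
    gcongr
    exact le_iSup (fun n : ℕ+ => ENNReal.ofReal (w n) * e n) _
  · have hr : 0 < q.toReal := ENNReal.toReal_pos hq.ne' hq'
    refine ⟨2 ^ (1 / q.toReal) * C, fun e he => ?_⟩
    rw [weightedNorm, if_neg hq', lq_of_ne_top hq', tsum_pnat_eq_tsum_dyadic_blocks]
    set F := fun n : ℕ+ => (ENNReal.ofReal (w n) * e n) ^ q.toReal / ((n : ℕ) : ℝ≥0∞) with hF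
    have key : ∀ k, (dyadicWeight w (k + 2) * e (dyadic (k + 2))) ^ q.toReal ≤
        (2 * C ^ q.toReal) * ∑ j ∈ Finset.range (2 ^ k), F (Nat.succPNat (2 ^ k - 1 + j)) := by
      intro k
      set x := dyadicWeight w (k + 2) * e (dyadic (k + 2)) with hx
      -- The block has `2 ^ k` terms with denominators up to `2 ^ (k + 1)`, whence the factor `2`.
      calc x ^ q.toReal = ∑ j ∈ Finset.range (2 ^ k), 2 * (x ^ q.toReal / (2 ^ (k + 1) : ℕ)) := by
            rw [Finset.sum_const, Finset.card_range, nsmul_eq_mul, ← mul_assoc,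
              ← ENNReal.mul_div_cancel (a := ((2 ^ (k + 1) : ℕ) : ℝ≥0∞)) (b := x ^ q.toReal)
                (by simp) (by simp)]
            congr 1
            · push_cast; ring
            · rw [ENNReal.mul_div_cancel (by simp) (by simp)]
        _ ≤ ∑ j ∈ Finset.range (2 ^ k),
            2 * (C ^ q.toReal * F (Nat.succPNat (2 ^ k - 1 + j))) := by
            gcongr with j hj
            have h2 := succPNat_le_two_pow (Finset.mem_range.1 hj)
            rw [hF, ← mul_div_assoc, ← ENNReal.mul_rpow_of_nonneg _ _ hr.le]
            gcongr
            · exact hw.le_term hC he (two_pow_le_succPNat k j) h2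
            · simpa using PNat.coe_le_coe _ _ |>.2 h2
        _ = _ := by rw [Finset.mul_sum]; simp only [mul_assoc]
    calc _ ≤ (∑' k, (2 * C ^ q.toReal) *
          ∑ j ∈ Finset.range (2 ^ k), F (Nat.succPNat (2 ^ k - 1 + j))) ^ (1 / q.toReal) := by
          gcongr with k
          exact key k
      _ = _ := by
          rw [ENNReal.tsum_mul_left, ENNReal.mul_rpow_of_nonneg _ _ (by positivity),
            ENNReal.mul_rpow_of_nonneg _ _ (by positivity), ← ENNReal.rpow_mul,
            mul_one_div_cancel hr.ne', ENNReal.rpow_one, ENNReal.coe_mul,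
            ENNReal.coe_rpow_of_nonneg _ (by positivity)]
          rfl

end weight

variable {𝕜 : Type*} [RCLike 𝕜] {X : Type*} [AddCommGroup X] [Module 𝕜 X] {p : ℝ}

/-! ### Elementary properties of `p`-norms -/

namespace PNorm

variable (N : PNorm 𝕜 X p)

theorem map_zero : N 0 = 0 := by
  have h := N.smul 0 0
  simpa using h

theorem map_neg (f : X) : N (-f) = N f := by
  have h := N.smul (-1) f
  simpa using h

theorem map_sub_comm (f g : X) : N (f - g) = N (g - f) := by
  rw [← N.map_neg, neg_sub]

theorem sum_rpow_le {ι : Type*} (s : Finset ι) (f : ι → X) :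
    N (∑ i ∈ s, f i) ^ p ≤ ∑ i ∈ s, N (f i) ^ p := by
  classical
  induction s using Finset.induction_on with
  | empty => simp [N.map_zero, Real.zero_rpow N.pos_p.ne']
  | insert i s hi ih =>
    rw [Finset.sum_insert hi, Finset.sum_insert hi]
    exact (N.add_rpow_le _ _).trans (by gcongr)

theorem le_of_rpow_le {x : X} {c t : ℝ} (hc : 0 ≤ c) (ht : 0 ≤ t)
    (h : N x ^ p ≤ c * t ^ p) : N x ≤ c ^ (1 / p) * t := by
  have hp := N.pos_p
  rw [← Real.rpow_le_rpow_iff (N.nonneg _) (by positivity) hp,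
    Real.mul_rpow (by positivity) ht, ← Real.rpow_mul hc, one_div_mul_cancel hp.ne', Real.rpow_one]
  exact h

theorem sum_le {ι : Type*} (s : Finset ι) (f : ι → X) {t : ℝ} (ht : 0 ≤ t)
    (h : ∀ i ∈ s, N (f i) ≤ t) : N (∑ i ∈ s, f i) ≤ (s.card : ℝ) ^ (1 / p) * t := by
  refine N.le_of_rpow_le (by positivity) ht ((N.sum_rpow_le s f).trans ?_)
  rw [← nsmul_eq_mul, ← Finset.sum_const]
  refine Finset.sum_le_sum fun i hi => ?_
  exact Real.rpow_le_rpow (N.nonneg _) (h i hi) N.pos_p.le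

/-- A constant in the triangle inequality of a `p`-norm. -/
def quasiConst (_N : PNorm 𝕜 X p) : NNReal := 2 ^ (1 / p)

theorem one_le_quasiConst : 1 ≤ N.quasiConst :=
  NNReal.one_le_rpow one_le_two (by have := N.pos_p; positivity)

theorem add_le (f g : X) : N (f + g) ≤ N.quasiConst * (N f + N g) := by
  have hf := N.nonneg f
  have hg := N.nonneg g
  have h : N (f + g) ^ p ≤ 2 * (N f + N g) ^ p := by
    refine (N.add_rpow_le f g).trans ?_
    rw [two_mul]
    have := N.pos_p
    gcongr <;> linarith
  have := N.le_of_rpow_le zero_le_two (by positivity) h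
  simpa [quasiConst] using this

theorem sub_le (f g : X) : N (f - g) ≤ N.quasiConst * (N f + N g) := by
  have := N.add_le f (-g)
  rwa [N.map_neg, ← sub_eq_add_neg] at this

/-- The `p`-norm with values in the extended nonnegative reals. -/
def en (f : X) : ℝ≥0∞ := ENNReal.ofReal (N f)

theorem en_ne_top (f : X) : N.en f ≠ ∞ := ENNReal.ofReal_ne_top

@[simp] theorem en_zero : N.en 0 = 0 := by simp [en, N.map_zero]

theorem en_eq_zero {f : X} (h : N.en f = 0) : f = 0 :=
  N.eq_zero f (le_antisymm (by simpa [en] using h) (N.nonneg f))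

theorem en_neg (f : X) : N.en (-f) = N.en f := by rw [en, N.map_neg, en]

theorem en_sub_comm (f g : X) : N.en (f - g) = N.en (g - f) := by
  rw [en, N.map_sub_comm, en]

theorem en_smul (c : 𝕜) (f : X) : N.en (c • f) = ‖c‖ₑ * N.en f := by
  rw [en, N.smul, ENNReal.ofReal_mul (norm_nonneg _), ofReal_norm, en]

theorem en_add_le (f g : X) : N.en (f + g) ≤ N.quasiConst * (N.en f + N.en g) := by
  have h : (N.quasiConst : ℝ≥0∞) = ENNReal.ofReal N.quasiConst := by simp
  rw [en, en, en, ← ENNReal.ofReal_add (N.nonneg _) (N.nonneg _), h,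
    ← ENNReal.ofReal_mul NNReal.zero_le_coe]
  exact ENNReal.ofReal_le_ofReal (N.add_le f g)

theorem en_sub_le (f g : X) : N.en (f - g) ≤ N.quasiConst * (N.en f + N.en g) := by
  have := N.en_add_le f (-g)
  rwa [N.en_neg, ← sub_eq_add_neg] at this

end PNorm

/-! ### Linear combinations and coordinates -/

namespace Basis

variable {N : PNorm 𝕜 X p} (B : Basis N)

theorem exists_vecConst : ∃ C : ℝ, 0 < C ∧ ∀ n, N (B.vec n) ≤ C := by
  obtain ⟨C, hC⟩ := B.vec_bounded
  exact ⟨max C 1, by positivity, fun n => (hC n).trans (le_max_left _ _)⟩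

theorem exists_coordConst : ∃ C : ℝ, 0 < C ∧ ∀ n f, ‖B.coord n f‖ ≤ C * N f := by
  obtain ⟨C, hC⟩ := B.coord_bounded
  refine ⟨max C 1, by positivity, fun n f => (hC n f).trans ?_⟩
  exact mul_le_mul_of_nonneg_right (le_max_left _ _) (N.nonneg f)

/-- A bound for the basis vectors. -/
def vecConst : ℝ := B.exists_vecConst.choose

theorem vecConst_pos : 0 < B.vecConst := B.exists_vecConst.choose_spec.1

theorem vec_le (n : ℕ) : N (B.vec n) ≤ B.vecConst := B.exists_vecConst.choose_spec.2 n

/-- A bound for the coordinate functionals. -/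
def coordConst : ℝ := B.exists_coordConst.choose

theorem coordConst_pos : 0 < B.coordConst := B.exists_coordConst.choose_spec.1

theorem coord_le (n : ℕ) (f : X) : ‖B.coord n f‖ ≤ B.coordConst * N f :=
  B.exists_coordConst.choose_spec.2 n f

theorem coord_indicator (a : ℕ → 𝕜) (A : Finset ℕ) (k : ℕ) :
    B.coord k (B.indicator a A) = if k ∈ A then a k else 0 := by
  simp [indicator, B.biorthogonal]

theorem indicator_le (a : ℕ → 𝕜) (A : Finset ℕ) {t : ℝ} (ht : 0 ≤ t)
    (h : ∀ n ∈ A, ‖a n‖ ≤ t) :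
    N (B.indicator a A) ≤ (A.card : ℝ) ^ (1 / p) * (B.vecConst * t) := by
  refine N.sum_le _ _ (mul_nonneg B.vecConst_pos.le ht) fun n hn => ?_
  rw [N.smul, mul_comm]
  exact mul_le_mul (B.vec_le n) (h n hn) (norm_nonneg _) B.vecConst_pos.le

/-- The span of the basis vectors with indices in a finite set. -/
def spanOn (A : Finset ℕ) : Submodule 𝕜 X := Submodule.span 𝕜 (B.vec '' (A : Set ℕ))

theorem vec_mem_spanOn {A : Finset ℕ} {n : ℕ} (hn : n ∈ A) : B.vec n ∈ B.spanOn A :=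
  Submodule.subset_span ⟨n, hn, rfl⟩

theorem indicator_mem_spanOn (a : ℕ → 𝕜) (A : Finset ℕ) : B.indicator a A ∈ B.spanOn A :=
  Submodule.sum_mem _ fun _ hn => Submodule.smul_mem _ _ (B.vec_mem_spanOn hn)

theorem spanOn_mono {A A' : Finset ℕ} (h : A ⊆ A') : B.spanOn A ≤ B.spanOn A' :=
  Submodule.span_mono (Set.image_mono (by exact_mod_cast h))

theorem indicator_add (a b : ℕ → 𝕜) (A : Finset ℕ) :
    B.indicator (fun n => a n + b n) A = B.indicator a A + B.indicator b A := by
  simp [indicator, add_smul, Finset.sum_add_distrib]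

theorem indicator_sub (a b : ℕ → 𝕜) (A : Finset ℕ) :
    B.indicator (fun n => a n - b n) A = B.indicator a A - B.indicator b A := by
  simp [indicator, sub_smul, Finset.sum_sub_distrib]

theorem indicator_union {A A' : Finset ℕ} (h : Disjoint A A') (a : ℕ → 𝕜) :
    B.indicator a (A ∪ A') = B.indicator a A + B.indicator a A' := Finset.sum_union h

theorem indicator_congr {a b : ℕ → 𝕜} {A : Finset ℕ} (h : ∀ n ∈ A, a n = b n) :
    B.indicator a A = B.indicator b A :=
  Finset.sum_congr rfl fun n hn => by rw [h n hn]

theorem eq_indicator_of_mem_spanOn {A : Finset ℕ} {u : X} (hu : u ∈ B.spanOn A) :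
    u = B.indicator (fun n => B.coord n u) A := by
  induction hu using Submodule.span_induction with
  | mem x hx =>
    obtain ⟨n, hn, rfl⟩ := hx
    have hn' : n ∈ A := hn
    simp only [indicator, B.biorthogonal]
    rw [Finset.sum_eq_single n]
    · simp
    · intro m _ hm; simp [hm]
    · intro h; exact absurd hn' h
  | zero => simp [indicator]
  | add x y _ _ hx hy =>
    conv_lhs => rw [hx, hy, ← B.indicator_add]
    simp
  | smul c x _ hx =>
    conv_lhs => rw [hx]
    simp [indicator, Finset.smul_sum, mul_smul]

theorem coord_eq_zero_of_mem_spanOn {A : Finset ℕ} {u : X} (hu : u ∈ B.spanOn A) {k : ℕ}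
    (hk : k ∉ A) : B.coord k u = 0 := by
  rw [B.eq_indicator_of_mem_spanOn hu, B.coord_indicator, if_neg hk]

theorem mem_spanOn_filter {A : Finset ℕ} {u : X} (hu : u ∈ B.spanOn A) {A' : Finset ℕ}
    (h : ∀ n ∈ A, B.coord n u ≠ 0 → n ∈ A') : u ∈ B.spanOn A' := by
  rw [B.eq_indicator_of_mem_spanOn hu]
  refine Submodule.sum_mem _ fun n hn => ?_
  by_cases h0 : B.coord n u = 0
  · simp [h0]
  · exact Submodule.smul_mem _ _ (B.vec_mem_spanOn (h n hn h0))

theorem exists_spanOn_of_mem_span {f : X} (hf : f ∈ Submodule.span 𝕜 (Set.range B.vec)) :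
    ∃ A, f ∈ B.spanOn A := by
  classical
  induction hf using Submodule.span_induction with
  | mem x hx =>
    obtain ⟨n, rfl⟩ := hx
    exact ⟨{n}, B.vec_mem_spanOn (by simp)⟩
  | zero => exact ⟨∅, Submodule.zero_mem _⟩
  | add x y _ _ hx hy =>
    obtain ⟨A, hA⟩ := hx
    obtain ⟨A', hA'⟩ := hy
    exact ⟨A ∪ A', Submodule.add_mem _ (B.spanOn_mono Finset.subset_union_left hA)
      (B.spanOn_mono Finset.subset_union_right hA')⟩
  | smul c x _ hx =>
    obtain ⟨A, hA⟩ := hx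
    exact ⟨A, Submodule.smul_mem _ _ hA⟩

theorem exists_spanOn_approx (f : X) {δ : ℝ} (hδ : 0 < δ) :
    ∃ A, ∃ g ∈ B.spanOn A, N (f - g) < δ := by
  obtain ⟨g, hg, h⟩ := B.dense_span f δ hδ
  obtain ⟨A, hA⟩ := B.exists_spanOn_of_mem_span hg
  exact ⟨A, g, hA, h⟩

/-- Coordinates tend to zero: this is clear on the span, and it passes to its closure because the
functionals are uniformly bounded. -/
theorem finite_le_coord (f : X) {δ : ℝ} (hδ : 0 < δ) : {n | δ ≤ ‖B.coord n f‖}.Finite := by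
  obtain ⟨A, g, hg, h⟩ := B.exists_spanOn_approx f (div_pos hδ B.coordConst_pos)
  refine A.finite_toSet.subset fun n hn => ?_
  by_contra hnA
  have h1 := B.coord_le n (f - g)
  rw [_root_.map_sub, B.coord_eq_zero_of_mem_spanOn hg hnA, sub_zero] at h1
  rw [lt_div_iff₀ B.coordConst_pos] at h
  have : δ ≤ ‖B.coord n f‖ := hn
  linarith

/-- The coordinates of norm less than `δ` have a common bound less than `δ`. -/
theorem exists_gap (f : X) {δ : ℝ} (hδ : 0 < δ) :
    ∃ τ, 0 ≤ τ ∧ τ < δ ∧ ∀ n, ‖B.coord n f‖ < δ → ‖B.coord n f‖ ≤ τ := by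
  -- Only finitely many coordinates have modulus in `[δ / 2, δ)`, so the supremum of those is
  -- attained.
  set s := (B.finite_le_coord f (half_pos hδ)).toFinset with hs
  set s' := s.filter (fun n => ‖B.coord n f‖ < δ) with hs'
  rcases s'.eq_empty_or_nonempty with h | h
  · refine ⟨δ / 2, by positivity, by linarith, fun n hn => ?_⟩
    by_contra! hcon
    have : n ∈ s' := by simp [hs', hs, hn, hcon.le]
    simp [h] at this
  · refine ⟨s'.sup' h fun n => ‖B.coord n f‖, ?_, ?_, fun n hn => ?_⟩
    · obtain ⟨n, hn⟩ := h
      exact (norm_nonneg _).trans (Finset.le_sup' (fun n => ‖B.coord n f‖) hn)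
    · rw [Finset.sup'_lt_iff]
      intro n hn
      exact (Finset.mem_filter.1 hn).2
    · by_cases h2 : δ / 2 ≤ ‖B.coord n f‖
      · exact Finset.le_sup' (fun n => ‖B.coord n f‖) (by simp [hs', hs, hn, h2])
      · obtain ⟨m, hm⟩ := h
        have hm2 : δ / 2 ≤ ‖B.coord m f‖ := by simpa [hs] using (Finset.mem_filter.1 hm).1
        exact (not_le.1 h2).le.trans (hm2.trans (Finset.le_sup' (fun n => ‖B.coord n f‖) hm))

/-! ### Greedy sets -/

theorem isGreedySet_empty (f : X) : B.IsGreedySet f 0 ∅ := ⟨rfl, by simp⟩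

theorem exists_max_coord_notMem (f : X) (A : Finset ℕ) :
    ∃ n ∉ A, ∀ k ∉ A, ‖B.coord k f‖ ≤ ‖B.coord n f‖ := by
  obtain ⟨n₀, hn₀⟩ := Infinite.exists_notMem_finset A
  by_cases h : ∃ n ∉ A, B.coord n f ≠ 0
  · obtain ⟨m, hm, hm0⟩ := h
    set s := (B.finite_le_coord f (norm_pos_iff.2 hm0)).toFinset with hs
    have hms : m ∈ s \ A := by simp [hs, hm]
    obtain ⟨n, hn, hmax⟩ := (s \ A).exists_max_image (fun n => ‖B.coord n f‖) ⟨m, hms⟩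
    refine ⟨n, (Finset.mem_sdiff.1 hn).2, fun k hk => ?_⟩
    by_cases hks : ‖B.coord m f‖ ≤ ‖B.coord k f‖
    · exact hmax k (by simp [hs, hk, hks])
    · exact (not_le.1 hks).le.trans (hmax m hms)
  · push Not at h
    exact ⟨n₀, hn₀, fun k hk => by rw [h k hk, h n₀ hn₀]⟩

theorem exists_isGreedySet (f : X) (m : ℕ) : ∃ A, B.IsGreedySet f m A := by
  classical
  induction m with
  | zero => exact ⟨∅, B.isGreedySet_empty f⟩
  | succ m ih =>
    obtain ⟨A, hA, hg⟩ := ih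
    obtain ⟨n, hn, hmax⟩ := B.exists_max_coord_notMem f A
    refine ⟨insert n A, by rw [Finset.card_insert_of_notMem hn, hA], fun i hi k hk => ?_⟩
    rw [Finset.mem_insert, not_or] at hk
    rcases Finset.mem_insert.1 hi with rfl | hi
    · exact hmax k hk.2
    · exact hg i hi k hk.2

variable {B}

/-- Discarding an index with smallest coordinate keeps a set greedy. This yields monotonicity of the
Chebyshev-greedy errors. -/
theorem IsGreedySet.exists_subset {f : X} {m l : ℕ} {A : Finset ℕ} (hA : B.IsGreedySet f m A)
    (hl : l ≤ m) : ∃ A' ⊆ A, B.IsGreedySet f l A' := by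
  classical
  induction m, hl using Nat.le_induction generalizing A with
  | base => exact ⟨A, subset_rfl, hA⟩
  | succ m _ ih =>
    obtain ⟨n, hn, hmin⟩ := A.exists_min_image (fun n => ‖B.coord n f‖)
      (Finset.card_pos.1 (by rw [hA.1]; omega))
    obtain ⟨A', hA', h⟩ := ih (A := A.erase n) ⟨by rw [Finset.card_erase_of_mem hn, hA.1]; rfl, by
      intro i hi k hk
      by_cases hkn : k = n
      · subst hkn; exact hmin i (Finset.mem_of_mem_erase hi)
      · exact hA.2 i (Finset.mem_of_mem_erase hi) k
          (fun h => hk (Finset.mem_erase.2 ⟨hkn, h⟩))⟩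
    exact ⟨A', hA'.trans (Finset.erase_subset _ _), h⟩

variable (B)

/-! ### Distances to coordinate subspaces -/

/-- The distance from a vector to a coordinate subspace. -/
def distOn (f : X) (A : Finset ℕ) : ℝ≥0∞ := ⨅ g ∈ B.spanOn A, N.en (f - g)

theorem distOn_le {f : X} {A : Finset ℕ} {g : X} (hg : g ∈ B.spanOn A) :
    B.distOn f A ≤ N.en (f - g) := iInf₂_le g hg

theorem distOn_le_en (f : X) (A : Finset ℕ) : B.distOn f A ≤ N.en f := by
  simpa using B.distOn_le (f := f) (Submodule.zero_mem (B.spanOn A))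

theorem distOn_anti (f : X) {A A' : Finset ℕ} (h : A ⊆ A') : B.distOn f A' ≤ B.distOn f A :=
  le_iInf₂ fun _ hg => B.distOn_le (B.spanOn_mono h hg)

theorem distOn_eq_zero {f : X} {A : Finset ℕ} (hf : f ∈ B.spanOn A) : B.distOn f A = 0 :=
  le_antisymm (by simpa using B.distOn_le (f := f) hf) zero_le

theorem le_mul_distOn_add {f : X} {A : Finset ℕ} {C : NNReal} {c x : ℝ≥0∞}
    (h : ∀ u ∈ B.spanOn A, x ≤ C * (N.en (f - u) + c)) :
    x ≤ C * (B.distOn f A + c) := by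
  rw [distOn, ENNReal.iInf_add]
  simp_rw [ENNReal.iInf_add]
  -- The inner infimum is `∞` off the span, and multiplication by `0` would not commute with it.
  rcases eq_or_ne C 0 with rfl | hC
  · simpa using h 0 (Submodule.zero_mem _)
  · rw [ENNReal.mul_iInf_of_ne (by simpa using hC) ENNReal.coe_ne_top]
    refine le_iInf fun u => ?_
    rw [ENNReal.mul_iInf_of_ne (by simpa using hC) ENNReal.coe_ne_top]
    exact le_iInf fun hu => h u hu

theorem distOn_add_le (f g : X) (A : Finset ℕ) :
    B.distOn (f + g) A ≤ N.quasiConst * (B.distOn f A + N.en g) := by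
  refine B.le_mul_distOn_add fun u hu => (B.distOn_le hu).trans ?_
  rw [add_sub_right_comm]
  exact N.en_add_le _ _

theorem distOn_add_of_mem (f : X) {g : X} {A : Finset ℕ} (hg : g ∈ B.spanOn A) :
    B.distOn (f + g) A = B.distOn f A := by
  apply le_antisymm
  · refine le_iInf₂ fun u hu => (B.distOn_le (Submodule.add_mem _ hu hg)).trans (le_of_eq ?_)
    congr 1; abel
  · refine le_iInf₂ fun u hu => (B.distOn_le (Submodule.sub_mem _ hu hg)).trans (le_of_eq ?_)
    congr 1; abel

theorem distOn_smul_le (c : 𝕜) (f : X) (A : Finset ℕ) :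
    B.distOn (c • f) A ≤ ‖c‖ₑ * B.distOn f A := by
  rcases eq_or_ne c 0 with rfl | hc
  · simpa using B.distOn_le_en (0 : X) A
  · simp only [distOn]
    rw [ENNReal.mul_iInf_of_ne (by simpa using hc) (by simp)]
    refine le_iInf fun u => ?_
    rw [ENNReal.mul_iInf_of_ne (by simpa using hc) (by simp)]
    refine le_iInf fun hu => (B.distOn_le (Submodule.smul_mem _ c hu)).trans ?_
    rw [← smul_sub, N.en_smul]

end Basis

namespace Basis

variable {N : PNorm 𝕜 X p} (B : Basis N)

/-! ### Best approximation errors and Chebyshev-greedy errors -/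

theorem bestError_le (f : X) {m : ℕ} {A : Finset ℕ} (hA : A.card ≤ m) {g : X}
    (hg : g ∈ B.spanOn A) : B.bestError f m ≤ N.en (f - g) := by
  rw [B.eq_indicator_of_mem_spanOn hg]
  exact iInf_le_of_le A (iInf_le_of_le hA (iInf_le _ _))

theorem exists_of_bestError_lt {f : X} {m : ℕ} {c : ℝ≥0∞} (h : B.bestError f m < c) :
    ∃ A : Finset ℕ, A.card ≤ m ∧ ∃ g ∈ B.spanOn A, N.en (f - g) < c := by
  simp only [bestError, iInf_lt_iff] at h
  obtain ⟨A, hA, a, h⟩ := h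
  exact ⟨A, hA, B.indicator a A, B.indicator_mem_spanOn a A, h⟩

theorem bestError_le_en (f : X) (m : ℕ) : B.bestError f m ≤ N.en f := by
  simpa using B.bestError_le f (A := ∅) (m := m) (by simp) (Submodule.zero_mem _)

theorem bestError_ne_top (f : X) (m : ℕ) : B.bestError f m ≠ ∞ :=
  ne_top_of_le_ne_top (N.en_ne_top f) (B.bestError_le_en f m)

theorem bestError_antitone (f : X) : Antitone (B.bestError f) := by
  intro m n hmn
  refine le_of_forall_gt fun c hc => ?_
  obtain ⟨A, hA, g, hg, h⟩ := B.exists_of_bestError_lt hc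
  exact (B.bestError_le f (hA.trans hmn) hg).trans_lt h

theorem bestError_zero (f : X) : B.bestError f 0 = N.en f := by
  refine le_antisymm (B.bestError_le_en f 0) (le_of_forall_gt fun c hc => ?_)
  obtain ⟨A, hA, g, hg, h⟩ := B.exists_of_bestError_lt hc
  obtain rfl : A = ∅ := by simpa using hA
  have : g = 0 := by simpa [spanOn] using hg
  simpa [this] using h

theorem bestError_eq_zero {f : X} {m : ℕ} {A : Finset ℕ} (hA : A.card ≤ m)
    (hf : f ∈ B.spanOn A) : B.bestError f m = 0 :=
  le_antisymm (by simpa using B.bestError_le f hA hf) zero_le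

theorem bestError_add_le (f g : X) (m n : ℕ) :
    B.bestError (f + g) (m + n) ≤ N.quasiConst * (B.bestError f m + B.bestError g n) := by
  classical
  refine ENNReal.le_of_forall_pos_le_add fun δ hδ _ => ?_
  set K := N.quasiConst
  have hK : K ≠ 0 := (zero_lt_one.trans_le N.one_le_quasiConst).ne'
  have hδ' : ((δ / (2 * K) : NNReal) : ℝ≥0∞) ≠ 0 := by
    simpa using ⟨hδ.ne', hK⟩
  obtain ⟨A, hA, u, hu, h1⟩ := B.exists_of_bestError_lt
    (ENNReal.lt_add_right (B.bestError_ne_top f m) hδ')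
  obtain ⟨A', hA', u', hu', h2⟩ := B.exists_of_bestError_lt
    (ENNReal.lt_add_right (B.bestError_ne_top g n) hδ')
  calc B.bestError (f + g) (m + n) ≤ N.en (f + g - (u + u')) :=
        B.bestError_le _ (A := A ∪ A') ((Finset.card_union_le _ _).trans (add_le_add hA hA'))
          (Submodule.add_mem _ (B.spanOn_mono Finset.subset_union_left hu)
            (B.spanOn_mono Finset.subset_union_right hu'))
    _ = N.en ((f - u) + (g - u')) := by congr 1; abel
    _ ≤ K * (N.en (f - u) + N.en (g - u')) := N.en_add_le _ _
    _ ≤ K * ((B.bestError f m + (δ / (2 * K) : NNReal)) +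
          (B.bestError g n + (δ / (2 * K) : NNReal))) := by gcongr
    _ = K * (B.bestError f m + B.bestError g n) + (K * (2 * (δ / (2 * K))) : NNReal) := by
        push_cast; ring
    _ = _ := by
        congr 2
        field_simp

theorem bestError_smul_le (c : 𝕜) (f : X) (m : ℕ) :
    B.bestError (c • f) m ≤ ‖c‖ₑ * B.bestError f m := by
  rcases eq_or_ne c 0 with rfl | hc
  · simpa using B.bestError_le_en (0 : X) m
  · rw [mul_comm, ← ENNReal.div_le_iff_le_mul (by simp [hc]) (by simp)]
    refine le_of_forall_gt fun x hx => ?_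
    obtain ⟨A, hA, g, hg, h⟩ := B.exists_of_bestError_lt hx
    refine lt_of_le_of_lt ?_ h
    rw [ENNReal.div_le_iff_le_mul (by simp [hc]) (by simp), mul_comm, ← N.en_smul, smul_sub]
    exact B.bestError_le _ hA (Submodule.smul_mem _ _ hg)

theorem bestError_le_distOn (f : X) {m : ℕ} {A : Finset ℕ} (hA : A.card ≤ m) :
    B.bestError f m ≤ B.distOn f A :=
  le_iInf₂ fun _ hg => B.bestError_le f hA hg

theorem tendsto_bestError (f : X) {δ : ℝ≥0∞} (hδ : 0 < δ) : ∃ m, B.bestError f m < δ := by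
  obtain ⟨δ', h0, h1⟩ := ENNReal.lt_iff_exists_nnreal_btwn.1 hδ
  obtain ⟨A, g, hg, h⟩ := B.exists_spanOn_approx f (δ := δ') (by exact_mod_cast h0)
  refine ⟨A.card, (B.bestError_le f le_rfl hg).trans_lt (lt_of_le_of_lt ?_ h1)⟩
  rw [PNorm.en, ← ENNReal.ofReal_coe_nnreal]
  exact ENNReal.ofReal_le_ofReal h.le

variable {B} in
theorem IsGreedySet.distOn_le {f : X} {m : ℕ} {A : Finset ℕ} (hA : B.IsGreedySet f m A) :
    B.distOn f A ≤ B.chebyshevError f m :=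
  le_iSup₂ (f := fun (A : Finset ℕ) (_ : B.IsGreedySet f m A) => B.distOn f A) A hA

theorem chebyshevError_le {f : X} {m : ℕ} {c : ℝ≥0∞}
    (h : ∀ A, B.IsGreedySet f m A → B.distOn f A ≤ c) : B.chebyshevError f m ≤ c :=
  iSup₂_le h

theorem chebyshevError_le_en (f : X) (m : ℕ) : B.chebyshevError f m ≤ N.en f :=
  B.chebyshevError_le fun A _ => B.distOn_le_en f A

theorem chebyshevError_zero (f : X) : B.chebyshevError f 0 = N.en f := by
  refine le_antisymm (B.chebyshevError_le_en f 0) (le_trans ?_ (B.isGreedySet_empty f).distOn_le)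
  rw [← B.bestError_zero]
  exact B.bestError_le_distOn f le_rfl

theorem chebyshevError_antitone (f : X) : Antitone (B.chebyshevError f) := by
  intro m n hmn
  refine B.chebyshevError_le fun A hA => ?_
  obtain ⟨A', hA', h⟩ := hA.exists_subset hmn
  exact (B.distOn_anti f hA').trans h.distOn_le

theorem bestError_le_chebyshevError (f : X) (m : ℕ) :
    B.bestError f m ≤ B.chebyshevError f m := by
  obtain ⟨A, hA⟩ := B.exists_isGreedySet f m
  exact (B.bestError_le_distOn f hA.1.le).trans hA.distOn_le

/-- A greedy set of cardinality `m` whose distance is at least half the Chebyshev-greedy error. -/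
theorem exists_isGreedySet_chebyshevError_le (f : X) (m : ℕ) :
    ∃ A, B.IsGreedySet f m A ∧ B.chebyshevError f m ≤ 2 * B.distOn f A := by
  rcases eq_or_ne (B.chebyshevError f m) 0 with h0 | h0
  · obtain ⟨A, hA⟩ := B.exists_isGreedySet f m
    exact ⟨A, hA, by simp [h0]⟩
  · have hlt : B.chebyshevError f m / 2 < B.chebyshevError f m :=
      ENNReal.half_lt_self h0 (ne_top_of_le_ne_top (N.en_ne_top f) (B.chebyshevError_le_en f m))
    nth_rewrite 2 [chebyshevError] at hlt
    simp only [lt_iSup_iff] at hlt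
    obtain ⟨A, hA, h⟩ := hlt
    refine ⟨A, hA, ?_⟩
    rw [mul_comm]
    exact (ENNReal.div_le_iff_le_mul (by simp) (by simp)).1 h.le

/-- The coordinates that a greedy set of cardinality `m` misses are controlled by the error of
best approximation with `m - 1` terms. -/
theorem IsGreedySet.enorm_coord_le {B : Basis N} {f : X} {m : ℕ} {A : Finset ℕ}
    (hA : B.IsGreedySet f (m + 1) A) {k : ℕ} (hk : k ∉ A) :
    ENNReal.ofReal ‖B.coord k f‖ ≤ ENNReal.ofReal B.coordConst * B.bestError f m := by
  have hc := B.coordConst_pos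
  rw [mul_comm, ← ENNReal.div_le_iff_le_mul (by simp [hc]) (by simp)]
  refine le_of_forall_gt fun x hx => ?_
  obtain ⟨D, hD, g, hg, h⟩ := B.exists_of_bestError_lt hx
  refine lt_of_le_of_lt ?_ h
  -- By counting, some index of the greedy set lies outside the approximating set `D`; there `f` and
  -- `f - g` have the same coordinate, which dominates all the missed ones.
  obtain ⟨i, hi, hiD⟩ := Finset.exists_mem_notMem_of_card_lt_card
    (s := D) (t := A) (by rw [hA.1]; omega)
  rw [ENNReal.div_le_iff_le_mul (by simp [hc]) (by simp), mul_comm, PNorm.en,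
    ← ENNReal.ofReal_mul hc.le]
  refine ENNReal.ofReal_le_ofReal ((hA.2 i hi k hk).trans ?_)
  have := B.coord_le i (f - g)
  rwa [map_sub, B.coord_eq_zero_of_mem_spanOn hg hiD, sub_zero] at this

/-- Enlarging a greedy set by a fixed finite set does not change the distance much, up to the
error of best approximation. -/
theorem exists_distOn_le_distOn_union (S : Finset ℕ) : ∃ C : NNReal, ∀ (f : X) (m : ℕ)
    (A : Finset ℕ), B.IsGreedySet f (m + 1) A →
      B.distOn f A ≤ C * (B.distOn f (S ∪ A) + B.bestError f m) := by
  classical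
  set K := N.quasiConst
  set c : NNReal := Real.toNNReal ((S.card : ℝ) ^ (1 / p) * (B.vecConst * B.coordConst)) with hc
  have hvc := B.vecConst_pos
  have hcc := B.coordConst_pos
  have hp := N.pos_p
  have bound : ∀ (a : ℕ → 𝕜) (x : ℝ≥0∞) (S' : Finset ℕ), S' ⊆ S →
      (∀ n ∈ S', ENNReal.ofReal ‖a n‖ ≤ ENNReal.ofReal B.coordConst * x) →
      N.en (B.indicator a S') ≤ c * x := by
    intro a x S' hS' h
    rcases eq_or_ne x ∞ with rfl | hx
    · rcases S'.eq_empty_or_nonempty with rfl | ⟨n, hn⟩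
      · simp [indicator]
      · have : c ≠ 0 := by
          have hcard : 0 < S.card := Finset.card_pos.2 ⟨n, hS' hn⟩
          have : 0 < (S.card : ℝ) ^ (1 / p) * (B.vecConst * B.coordConst) := by positivity
          simpa [hc] using this
        rw [ENNReal.mul_top (by simpa using this)]
        exact le_top
    lift x to NNReal using hx
    have h1 := B.indicator_le a S' (t := B.coordConst * x) (by positivity) fun n hn => by
      have h2 := h n hn
      rw [← ENNReal.ofReal_coe_nnreal, ← ENNReal.ofReal_mul hcc.le] at h2
      exact (ENNReal.ofReal_le_ofReal_iff (by positivity)).1 h2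
    rw [PNorm.en, ← ENNReal.ofReal_coe_nnreal (p := c), ← ENNReal.ofReal_coe_nnreal (p := x),
      ← ENNReal.ofReal_mul NNReal.zero_le_coe]
    refine ENNReal.ofReal_le_ofReal (h1.trans ?_)
    rw [hc, Real.coe_toNNReal _ (by positivity), mul_assoc, mul_assoc]
    gcongr
  refine ⟨K * (1 + c) * K, fun f m A hA => ?_⟩
  refine B.le_mul_distOn_add fun u hu => ?_
  set v := B.indicator (fun n => B.coord n u) A with hv
  have hvA : v ∈ B.spanOn A := B.indicator_mem_spanOn _ _
  -- Only the part of `u` over `A` is kept. The discarded part over `S \ A` is that of `f` minus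
  -- that of `f - u`: the first is small since `A` is greedy, the second since the coordinates are
  -- bounded functionals and `S` is fixed.
  have hsplit : u = v + B.indicator (fun n => B.coord n u) (S \ A) := by
    rw [hv, ← B.indicator_union Finset.disjoint_sdiff, Finset.union_sdiff_self_eq_union,
      Finset.union_comm]
    exact B.eq_indicator_of_mem_spanOn hu
  have e1 : f - v = (f - u) + B.indicator (fun n => B.coord n u) (S \ A) := by
    rw [eq_sub_of_add_eq hsplit.symm]; abel
  have e2 : B.indicator (fun n => B.coord n u) (S \ A) =
      B.indicator (fun n => B.coord n f) (S \ A) -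
        B.indicator (fun n => B.coord n (f - u)) (S \ A) := by
    rw [← B.indicator_sub]
    exact B.indicator_congr fun n _ => by simp
  have b1 : N.en (B.indicator (fun n => B.coord n f) (S \ A)) ≤ c * B.bestError f m :=
    bound _ _ _ Finset.sdiff_subset fun n hn => hA.enorm_coord_le (Finset.mem_sdiff.1 hn).2
  have b2 : N.en (B.indicator (fun n => B.coord n (f - u)) (S \ A)) ≤ c * N.en (f - u) :=
    bound _ _ _ Finset.sdiff_subset fun n hn => by
      rw [PNorm.en, ← ENNReal.ofReal_mul hcc.le]
      exact ENNReal.ofReal_le_ofReal (B.coord_le n _)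
  have hK : (1 : ℝ≥0∞) ≤ K := by exact_mod_cast N.one_le_quasiConst
  set x := N.en (f - u)
  set y := B.bestError f m
  calc B.distOn f A ≤ N.en (f - v) := B.distOn_le hvA
    _ ≤ K * (x + N.en (B.indicator (fun n => B.coord n u) (S \ A))) := by
        rw [e1]; exact N.en_add_le _ _
    _ ≤ K * (K * (x + y) + K * (c * y + c * x)) := by
        rw [e2]
        gcongr
        · calc x ≤ 1 * (x + y) := by rw [one_mul]; exact le_self_add
            _ ≤ _ := by gcongr
        · exact (N.en_sub_le _ _).trans (by gcongr)
    _ = _ := by push_cast; ring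

/-! ### Dyadic forms of the class quasi-norms -/

variable (w : ℕ+ → ℝ) (q : ℝ≥0∞)

/-- The dyadic form of the quasi-norm of `𝒜^w_q`. -/
def anorm (f : X) : ℝ≥0∞ := dyadicNorm w q (B.bestError f ∘ dyadic)

/-- The dyadic form of the quasi-norm of `𝒞𝒢^w_q`. -/
def gnorm (f : X) : ℝ≥0∞ := dyadicNorm w q (B.chebyshevError f ∘ dyadic)

variable {w q}

theorem exists_approxNorm_le_anorm (hw : IsWeightIDPlus w) (hq : 0 < q) :
    ∃ C : NNReal, ∀ f, B.approxNorm w q f ≤ C * B.anorm w q f := by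
  obtain ⟨C, hC⟩ := hw.weightedNorm_le_dyadicNorm hq
  refine ⟨C, fun f => le_trans (le_of_eq ?_) (hC _ (B.bestError_antitone f))⟩
  rw [B.bestError_zero]; rfl

theorem exists_anorm_le_approxNorm (hw : IsWeightIDPlus w) (hq : 0 < q) :
    ∃ C : NNReal, ∀ f, B.anorm w q f ≤ C * B.approxNorm w q f := by
  obtain ⟨C, hC⟩ := hw.dyadicNorm_le_weightedNorm hq
  refine ⟨C, fun f => (hC _ (B.bestError_antitone f)).trans (le_of_eq ?_)⟩
  rw [B.bestError_zero]; rfl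

theorem exists_chebyshevNorm_le_gnorm (hw : IsWeightIDPlus w) (hq : 0 < q) :
    ∃ C : NNReal, ∀ f, B.chebyshevNorm w q f ≤ C * B.gnorm w q f := by
  obtain ⟨C, hC⟩ := hw.weightedNorm_le_dyadicNorm hq
  refine ⟨C, fun f => le_trans (le_of_eq ?_) (hC _ (B.chebyshevError_antitone f))⟩
  rw [B.chebyshevError_zero]; rfl

theorem exists_gnorm_le_chebyshevNorm (hw : IsWeightIDPlus w) (hq : 0 < q) :
    ∃ C : NNReal, ∀ f, B.gnorm w q f ≤ C * B.chebyshevNorm w q f := by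
  obtain ⟨C, hC⟩ := hw.dyadicNorm_le_weightedNorm hq
  refine ⟨C, fun f => (hC _ (B.chebyshevError_antitone f)).trans (le_of_eq ?_)⟩
  rw [B.chebyshevError_zero]; rfl

theorem anorm_le_gnorm (f : X) : B.anorm w q f ≤ B.gnorm w q f :=
  dyadicNorm_mono fun _ => B.bestError_le_chebyshevError f _

theorem anorm_smul_le (hq : 0 < q) (c : 𝕜) (f : X) :
    B.anorm w q (c • f) ≤ ‖c‖ₑ * B.anorm w q f := by
  rw [anorm, anorm, ← dyadicNorm_const_mul hq]
  exact dyadicNorm_mono fun k => B.bestError_smul_le c f _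

theorem weight_mul_en_le_anorm (hq : 0 < q) (f : X) :
    dyadicWeight w 0 * N.en f ≤ B.anorm w q f := by
  have := le_dyadicNorm (w := w) hq (B.bestError f ∘ dyadic) 0
  rwa [Function.comp_apply, dyadic_zero, B.bestError_zero] at this

theorem exists_anorm_add_le (hw : IsWeightIDPlus w) (hq : 0 < q) :
    ∃ C : NNReal, 1 ≤ C ∧ ∀ f g,
      B.anorm w q (f + g) ≤ C * (B.anorm w q f + B.anorm w q g) := by
  obtain ⟨C₁, h₁⟩ := dyadicNorm_add_le w hq
  obtain ⟨C₂, h₂⟩ := hw.dyadicNorm_shift_le hq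
  refine ⟨N.quasiConst * (C₁ * C₂) + 1, le_add_self, fun f g => ?_⟩
  calc B.anorm w q (f + g) ≤ dyadicNorm w q (fun k => N.quasiConst *
        ((B.bestError f ∘ dyadic) (k - 1) + (B.bestError g ∘ dyadic) (k - 1))) := by
        refine dyadicNorm_mono fun k => ?_
        cases k with
        | zero =>
          have := B.bestError_add_le f g 0 0
          simpa using this
        | succ k =>
          exact (B.bestError_antitone _ (dyadic_add_self_le k)).trans (B.bestError_add_le f g _ _)
    _ = N.quasiConst * dyadicNorm w q (fun k =>
          (B.bestError f ∘ dyadic) (k - 1) + (B.bestError g ∘ dyadic) (k - 1)) :=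
        dyadicNorm_const_mul hq _ _
    _ ≤ N.quasiConst * (C₁ * (C₂ * B.anorm w q f + C₂ * B.anorm w q g)) := by
        gcongr
        refine (h₁ (fun k => (B.bestError f ∘ dyadic) (k - 1))
          (fun k => (B.bestError g ∘ dyadic) (k - 1))).trans ?_
        gcongr
        · exact h₂ (B.bestError f ∘ dyadic)
        · exact h₂ (B.bestError g ∘ dyadic)
    _ = (N.quasiConst * (C₁ * C₂) : NNReal) * (B.anorm w q f + B.anorm w q g) := by
        push_cast; ring
    _ ≤ _ := by gcongr; exact le_self_add

/-- On `m`-term combinations the class quasi-norm is controlled by the `p`-norm. -/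
theorem exists_anorm_le_en (hw : IsWeightIDPlus w) (hq : 0 < q) (m : ℕ) :
    ∃ C : NNReal, ∀ (A : Finset ℕ) (f : X), A.card ≤ m → f ∈ B.spanOn A →
      B.anorm w q f ≤ C * N.en f := by
  obtain ⟨C, hC⟩ := hw.dyadicNorm_truncation_le hq
  refine ⟨C * (dyadicWeight w (m + 1)).toNNReal, fun A f hA hf => ?_⟩
  rw [ENNReal.coe_mul, ENNReal.coe_toNNReal (dyadicWeight_ne_top _), mul_comm]
  calc B.anorm w q f ≤ dyadicNorm w q (fun k => N.en f * (if k < m + 1 then 1 else 0)) := by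
        refine dyadicNorm_mono fun k => ?_
        split_ifs with hk
        · simpa using B.bestError_le_en f _
        · obtain ⟨j, rfl⟩ : ∃ j, k = j + 1 := ⟨k - 1, by omega⟩
          simp only [Function.comp_apply, dyadic_succ, mul_zero, nonpos_iff_eq_zero]
          exact B.bestError_eq_zero (hA.trans ((by omega : m ≤ j).trans j.lt_two_pow_self.le)) hf
    _ = N.en f * _ := dyadicNorm_const_mul hq _ _
    _ ≤ _ := by gcongr; exact hC _

/-- Lower semicontinuity of the class quasi-norm, up to a constant. -/
theorem exists_anorm_le_of_approx (hw : IsWeightIDPlus w) (hq : 0 < q) :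
    ∃ C : NNReal, ∀ (f : X) (M : NNReal), 0 < M →
      (∀ δ : ℝ, 0 < δ → ∃ g, N (f - g) < δ ∧ B.anorm w q g ≤ M) → B.anorm w q f ≤ C * M := by
  obtain ⟨C₀, hC₀⟩ := hw.dyadicNorm_truncation_le hq
  obtain ⟨C₁, hC₁⟩ := dyadicNorm_add_le w hq
  refine ⟨N.quasiConst * (C₁ * 2), fun f M hM h => dyadicNorm_le_of_truncations hq fun L => ?_⟩
  -- Chosen so that an approximation error `M / x`, repeated over the first `L` entries, contributes
  -- at most `M`.
  set x : NNReal := C₀ * (dyadicWeight w L).toNNReal + 1 with hx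
  have hxpos : 0 < x := by positivity
  obtain ⟨g, hg, hgM⟩ := h (M / x) (by positivity)
  have hg' : N.en (f - g) ≤ (M / x : NNReal) := by
    rw [PNorm.en, ← ENNReal.ofReal_coe_nnreal]
    exact ENNReal.ofReal_le_ofReal (by push_cast; exact hg.le)
  calc dyadicNorm w q (fun k => if k < L then (B.bestError f ∘ dyadic) k else 0)
      ≤ dyadicNorm w q (fun k => N.quasiConst * ((B.bestError g ∘ dyadic) k +
          N.en (f - g) * (if k < L then 1 else 0))) := by
        refine dyadicNorm_mono fun k => ?_
        split_ifs with hk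
        · have := B.bestError_add_le g (f - g) (dyadic k) 0
          rw [B.bestError_zero] at this
          simpa using this
        · exact zero_le
    _ = N.quasiConst * dyadicNorm w q (fun k => (B.bestError g ∘ dyadic) k +
          N.en (f - g) * (if k < L then 1 else 0)) := dyadicNorm_const_mul hq _ _
    _ ≤ N.quasiConst * (C₁ * (M + M)) := by
        gcongr
        refine (hC₁ _ _).trans ?_
        gcongr
        · exact hgM
        · rw [dyadicNorm_const_mul hq]
          calc _ ≤ ((M / x : NNReal) : ℝ≥0∞) * (C₀ * dyadicWeight w L) := by gcongr; exact hC₀ L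
            _ ≤ ((M / x : NNReal) : ℝ≥0∞) * x := by
                gcongr
                rw [hx, ENNReal.coe_add, ENNReal.coe_mul,
                  ENNReal.coe_toNNReal (dyadicWeight_ne_top _)]
                exact le_self_add
            _ = M := by
                rw [← ENNReal.coe_mul, div_mul_cancel₀ _ hxpos.ne']
    _ = _ := by push_cast; ring

end Basis

theorem exists_pos_forall_le_of_finset {ι : Type*} (S : Finset ι) (F : ι → ℝ)
    (h : ∀ n ∈ S, 0 < F n) : ∃ τ, 0 < τ ∧ ∀ n ∈ S, τ ≤ F n := by
  rcases S.eq_empty_or_nonempty with rfl | hS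
  · exact ⟨1, one_pos, by simp⟩
  · obtain ⟨m, hm, hmin⟩ := S.exists_min_image F hS
    exact ⟨F m, h m hm, hmin⟩

namespace Basis

variable {N : PNorm 𝕜 X p} (B : Basis N) {w : ℕ+ → ℝ} {q : ℝ≥0∞}

/-! ### Boundedness on the span of the basis -/

theorem chebyshevError_smul_le {c : 𝕜} (hc : c ≠ 0) (f : X) (m : ℕ) :
    B.chebyshevError (c • f) m ≤ ‖c‖ₑ * B.chebyshevError f m := by
  refine B.chebyshevError_le fun A hA => (B.distOn_smul_le c f A).trans ?_
  gcongr
  refine IsGreedySet.distOn_le ⟨hA.1, fun n hn k hk => ?_⟩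
  have := hA.2 n hn k hk
  simp only [map_smul, smul_eq_mul, norm_mul] at this
  exact le_of_mul_le_mul_left this (norm_pos_iff.2 hc)

theorem gnorm_smul_le (hq : 0 < q) {c : 𝕜} (hc : c ≠ 0) (f : X) :
    B.gnorm w q (c • f) ≤ ‖c‖ₑ * B.gnorm w q f := by
  rw [gnorm, gnorm, ← dyadicNorm_const_mul hq]
  exact dyadicNorm_mono fun k => B.chebyshevError_smul_le hc f _

theorem gnorm_zero (hq : 0 < q) : B.gnorm w q 0 = 0 := by
  refine le_antisymm ?_ zero_le
  calc B.gnorm w q 0 ≤ dyadicNorm w q (fun _ => 0 * 0) :=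
        dyadicNorm_mono fun k => by simpa using B.chebyshevError_le_en 0 (dyadic k)
    _ = 0 := by rw [dyadicNorm_const_mul hq, zero_mul]

theorem en_le_anorm (hw : IsWeightIDPlus w) (hq : 0 < q) (f : X) :
    N.en f ≤ (dyadicWeight w 0)⁻¹ * B.anorm w q f := by
  calc N.en f = (dyadicWeight w 0)⁻¹ * (dyadicWeight w 0 * N.en f) := by
        rw [← mul_assoc, ENNReal.inv_mul_cancel (hw.dyadicWeight_ne_zero 0) (dyadicWeight_ne_top 0),
          one_mul]
    _ ≤ _ := by gcongr; exact B.weight_mul_en_le_anorm hq f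

theorem norm_le_of_anorm_le (hw : IsWeightIDPlus w) (hq : 0 < q) {f : X} {ρ : NNReal}
    (h : B.anorm w q f ≤ ρ) : N f ≤ (w 1)⁻¹ * ρ := by
  have h1 := (B.en_le_anorm hw hq f).trans (mul_le_mul' le_rfl h)
  have hw1 := hw.pos 1
  rw [dyadicWeight, ← ENNReal.ofReal_inv_of_pos (hw.pos _), ← ENNReal.ofReal_coe_nnreal,
    ← ENNReal.ofReal_mul (by simp [hw1.le])] at h1
  have := (ENNReal.ofReal_le_ofReal_iff (by simp; positivity)).1 h1
  simpa using this

theorem anorm_ne_top_of_mem_spanOn (hw : IsWeightIDPlus w) (hq : 0 < q) {A : Finset ℕ} {f : X}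
    (hf : f ∈ B.spanOn A) : B.anorm w q f ≠ ∞ := by
  obtain ⟨C, hC⟩ := B.exists_anorm_le_en hw hq A.card
  exact ne_top_of_le_ne_top (ENNReal.mul_ne_top ENNReal.coe_ne_top (N.en_ne_top f))
    (hC A f le_rfl hf)

theorem exists_anorm_le_gnorm_gt (hw : IsWeightIDPlus w) (hq : 0 < q)
    (h : ∀ C : NNReal, ∃ A, ∃ g ∈ B.spanOn A, C * B.anorm w q g < B.gnorm w q g)
    (ρ M : NNReal) (hρ : 0 < ρ) :
    ∃ A, ∃ g ∈ B.spanOn A, B.anorm w q g ≤ ρ ∧ M < B.gnorm w q g := by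
  obtain ⟨A, g, hg, hlt⟩ := h (M / ρ)
  have hne : B.anorm w q g ≠ 0 := by
    intro h0
    have h1 := B.en_le_anorm hw hq g
    rw [h0, mul_zero] at h1
    have h2 : g = 0 := N.en_eq_zero (le_antisymm h1 zero_le)
    rw [h2, B.gnorm_zero hq] at hlt
    exact not_lt_zero hlt
  have htop := B.anorm_ne_top_of_mem_spanOn hw hq hg
  obtain ⟨α, hα⟩ : ∃ α : NNReal, B.anorm w q g = α :=
    ⟨_, (ENNReal.coe_toNNReal htop).symm⟩
  have hα0 : α ≠ 0 := by rintro rfl; exact hne (by simpa using hα)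
  -- Both quantities are homogeneous, so a violation of the inequality can be rescaled until `anorm`
  -- is at most `ρ`.
  set c : 𝕜 := (((ρ / α : NNReal) : ℝ) : 𝕜) with hc
  have hcpos : ρ / α ≠ 0 := div_ne_zero hρ.ne' hα0
  have hcn : ‖c‖ₑ = (ρ / α : NNReal) := by
    rw [hc, ← ofReal_norm, RCLike.norm_ofReal, abs_of_nonneg NNReal.zero_le_coe,
      ENNReal.ofReal_coe_nnreal]
  have hc0 : c ≠ 0 := by
    intro h0
    rw [h0, enorm_zero] at hcn
    exact hcpos (by exact_mod_cast hcn.symm)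
  refine ⟨A, c • g, Submodule.smul_mem _ _ hg, ?_, ?_⟩
  · refine (B.anorm_smul_le hq c g).trans (le_of_eq ?_)
    rw [hcn, hα, ← ENNReal.coe_mul, div_mul_cancel₀ _ hα0]
  · by_contra! hcon
    have h1 := B.gnorm_smul_le (w := w) hq (inv_ne_zero hc0) (c • g)
    rw [inv_smul_smul₀ hc0] at h1
    have h2 : B.gnorm w q g ≤ ‖c⁻¹‖ₑ * M := h1.trans (by gcongr)
    have h3 : ‖c⁻¹‖ₑ = (α / ρ : NNReal) := by
      rw [enorm_inv hc0, hcn, ← ENNReal.coe_inv hcpos, inv_div]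
    rw [h3] at h2
    rw [hα] at hlt
    refine absurd (hlt.trans_le h2) (not_lt.2 (le_of_eq ?_))
    norm_cast
    field_simp

/-- The coordinate projection onto `S` has finite rank and is bounded for the `p`-norm, which
`anorm` dominates. The constant depends on `S`, which is fixed wherever this is applied. -/
theorem exists_anorm_sub_proj_le (hw : IsWeightIDPlus w) (hq : 0 < q) (S : Finset ℕ) :
    ∃ C : NNReal, ∀ g, B.anorm w q (g - B.indicator (fun n => B.coord n g) S) ≤
      C * B.anorm w q g := by
  obtain ⟨C₁, -, h₁⟩ := B.exists_anorm_add_le hw hq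
  obtain ⟨C₂, h₂⟩ := B.exists_anorm_le_en hw hq S.card
  have hv := B.vecConst_pos
  have hcc := B.coordConst_pos
  have hp := N.pos_p
  set c : ℝ := (S.card : ℝ) ^ (1 / p) * (B.vecConst * B.coordConst) with hc
  set W := (dyadicWeight w 0)⁻¹.toNNReal with hW
  have hW' : (W : ℝ≥0∞) = (dyadicWeight w 0)⁻¹ :=
    ENNReal.coe_toNNReal (ENNReal.inv_ne_top.2 (hw.dyadicWeight_ne_zero 0))
  refine ⟨C₁ * (1 + C₂ * (c.toNNReal * W)), fun g => ?_⟩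
  set P := B.indicator (fun n => B.coord n g) S with hP
  have hPn : N.en P ≤ c.toNNReal * N.en g := by
    rw [PNorm.en, PNorm.en]
    change _ ≤ ENNReal.ofReal c * _
    rw [← ENNReal.ofReal_mul (by positivity)]
    refine ENNReal.ofReal_le_ofReal ?_
    have := B.indicator_le (fun n => B.coord n g) S
      (mul_nonneg hcc.le (N.nonneg g)) fun n _ => B.coord_le n g
    rw [hc]
    linarith
  have hPa : B.anorm w q (-P) ≤ C₂ * (c.toNNReal * (W * B.anorm w q g)) := by
    have hmem : P ∈ B.spanOn S := B.indicator_mem_spanOn _ _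
    refine (h₂ S (-P) le_rfl (Submodule.neg_mem _ hmem)).trans ?_
    rw [N.en_neg]
    gcongr
    refine hPn.trans ?_
    gcongr
    rw [hW']
    exact B.en_le_anorm hw hq g
  calc B.anorm w q (g - P) ≤ C₁ * (B.anorm w q g + B.anorm w q (-P)) := by
        rw [sub_eq_add_neg]; exact h₁ _ _
    _ ≤ C₁ * (B.anorm w q g + C₂ * (c.toNNReal * (W * B.anorm w q g))) := by gcongr
    _ = _ := by push_cast; ring

theorem IsGreedySet.subset_support {B : Basis N} {f : X} {m : ℕ} {G A : Finset ℕ}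
    (hG : B.IsGreedySet f m G) (hA : ∀ n ∉ A, B.coord n f = 0) (hne : ∀ n ∈ A, B.coord n f ≠ 0)
    (hm : m ≤ A.card) : G ⊆ A := by
  intro n hn
  by_contra hnA
  have hAG : A ⊆ G := by
    intro k hk
    by_contra hkG
    have := hG.2 n hn k hkG
    rw [hA n hnA, norm_zero] at this
    exact hne k hk (norm_le_zero_iff.1 this)
  have := Finset.card_lt_card (Finset.ssubset_iff_of_subset hAG |>.2 ⟨n, hn, hnA⟩)
  have := hG.1
  omega

theorem IsGreedySet.support_subset {B : Basis N} {f : X} {m : ℕ} {G A : Finset ℕ}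
    (hG : B.IsGreedySet f m G) (hA : ∀ n ∉ A, B.coord n f = 0) (hne : ∀ n ∈ A, B.coord n f ≠ 0)
    (hm : A.card ≤ m) : A ⊆ G := by
  intro k hk
  by_contra hkG
  have hGA : G ⊆ A := by
    intro n hn
    by_contra hnA
    have := hG.2 n hn k hkG
    rw [hA n hnA, norm_zero] at this
    exact hne k hk (norm_le_zero_iff.1 this)
  have := Finset.card_lt_card (Finset.ssubset_iff_of_subset hGA |>.2 ⟨k, hk, hkG⟩)
  have := hG.1
  omega

/-- The effect of adding to a finite block `g` a block `s` of larger coordinates and a remainder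
`r` of smaller coordinates. -/
theorem exists_gnorm_block_le (hw : IsWeightIDPlus w) (hq : 0 < q) (S : Finset ℕ) :
    ∃ D : NNReal, ∀ (s g r : X) (A : Finset ℕ), s ∈ B.spanOn S → g ∈ B.spanOn A →
      (∀ n ∈ A, B.coord n g ≠ 0) → (∀ n ∈ S, ∀ k, ‖B.coord k g‖ ≤ ‖B.coord n s‖) →
      (∀ n ∈ S, B.coord n r = 0) → (∀ n ∈ A, B.coord n r = 0) →
      (∀ n ∈ S, ∀ k, ‖B.coord k r‖ ≤ ‖B.coord n s‖) →
      (∀ n ∈ A, ∀ k, ‖B.coord k r‖ ≤ ‖B.coord n g‖) →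
      B.gnorm w q g ≤ D * (B.gnorm w q (s + (g - B.indicator (fun n => B.coord n g) S) + r) +
        N.en r * dyadicNorm w q (fun k => if k < A.card + 1 then 1 else 0) +
        B.anorm w q g) := by
  classical
  obtain ⟨C, hC⟩ := B.exists_distOn_le_distOn_union S
  obtain ⟨C₁, h₁⟩ := dyadicNorm_add_le w hq
  obtain ⟨C₂, h₂⟩ := hw.dyadicNorm_shift_le hq
  set K := N.quasiConst
  have hK : (1 : ℝ≥0∞) ≤ K := by exact_mod_cast N.one_le_quasiConst
  set D : NNReal := 2 * C * K + 1 with hD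
  refine ⟨D * (C₁ * (C₁ + C₂)), ?_⟩
  intro s g r A hs hg hgne hgs hrS hrA hrs hrg
  have hg0 : ∀ n ∉ A, B.coord n g = 0 := fun n hn => B.coord_eq_zero_of_mem_spanOn hg hn
  set P := B.indicator (fun n => B.coord n g) S with hP
  have hPS : P ∈ B.spanOn S := B.indicator_mem_spanOn _ _
  set f := s + (g - P) + r with hf
  have hfS : ∀ n ∈ S, B.coord n f = B.coord n s := by
    intro n hn
    simp [hf, hP, B.coord_indicator, hn, hrS n hn]
  have hfnS : ∀ n ∉ S, B.coord n f = B.coord n g + B.coord n r := by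
    intro n hn
    simp [hf, hP, B.coord_indicator, hn, B.coord_eq_zero_of_mem_spanOn hs hn]
  -- From `|A|` terms on, greedy sets contain the support of `g` and the error vanishes; thus `r` is
  -- charged only for `k < |A| + 1`.
  have key : ∀ k, (B.chebyshevError g ∘ dyadic) k ≤ D * (((B.chebyshevError f ∘ dyadic) k +
      N.en r * (if k < A.card + 1 then 1 else 0)) + (B.bestError g ∘ dyadic) (k - 1)) := by
    intro k
    cases k with
    | zero =>
      simp only [Function.comp_apply, dyadic_zero, B.chebyshevError_zero, zero_tsub,
        B.bestError_zero]
      calc N.en g ≤ 1 * N.en g := by simp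
        _ ≤ D * N.en g := by gcongr; rw [hD]; push_cast; exact le_add_self
        _ ≤ _ := by gcongr; exact le_add_self
    | succ k =>
      simp only [Function.comp_apply, dyadic_succ, Nat.add_sub_cancel]
      obtain ⟨G, hG, hle⟩ := B.exists_isGreedySet_chebyshevError_le g (2 ^ k)
      by_cases hk : A.card ≤ 2 ^ k
      · rw [B.distOn_eq_zero (B.spanOn_mono (hG.support_subset hg0 hgne hk) hg), mul_zero] at hle
        exact hle.trans zero_le
      have hGA := hG.subset_support hg0 hgne (by omega)
      have hkA : k + 1 < A.card + 1 := by
        have := k.lt_two_pow_self; omega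
      -- The magnitudes are ordered as `s`, then `g`, then `r`, and the supports of `g` and `r` do
      -- not meet, so a greedy set of `g` completed by `S` is greedy for `f`.
      have hgreedy : B.IsGreedySet f (S ∪ G).card (S ∪ G) := by
        refine ⟨rfl, fun n hn k hk => ?_⟩
        rw [Finset.mem_union, not_or] at hk
        rw [hfnS k hk.1]
        have hk' : ‖B.coord k g + B.coord k r‖ = ‖B.coord k g‖ ∨
            ‖B.coord k g + B.coord k r‖ = ‖B.coord k r‖ := by
          by_cases hkA : k ∈ A
          · left; rw [hrA k hkA, add_zero]
          · right; rw [hg0 k hkA, zero_add]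
        by_cases hnS : n ∈ S
        · rw [hfS n hnS]
          rcases hk' with h | h <;> rw [h]
          · exact hgs n hnS k
          · exact hrs n hnS k
        · have hnG : n ∈ G := (Finset.mem_union.1 hn).resolve_left hnS
          rw [hfnS n hnS, hrA n (hGA hnG), add_zero]
          rcases hk' with h | h <;> rw [h]
          · exact hG.2 n hnG k hk.2
          · exact hrg n (hGA hnG) k
      have d1 : B.distOn g (S ∪ G) ≤ K * (B.chebyshevError f (2 ^ k) + N.en r) := by
        have e1 : B.distOn g (S ∪ G) = B.distOn (g + (s - P)) (S ∪ G) :=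
          (B.distOn_add_of_mem _ (B.spanOn_mono Finset.subset_union_left
            (Submodule.sub_mem _ hs hPS))).symm
        have e2 : g + (s - P) = f + -r := by rw [hf]; abel
        rw [e1, e2]
        refine (B.distOn_add_le _ _ _).trans ?_
        rw [N.en_neg]
        gcongr
        refine hgreedy.distOn_le.trans (B.chebyshevError_antitone f ?_)
        rw [← hG.1]
        exact Finset.card_le_card Finset.subset_union_right
      -- The missed coordinates are controlled by the best error with one term less. Since `dyadic k
      -- ≤ 2 ^ k - 1`, this produces the shift by one in `key`.
      have hpow : 2 ^ k = (2 ^ k - 1) + 1 := by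
        have := Nat.one_le_two_pow (n := k); omega
      have d2 := hC g (2 ^ k - 1) G (by rw [← hpow]; exact hG)
      have d3 : B.bestError g (2 ^ k - 1) ≤ B.bestError g (dyadic k) := by
        refine B.bestError_antitone g ?_
        have := dyadic_lt_succ k
        rw [dyadic_succ] at this
        omega
      rw [if_pos hkA, mul_one]
      set T := B.chebyshevError f (2 ^ k)
      set E := B.bestError g (dyadic k)
      calc B.chebyshevError g (2 ^ k) ≤ 2 * (C * (K * (T + N.en r) + E)) := by
            refine hle.trans ?_
            gcongr
            exact d2.trans (by gcongr)
        _ ≤ 2 * (C * (K * (T + N.en r) + K * E)) := by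
            gcongr
            calc E = 1 * E := (one_mul _).symm
              _ ≤ K * E := by gcongr
        _ = (2 * C * K : NNReal) * (T + N.en r + E) := by push_cast; ring
        _ ≤ _ := by gcongr; exact le_self_add
  set V := dyadicNorm w q (fun k => if k < A.card + 1 then 1 else 0)
  calc B.gnorm w q g ≤ _ := dyadicNorm_mono key
    _ = D * _ := dyadicNorm_const_mul hq _ _
    _ ≤ D * (C₁ * (C₁ * (B.gnorm w q f + N.en r * V) + C₂ * B.anorm w q g)) := by
        gcongr
        refine (h₁ _ _).trans ?_
        gcongr
        · refine (h₁ _ _).trans (le_of_eq ?_)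
          rw [dyadicNorm_const_mul hq]
          rfl
        · exact h₂ (B.bestError g ∘ dyadic)
    _ ≤ D * (C₁ * ((C₁ + C₂) * (B.gnorm w q f + N.en r * V) +
          (C₁ + C₂) * B.anorm w q g)) := by
        gcongr
        · exact le_self_add
        · exact le_add_self
    _ = _ := by push_cast; ring

/-- The inductive step of the gliding hump. The new partial sum has `gnorm` at least `j`, and keeps
it under every later remainder `r` that vanishes on the present support and is small; `ρ'` is the
size allowed for such remainders. -/
theorem exists_next_block (hw : IsWeightIDPlus w) (hq : 0 < q)
    (h : ∀ C : NNReal, ∃ A, ∃ g ∈ B.spanOn A, C * B.anorm w q g < B.gnorm w q g)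
    {c : ℝ} (hc : 0 < c) (S : Finset ℕ) (s : X) (hs : s ∈ B.spanOn S)
    (hsne : ∀ n ∈ S, B.coord n s ≠ 0) (ρ : NNReal) (hρ : 0 < ρ) (j : ℕ) :
    ∃ (S' : Finset ℕ) (s' : X) (ρ' : NNReal), S ⊆ S' ∧ s' ∈ B.spanOn S' ∧
      (∀ n ∈ S', B.coord n s' ≠ 0) ∧ (∀ n ∈ S, B.coord n (s' - s) = 0) ∧
      B.anorm w q (s' - s) ≤ ρ ∧ 0 < ρ' ∧ ρ' ≤ ρ ∧
      ∀ r, (∀ n ∈ S', B.coord n r = 0) → N r ≤ c * ρ' → j ≤ B.gnorm w q (s' + r) := by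
  classical
  obtain ⟨D, hD⟩ := B.exists_gnorm_block_le hw hq S
  obtain ⟨C₁, h₁⟩ := B.exists_anorm_sub_proj_le hw hq S
  obtain ⟨τ, hτ, hτS⟩ := exists_pos_forall_le_of_finset S (fun n => ‖B.coord n s‖)
    fun n hn => norm_pos_iff.2 (hsne n hn)
  have hcc := B.coordConst_pos
  have hw1 := hw.pos 1
  -- The first bound keeps the block within `ρ` after its coordinates on `S` are removed; the second
  -- puts all its coordinates below those of `s`.
  obtain ⟨ρ₀, hρ₀, hρ₁, hρ₂⟩ : ∃ ρ₀ : NNReal, 0 < ρ₀ ∧ C₁ * ρ₀ ≤ ρ ∧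
      B.coordConst * ((w 1)⁻¹ * ρ₀) ≤ τ := by
    refine ⟨min (ρ / (C₁ + 1)) (τ / (B.coordConst * (w 1)⁻¹)).toNNReal, ?_, ?_, ?_⟩
    · exact lt_min (by positivity) (by simp; positivity)
    · calc C₁ * _ ≤ (C₁ + 1) * (ρ / (C₁ + 1)) := by
            gcongr
            · exact le_self_add
            · exact min_le_left _ _
        _ = ρ := by field_simp
    · calc _ ≤ B.coordConst * ((w 1)⁻¹ * (τ / (B.coordConst * (w 1)⁻¹))) := by
            gcongr
            rw [NNReal.coe_min]
            refine (min_le_right _ _).trans (le_of_eq (Real.coe_toNNReal _ (by positivity)))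
        _ = τ := by field_simp
  -- In the estimate by `D`, the summand `1` pays for the remainder, `ρ₀` for `anorm` of the block,
  -- and `j` is what must be left.
  obtain ⟨A₀, g, hgA₀, hga, hgg⟩ :=
    B.exists_anorm_le_gnorm_gt hw hq h ρ₀ (D * (j + 1 + ρ₀)) hρ₀
  set A := A₀.filter (fun n => B.coord n g ≠ 0) with hA
  have hgA : g ∈ B.spanOn A := B.mem_spanOn_filter hgA₀ fun n hn h0 => by simp [hA, hn, h0]
  have hgne : ∀ n ∈ A, B.coord n g ≠ 0 := fun n hn => (Finset.mem_filter.1 hn).2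
  obtain ⟨τ', hτ', hτA⟩ := exists_pos_forall_le_of_finset A (fun n => ‖B.coord n g‖)
    fun n hn => norm_pos_iff.2 (hgne n hn)
  set V := dyadicNorm w q (fun k => if k < A.card + 1 then 1 else 0) with hV
  have hVtop : V ≠ ∞ := hw.dyadicNorm_truncation_ne_top hq _
  have hgτ : ∀ n ∈ S, ∀ k, ‖B.coord k g‖ ≤ ‖B.coord n s‖ := by
    intro n hn k
    refine (B.coord_le k g).trans (le_trans ?_ (hτS n hn))
    refine le_trans ?_ hρ₂
    gcongr
    exact B.norm_le_of_anorm_le hw hq hga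
  set P := B.indicator (fun n => B.coord n g) S with hP
  have hPS : P ∈ B.spanOn S := B.indicator_mem_spanOn _ _
  -- Remainders of this size have coordinates below those of `s` and of `g`, and cost at most `1`
  -- over the indices where they are charged.
  obtain ⟨ρ', hρ'0, hρ'ρ, hρ'1, hρ'2, hρ'3⟩ : ∃ ρ' : NNReal, 0 < ρ' ∧ ρ' ≤ ρ ∧
      B.coordConst * (c * ρ') ≤ τ ∧ B.coordConst * (c * ρ') ≤ τ' ∧ c * ρ' * V.toReal ≤ 1 := by
    have hVn : 0 ≤ V.toReal := ENNReal.toReal_nonneg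
    have aux : ∀ x y : ℝ, 0 ≤ x → 0 < y → ∀ z, 0 ≤ z → z ≤ y / (x + 1) → x * z ≤ y := by
      intro x y hx hy z hz hzy
      rw [le_div_iff₀ (by positivity)] at hzy
      nlinarith
    set m := min (min (ρ : ℝ) (τ / (B.coordConst * c + 1)))
      (min (τ' / (B.coordConst * c + 1)) (1 / (c * V.toReal + 1))) with hm
    have hmpos : 0 < m := by
      refine lt_min (lt_min (by exact_mod_cast hρ) (by positivity))
        (lt_min (by positivity) (by positivity))
    refine ⟨m.toNNReal, by simpa using hmpos, ?_, ?_, ?_, ?_⟩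
    · rw [← NNReal.coe_le_coe, Real.coe_toNNReal _ hmpos.le]
      exact (min_le_left _ _).trans (min_le_left _ _)
    · rw [Real.coe_toNNReal _ hmpos.le, ← mul_assoc]
      exact aux _ _ (by positivity) hτ _ hmpos.le ((min_le_left _ _).trans (min_le_right _ _))
    · rw [Real.coe_toNNReal _ hmpos.le, ← mul_assoc]
      exact aux _ _ (by positivity) hτ' _ hmpos.le ((min_le_right _ _).trans (min_le_left _ _))
    · rw [Real.coe_toNNReal _ hmpos.le, mul_right_comm]
      exact aux _ _ (by positivity) one_pos _ hmpos.le
        ((min_le_right _ _).trans (min_le_right _ _))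
  refine ⟨S ∪ A, s + (g - P), ρ', Finset.subset_union_left, ?_, ?_, ?_, ?_, hρ'0, hρ'ρ, ?_⟩
  · exact Submodule.add_mem _ (B.spanOn_mono Finset.subset_union_left hs)
      (Submodule.sub_mem _ (B.spanOn_mono Finset.subset_union_right hgA)
        (B.spanOn_mono Finset.subset_union_left hPS))
  · intro n hn
    by_cases hnS : n ∈ S
    · simpa [hP, B.coord_indicator, hnS] using hsne n hnS
    · have hnA := (Finset.mem_union.1 hn).resolve_left hnS
      simpa [hP, B.coord_indicator, hnS, B.coord_eq_zero_of_mem_spanOn hs hnS] using hgne n hnA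
  · intro n hn
    simp [hP, B.coord_indicator, hn]
  · rw [add_sub_cancel_left]
    refine (h₁ g).trans ?_
    calc (C₁ : ℝ≥0∞) * B.anorm w q g ≤ C₁ * ρ₀ := by gcongr
      _ ≤ ρ := by exact_mod_cast hρ₁
  · intro r hr hrN
    by_contra! hcon
    have hrc : ∀ k, ‖B.coord k r‖ ≤ B.coordConst * (c * ρ') := fun k =>
      (B.coord_le k r).trans (by gcongr)
    have h5 := hD s g r A hs hgA hgne hgτ (fun n hn => hr n (Finset.mem_union_left _ hn))
      (fun n hn => hr n (Finset.mem_union_right _ hn))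
      (fun n hn k => (hrc k).trans (hρ'1.trans (hτS n hn)))
      (fun n hn k => (hrc k).trans (hρ'2.trans (hτA n hn)))
    have h6 : N.en r * V ≤ 1 := by
      rw [← ENNReal.ofReal_toReal hVtop, PNorm.en, ← ENNReal.ofReal_mul (N.nonneg r),
        ← ENNReal.ofReal_one]
      refine ENNReal.ofReal_le_ofReal (le_trans ?_ hρ'3)
      gcongr
    refine absurd (hgg.trans_le h5) (not_lt.2 ?_)
    rw [ENNReal.coe_mul]
    push_cast
    gcongr

/-- Greedy sets do not add up, so no quasi-triangle inequality for `gnorm` is at hand and a closed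
graph argument is replaced by a gliding hump. Completeness provides the sum of the blocks, lower
semicontinuity keeps its `anorm` finite, and every partial sum forces its `gnorm` to be large. -/
theorem exists_gnorm_le_anorm_on_span (hcomplete : N.Complete) (hw : IsWeightIDPlus w)
    (hq : 0 < q) (hsub : ∀ f, B.anorm w q f ≠ ∞ → B.gnorm w q f ≠ ∞) :
    ∃ C : NNReal, ∀ A, ∀ g ∈ B.spanOn A, B.gnorm w q g ≤ C * B.anorm w q g := by
  by_contra! hneg
  obtain ⟨C, hC1, hC⟩ := B.exists_anorm_add_le hw hq
  obtain ⟨C', hC'⟩ := B.exists_anorm_le_of_approx hw hq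
  have hw1 := hw.pos 1
  have hcc := B.coordConst_pos
  have hKpos : (0 : ℝ) < N.quasiConst := by
    have := zero_lt_one.trans_le N.one_le_quasiConst
    exact_mod_cast this
  -- The limit remainder is a tail that can be made as small as wanted plus a finite sum of `p`-norm
  -- at most `(w 1)⁻¹ * ρ`; the triangle inequality gives `2 * N.quasiConst`.
  set c : ℝ := 2 * N.quasiConst * (w 1)⁻¹ with hc
  have hcpos : 0 < c := by positivity
  have hCpos : 0 < C := zero_lt_one.trans_le hC1
  let St := {x : Finset ℕ × X × NNReal //
    x.2.1 ∈ B.spanOn x.1 ∧ (∀ n ∈ x.1, B.coord n x.2.1 ≠ 0) ∧ 0 < x.2.2}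
  have step : ∀ (j : ℕ) (x : St), ∃ y : St, x.1.1 ⊆ y.1.1 ∧
      (∀ n ∈ x.1.1, B.coord n (y.1.2.1 - x.1.2.1) = 0) ∧
      B.anorm w q (y.1.2.1 - x.1.2.1) ≤ (x.1.2.2 / (2 * C) : NNReal) ∧
      y.1.2.2 ≤ x.1.2.2 / (2 * C) ∧
      ∀ r, (∀ n ∈ y.1.1, B.coord n r = 0) → N r ≤ c * y.1.2.2 →
        j ≤ B.gnorm w q (y.1.2.1 + r) := by
    rintro j ⟨⟨S, s, ρ⟩, hs, hne, hρ⟩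
    obtain ⟨S', s', ρ', a1, a2, a3, a4, a5, a6, a7, a8⟩ :=
      B.exists_next_block hw hq hneg hcpos S s hs hne (ρ / (2 * C)) (by positivity) j
    exact ⟨⟨⟨S', s', ρ'⟩, a2, a3, a6⟩, a1, a4, a5, a7, a8⟩
  choose next hn1 hn2 hn3 hn4 hn5 using step
  let x₀ : St := ⟨⟨∅, 0, 1⟩, Submodule.zero_mem _, by simp, one_pos⟩
  let x : ℕ → St := fun n => Nat.rec x₀ (fun j y => next j y) n
  have hx : ∀ j, x (j + 1) = next j (x j) := fun j => rfl
  set S : ℕ → Finset ℕ := fun j => (x j).1.1 with hS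
  set s : ℕ → X := fun j => (x j).1.2.1 with hsdef
  set ρ : ℕ → NNReal := fun j => (x j).1.2.2 with hρdef
  have hρpos : ∀ j, 0 < ρ j := fun j => (x j).2.2.2
  have hSmono : ∀ j, S j ⊆ S (j + 1) := fun j => hn1 j (x j)
  have hS' : Monotone S := monotone_nat_of_le_succ hSmono
  have hcoord : ∀ j, ∀ n ∈ S j, B.coord n (s (j + 1) - s j) = 0 := fun j => hn2 j (x j)
  have hinc : ∀ j, B.anorm w q (s (j + 1) - s j) ≤ (ρ j / (2 * C) : NNReal) :=
    fun j => hn3 j (x j)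
  have hρs : ∀ j, ρ (j + 1) ≤ ρ j / (2 * C) := fun j => hn4 j (x j)
  have hbig : ∀ j, ∀ r, (∀ n ∈ S (j + 1), B.coord n r = 0) → N r ≤ c * ρ (j + 1) →
      j ≤ B.gnorm w q (s (j + 1) + r) := fun j => hn5 j (x j)
  -- Dividing by `2 * C` at every stage lets the quasi-triangle inequality be iterated without
  -- accumulating constants: `C (ρ / 2C + ρ / 2C) = ρ`.
  have hsum : ∀ i j, B.anorm w q (s (j + i) - s j) ≤ ρ j := by
    intro i
    induction i with
    | zero =>
      intro j
      have h0 : B.anorm w q (0 : X) = 0 :=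
        le_antisymm ((B.anorm_le_gnorm 0).trans_eq (B.gnorm_zero hq)) zero_le
      simp [h0]
    | succ i ih =>
      intro j
      have e : s (j + (i + 1)) - s j = (s (j + 1) - s j) + (s (j + 1 + i) - s (j + 1)) := by
        rw [show j + (i + 1) = j + 1 + i by ring]; abel
      rw [e]
      refine (hC _ _).trans ?_
      calc (C : ℝ≥0∞) * (B.anorm w q (s (j + 1) - s j) + B.anorm w q (s (j + 1 + i) - s (j + 1)))
          ≤ C * ((ρ j / (2 * C) : NNReal) + (ρ j / (2 * C) : NNReal)) := by
            gcongr
            · exact hinc j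
            · exact (ih (j + 1)).trans (by exact_mod_cast hρs j)
        _ = ρ j := by
            norm_cast
            field_simp
            norm_num
  have hcoord' : ∀ i j, ∀ n ∈ S j, B.coord n (s (j + i) - s j) = 0 := by
    intro i j n hn
    induction i with
    | zero => simp
    | succ i ih =>
      have e : s (j + (i + 1)) - s j = (s (j + i + 1) - s (j + i)) + (s (j + i) - s j) := by
        rw [← add_assoc]; abel
      rw [e, map_add, ih, hcoord (j + i) n (hS' (Nat.le_add_right j i) hn), add_zero]
  have hρgeo : ∀ j, (ρ j : ℝ) ≤ (1 / 2) ^ j := by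
    intro j
    induction j with
    | zero => exact le_of_eq (by simp [hρdef, x, x₀])
    | succ j ih =>
      have h2 : ρ (j + 1) ≤ ρ j / 2 := (hρs j).trans <| by
        gcongr
        exact le_mul_of_one_le_right zero_le hC1
      calc (ρ (j + 1) : ℝ) ≤ ρ j / 2 := by exact_mod_cast h2
        _ ≤ (1 / 2) ^ j / 2 := by gcongr
        _ = _ := by rw [pow_succ]; ring
  have hNs : ∀ i j, N (s (j + i) - s j) ≤ (w 1)⁻¹ * ρ j := fun i j =>
    B.norm_le_of_anorm_le hw hq (hsum i j)
  obtain ⟨f, hf⟩ := hcomplete s (by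
    intro ε hε
    obtain ⟨M, hM⟩ := exists_pow_lt_of_lt_one (show 0 < ε * w 1 by positivity)
      (by norm_num : (1 / 2 : ℝ) < 1)
    have key : ∀ m n, M ≤ m → m ≤ n → N (s n - s m) < ε := by
      intro m n hm hmn
      obtain ⟨i, rfl⟩ := Nat.exists_eq_add_of_le hmn
      calc N (s (m + i) - s m) ≤ (w 1)⁻¹ * ρ m := hNs i m
        _ ≤ (w 1)⁻¹ * (1 / 2) ^ M := by
            gcongr
            exact (hρgeo m).trans (pow_le_pow_of_le_one (by norm_num) (by norm_num) hm)
        _ < (w 1)⁻¹ * (ε * w 1) := by gcongr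
        _ = ε := by field_simp
    refine ⟨M, fun m n hm hn => ?_⟩
    rcases le_total m n with h | h
    · rw [N.map_sub_comm]; exact key m n hm h
    · exact key n m hn h)
  have hlim : ∀ j, ∀ δ : ℝ, 0 < δ → ∃ i, N (f - s (j + i)) < δ := by
    intro j δ hδ
    obtain ⟨n, hn1, hn2⟩ :=
      ((hf.eventually (gt_mem_nhds hδ)).and (Filter.eventually_ge_atTop j)).exists
    obtain ⟨i, rfl⟩ := Nat.exists_eq_add_of_le hn2
    exact ⟨i, by rw [N.map_sub_comm]; exact hn1⟩
  have hfin : B.anorm w q f ≠ ∞ := by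
    refine ne_top_of_le_ne_top (ENNReal.mul_ne_top ENNReal.coe_ne_top ENNReal.coe_ne_top)
      (hC' f 1 one_pos fun δ hδ => ?_)
    obtain ⟨i, hi⟩ := hlim 0 δ hδ
    refine ⟨_, hi, ?_⟩
    have := hsum i 0
    simpa [hsdef, hρdef, x, x₀] using this
  refine hsub f hfin ?_
  refine ENNReal.eq_top_of_forall_nnreal_le fun t => ?_
  obtain ⟨j, hj⟩ := exists_nat_ge t
  refine le_trans (by exact_mod_cast hj : (t : ℝ≥0∞) ≤ j) ?_
  -- It remains to see that `f - s (j + 1)` is an admissible remainder: it vanishes on the support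
  -- by continuity of the coordinates, and it is small.
  have := hbig j (f - s (j + 1)) ?_ ?_
  · simpa using this
  · intro n hn
    by_contra hne
    obtain ⟨i, hi⟩ := hlim (j + 1) (‖B.coord n (f - s (j + 1))‖ / B.coordConst)
      (div_pos (norm_pos_iff.2 hne) hcc)
    rw [lt_div_iff₀ hcc] at hi
    have h1 := B.coord_le n (f - s (j + 1 + i))
    have e : f - s (j + 1) = (f - s (j + 1 + i)) + (s (j + 1 + i) - s (j + 1)) := by abel
    rw [e, map_add, hcoord' i (j + 1) n hn, add_zero] at hi
    linarith
  · obtain ⟨i, hi⟩ := hlim (j + 1) ((w 1)⁻¹ * ρ (j + 1))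
      (mul_pos (inv_pos.2 hw1) (NNReal.coe_pos.2 (hρpos (j + 1))))
    have e : f - s (j + 1) = (f - s (j + 1 + i)) + (s (j + 1 + i) - s (j + 1)) := by abel
    rw [e]
    refine (N.add_le _ _).trans ?_
    calc (N.quasiConst : ℝ) * (N (f - s (j + 1 + i)) + N (s (j + 1 + i) - s (j + 1)))
        ≤ N.quasiConst * ((w 1)⁻¹ * ρ (j + 1) + (w 1)⁻¹ * ρ (j + 1)) := by
          gcongr
          exact hNs i (j + 1)
      _ = _ := by rw [hc]; ring

end Basis

/-! ### Signs of scalars and comparison of real and extended norms. -/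

theorem norm_sgn (z : 𝕜) : ‖sgn z‖ = 1 := by
  unfold sgn
  split_ifs with h
  · simp
  · rw [norm_div, RCLike.norm_ofReal, abs_norm, div_self (norm_ne_zero_iff.2 h)]

theorem sgn_of_norm_eq_one {z : 𝕜} (h : ‖z‖ = 1) : sgn z = z := by
  have : z ≠ 0 := by rintro rfl; simp at h
  simp [sgn, this, h]

theorem norm_mul_sgn (z : 𝕜) : ((‖z‖ : ℝ) : 𝕜) * sgn z = z := by
  unfold sgn
  split_ifs with h
  · simp [h]
  · have : ((‖z‖ : ℝ) : 𝕜) ≠ 0 := by simpa using h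
    field_simp

theorem PNorm.en_le_mul_en_iff (N : PNorm 𝕜 X p) {f g : X} {C : NNReal} :
    N.en f ≤ C * N.en g ↔ N f ≤ C * N g := by
  rw [en, en, ← ENNReal.ofReal_coe_nnreal, ← ENNReal.ofReal_mul NNReal.zero_le_coe,
    ENNReal.ofReal_le_ofReal_iff (mul_nonneg NNReal.zero_le_coe (N.nonneg g))]

theorem PNorm.en_le_of_le (N : PNorm 𝕜 X p) {f g : X} {C : ℝ} (hC : 0 ≤ C)
    (h : N f ≤ C * N g) : N.en f ≤ C.toNNReal * N.en g := by
  rw [N.en_le_mul_en_iff, Real.coe_toNNReal _ hC]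
  exact h

theorem PNorm.mem_closedSpan_of_mem_span (N : PNorm 𝕜 X p) {S : Set X} {f : X}
    (hf : f ∈ Submodule.span 𝕜 S) : f ∈ N.closedSpan S := by
  intro ε hε
  exact ⟨f, hf, by simpa [N.map_zero] using hε⟩

namespace Basis

variable {N : PNorm 𝕜 X p} (B : Basis N) {w : ℕ+ → ℝ} {q : ℝ≥0∞}

/-! ### Separation of indicator sums -/

/-- Any finite set of indices can be complemented by sets of any given size, in such a way that
the indicator sums over either one are separated from the span of the other one. -/
def SeparatesIndicators : Prop :=
  ∃ c : NNReal, ∀ (F : Finset ℕ) (m : ℕ), ∃ D : Finset ℕ, D.card = m ∧ Disjoint F D ∧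
    (∀ A ⊆ F, ∀ ε : ℕ → 𝕜, (∀ n, ‖ε n‖ = 1) → ∀ u ∈ B.spanOn D,
      N.en (B.indicator ε A) ≤ c * N.en (B.indicator ε A + u)) ∧
    (∀ A ⊆ D, ∀ ε : ℕ → 𝕜, (∀ n, ‖ε n‖ = 1) → ∀ u ∈ B.spanOn F,
      N.en (B.indicator ε A) ≤ c * N.en (B.indicator ε A + u))

variable {B}

/-- The property is used twice. The full level set `E` is greedy for `f`; and any subset of `E` is
greedy for the sign sum `g` over `E`, whose coordinates all have modulus `1` or `0`. -/
theorem TruncationQuasiGreedy.exists_sgn_indicator_le (h : B.TruncationQuasiGreedy) :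
    ∃ C : ℝ, 0 < C ∧ ∀ (f : X) (t : ℝ) (A : Finset ℕ), 0 < t →
      (∀ n ∈ A, t ≤ ‖B.coord n f‖) →
      t * N (B.indicator (fun n => sgn (B.coord n f)) A) ≤ C * N f := by
  classical
  obtain ⟨C, hC, h⟩ := h
  refine ⟨C * C, by positivity, fun f t A ht hA => ?_⟩
  rcases A.eq_empty_or_nonempty with rfl | hne
  · simpa [indicator, N.map_zero] using mul_nonneg (mul_nonneg hC.le hC.le) (N.nonneg f)
  set E := (B.finite_le_coord f ht).toFinset with hE
  have hmem : ∀ n, n ∈ E ↔ t ≤ ‖B.coord n f‖ := by simp [hE]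
  have hAE : A ⊆ E := fun n hn => (hmem n).2 (hA n hn)
  have hEne : E.Nonempty := hne.mono hAE
  set g := B.indicator (fun n => sgn (B.coord n f)) E with hg
  have h1 : t * N g ≤ C * N f := by
    refine le_trans ?_ (h f E.card E hEne ⟨rfl, fun n hn k hk => ?_⟩)
    · refine mul_le_mul_of_nonneg_right ?_ (N.nonneg _)
      exact Finset.le_inf' _ _ fun n hn => (hmem n).1 hn
    · rw [hmem, not_le] at hk
      exact hk.le.trans ((hmem n).1 hn)
  have hcg : ∀ n ∈ E, B.coord n g = sgn (B.coord n f) := fun n hn => by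
    rw [hg, B.coord_indicator, if_pos hn]
  have h2 : 1 * N (B.indicator (fun n => sgn (B.coord n g)) A) ≤ C * N g := by
    refine le_trans ?_ (h g A.card A hne ⟨rfl, fun n hn k _ => ?_⟩)
    · refine mul_le_mul_of_nonneg_right ?_ (N.nonneg _)
      exact Finset.le_inf' _ _ fun n hn => by rw [hcg n (hAE hn), norm_sgn]
    · rw [hcg n (hAE hn), norm_sgn, hg, B.coord_indicator]
      split_ifs
      · rw [norm_sgn]
      · simp
  have h3 : B.indicator (fun n => sgn (B.coord n g)) A =
      B.indicator (fun n => sgn (B.coord n f)) A :=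
    B.indicator_congr fun n hn => by rw [hcg n (hAE hn), sgn_of_norm_eq_one (norm_sgn _)]
  rw [h3, one_mul] at h2
  calc t * N (B.indicator (fun n => sgn (B.coord n f)) A) ≤ t * (C * N g) := by gcongr
    _ = C * (t * N g) := by ring
    _ ≤ C * (C * N f) := by gcongr
    _ = _ := by ring

/-- A summand supported off `A` does not change the unimodular coordinates on `A`, so the previous
lemma with `t = 1` applies and any disjoint set will do. -/
theorem TruncationQuasiGreedy.separatesIndicators (h : B.TruncationQuasiGreedy) :
    B.SeparatesIndicators := by
  classical
  obtain ⟨C, hC, h⟩ := h.exists_sgn_indicator_le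
  have key : ∀ A D : Finset ℕ, Disjoint A D → ∀ ε : ℕ → 𝕜, (∀ n, ‖ε n‖ = 1) →
      ∀ u ∈ B.spanOn D, N.en (B.indicator ε A) ≤ C.toNNReal * N.en (B.indicator ε A + u) := by
    intro A D hAD ε hε u hu
    refine N.en_le_of_le hC.le ?_
    have hc : ∀ n ∈ A, B.coord n (B.indicator ε A + u) = ε n := fun n hn => by
      rw [map_add, B.coord_indicator, if_pos hn,
        B.coord_eq_zero_of_mem_spanOn hu (Finset.disjoint_left.1 hAD hn), add_zero]
    have h1 := h (B.indicator ε A + u) 1 A one_pos fun n hn => by rw [hc n hn, hε]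
    rw [one_mul] at h1
    convert h1 using 2
    exact B.indicator_congr fun n hn => by rw [hc n hn, sgn_of_norm_eq_one (hε n)]
  refine ⟨C.toNNReal, fun F m => ?_⟩
  obtain ⟨D, hFD, hD⟩ := Infinite.exists_superset_card_eq F (F.card + m) (Nat.le_add_right _ _)
  have hdisj : Disjoint F (D \ F) := Finset.disjoint_sdiff
  refine ⟨D \ F, ?_, hdisj, ?_, ?_⟩
  · rw [Finset.card_sdiff_of_subset hFD, hD]; omega
  · exact fun A hA => key A _ (hdisj.mono_left hA)
  · exact fun A hA => key A _ (hdisj.symm.mono_left hA)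

theorem exists_separated_of_hasFDSP (hsep : N.Separable Set.univ) (h : N.HasFDSP B.vec) :
    ∃ c : NNReal, ∀ (Y : Submodule 𝕜 X), FiniteDimensional 𝕜 Y → ∀ (F : Finset ℕ) (m : ℕ),
      ∃ D : Finset ℕ, D.card = m ∧ Disjoint F D ∧
        ∀ f ∈ Y, ∀ u ∈ B.spanOn D, N.en f ≤ c * N.en (f + u) := by
  classical
  obtain ⟨C, hC, h⟩ := h
  obtain ⟨i, hi, -, h⟩ := h ⊤ (by simpa using hsep) 1 one_pos
  refine ⟨(C + 1).toNNReal, fun Y hY F m => ?_⟩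
  obtain ⟨j, hj⟩ := h Y le_top hY
  -- Beyond `j` the separation holds; beyond `F.sup id` the indices avoid `F`, because `k ≤ i k`.
  set J := max j (F.sup id) with hJ
  refine ⟨(Finset.Ioc J (J + m)).image i, ?_, ?_, fun f hf u hu => ?_⟩
  · rw [Finset.card_image_of_injective _ hi.injective]; simp
  · rw [Finset.disjoint_left]
    intro n hn hn'
    obtain ⟨k, hk, rfl⟩ := Finset.mem_image.1 hn'
    have h1 : i k ≤ F.sup id := Finset.le_sup (f := id) hn
    have h2 := hi.id_le k
    have h3 := (Finset.mem_Ioc.1 hk).1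
    have h4 : F.sup id ≤ J := le_max_right _ _
    simp only [id] at h2
    omega
  · refine N.en_le_of_le (by positivity) (hj f hf u (N.mem_closedSpan_of_mem_span ?_))
    refine Submodule.span_mono ?_ hu
    rintro _ ⟨n, hn, rfl⟩
    obtain ⟨k, hk, rfl⟩ := Finset.mem_image.1 (Finset.mem_coe.1 hn)
    exact ⟨k, (le_max_left _ _).trans_lt (Finset.mem_Ioc.1 hk).1, rfl⟩

theorem finiteDimensional_spanOn (F : Finset ℕ) : FiniteDimensional 𝕜 (B.spanOn F) :=
  FiniteDimensional.span_of_finite 𝕜 (F.finite_toSet.image _)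

/-- The separation property bounds the component over `F`. The component over `D` is the whole minus
that one, so it is bounded as well. -/
theorem separatesIndicators_of_hasFDSP (hsep : N.Separable Set.univ) (h : N.HasFDSP B.vec) :
    B.SeparatesIndicators := by
  obtain ⟨c, hc⟩ := exists_separated_of_hasFDSP hsep h
  refine ⟨c + N.quasiConst * (1 + c), fun F m => ?_⟩
  obtain ⟨D, hD, hFD, h⟩ := hc (B.spanOn F) (finiteDimensional_spanOn F) F m
  refine ⟨D, hD, hFD, fun A hA ε _ u hu => ?_, fun A hA ε _ u hu => ?_⟩
  · refine (h _ (B.spanOn_mono hA (B.indicator_mem_spanOn ε A)) u hu).trans ?_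
    gcongr
    exact le_self_add
  · set v := B.indicator ε A
    have hv : v ∈ B.spanOn D := B.spanOn_mono hA (B.indicator_mem_spanOn ε A)
    have h1 := h u hu v hv
    rw [add_comm u v] at h1
    calc N.en v = N.en ((v + u) - u) := by rw [add_sub_cancel_right]
      _ ≤ N.quasiConst * (N.en (v + u) + N.en u) := N.en_sub_le _ _
      _ ≤ N.quasiConst * (N.en (v + u) + c * N.en (v + u)) := by gcongr
      _ = (N.quasiConst * (1 + c) : NNReal) * N.en (v + u) := by push_cast; ring
      _ ≤ _ := by gcongr; exact le_add_self

/-! ### Superdemocracy -/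

variable (B)

/-- The greedy error of `u + v` at `D` carries the weight at `|D|`, whereas `‖u‖` enters the best
errors only with the weight at `|A|`. The gap `b` makes the first weight so much larger that `‖u‖`
can be absorbed. -/
theorem exists_indicator_le_of_dyadic_card (hw : IsWeightIDPlus w) (hq : 0 < q) {C : NNReal}
    (hC : ∀ A, ∀ g ∈ B.spanOn A, B.gnorm w q g ≤ C * B.anorm w q g) (c : NNReal) :
    ∃ (b : ℕ) (C' : NNReal), ∀ (a : ℕ) (A D : Finset ℕ) (ε ε' : ℕ → 𝕜), Disjoint A D →
      (∀ n, ‖ε n‖ = 1) → (∀ n, ‖ε' n‖ = 1) →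
      (∀ u ∈ B.spanOn D, N.en (B.indicator ε A) ≤ c * N.en (B.indicator ε A + u)) →
      A.card ≤ 2 ^ a → 2 ^ (a + b) ≤ D.card → D.card ≤ 2 ^ (a + b + 1) →
      N.en (B.indicator ε A) ≤ C' * N.en (B.indicator ε' D) := by
  classical
  obtain ⟨C₀, h₀⟩ := hw.dyadicNorm_truncation_le hq
  obtain ⟨C₁, h₁⟩ := dyadicNorm_add_le w hq
  obtain ⟨C₂, h₂⟩ := hw.dyadicWeight_succ_le
  set K := N.quasiConst
  have hK : (1 : ℝ≥0∞) ≤ K := by exact_mod_cast N.one_le_quasiConst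
  set M : NNReal := c * (C * (C₁ * (K * C₀))) with hM
  obtain ⟨b, hb⟩ := hw.dyadicWeight_growth (2 * M)
  refine ⟨b, 2 * M * (C₂ * C₂), fun a A D ε ε' hAD hε hε' hsep hA hD hD' => ?_⟩
  set u := B.indicator ε A with hu
  set v := B.indicator ε' D with hv
  have huA : u ∈ B.spanOn A := B.indicator_mem_spanOn _ _
  have hvD : v ∈ B.spanOn D := B.indicator_mem_spanOn _ _
  have hmem : u + v ∈ B.spanOn (A ∪ D) :=
    Submodule.add_mem _ (B.spanOn_mono Finset.subset_union_left huA)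
      (B.spanOn_mono Finset.subset_union_right hvD)
  set x := N.en u
  set y := N.en v
  have hgreedy : B.IsGreedySet (u + v) D.card D := by
    refine ⟨rfl, fun n hn k hk => ?_⟩
    have hnA : n ∉ A := fun h => Finset.disjoint_left.1 hAD h hn
    simp only [hu, hv, map_add, B.coord_indicator, if_pos hn, if_neg hnA, if_neg hk, zero_add,
      add_zero, hε']
    split_ifs
    · rw [hε]
    · simp
  have hdist : x ≤ c * B.distOn (u + v) D := by
    rw [B.distOn_add_of_mem _ hvD]
    have := B.le_mul_distOn_add (f := u) (A := D) (C := c) (c := 0) (x := x) fun z hz => by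
      rw [add_zero, sub_eq_add_neg]
      exact hsep _ (Submodule.neg_mem _ hz)
    simpa using this
  set W := dyadicWeight w (a + b + 1) with hW
  have lower : W * x ≤ c * B.gnorm w q (u + v) := by
    calc W * x ≤ W * (c * B.chebyshevError (u + v) (dyadic (a + b + 1))) := by
          gcongr
          refine hdist.trans ?_
          gcongr
          refine hgreedy.distOn_le.trans (B.chebyshevError_antitone _ ?_)
          rwa [dyadic_succ]
      _ = c * (W * B.chebyshevError (u + v) (dyadic (a + b + 1))) := by ring
      _ ≤ _ := by gcongr; exact le_dyadicNorm hq (B.chebyshevError (u + v) ∘ dyadic) _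
  have upper : B.anorm w q (u + v) ≤
      C₁ * (K * C₀) * (dyadicWeight w (a + 1) * x + dyadicWeight w (a + b + 3) * y) := by
    -- From `k = a + 1` on there are `2 ^ a ≥ |A|` terms, enough to remove `u`; from `k = a + b + 3`
    -- on there are enough to remove `u + v`.
    have hpt : ∀ k, (B.bestError (u + v) ∘ dyadic) k ≤
        K * x * (if k < a + 1 then 1 else 0) + K * y * (if k < a + b + 3 then 1 else 0) := by
      intro k
      by_cases hk : k < a + 1
      · rw [if_pos hk, if_pos (by omega), mul_one, mul_one, ← mul_add]
        exact (B.bestError_le_en _ _).trans (N.en_add_le _ _)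
      obtain ⟨j, rfl⟩ : ∃ j, k = j + 1 := ⟨k - 1, by omega⟩
      rw [if_neg hk, mul_zero, zero_add, Function.comp_apply, dyadic_succ]
      by_cases hk2 : j + 1 < a + b + 3
      · rw [if_pos hk2, mul_one]
        have := B.bestError_le (u + v) (m := 2 ^ j)
          (hA.trans (Nat.pow_le_pow_right two_pos (by omega))) huA
        rw [add_sub_cancel_left] at this
        refine this.trans ?_
        calc y = 1 * y := (one_mul y).symm
          _ ≤ K * y := by gcongr
      · rw [if_neg hk2, mul_zero]
        refine (B.bestError_eq_zero ?_ hmem).le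
        calc (A ∪ D).card ≤ A.card + D.card := Finset.card_union_le _ _
          _ ≤ 2 ^ (a + b + 1) + 2 ^ (a + b + 1) :=
            add_le_add (hA.trans (Nat.pow_le_pow_right two_pos (by omega))) hD'
          _ = 2 ^ (a + b + 2) := by ring
          _ ≤ 2 ^ j := Nat.pow_le_pow_right two_pos (by omega)
    calc B.anorm w q (u + v) ≤ _ := dyadicNorm_mono hpt
      _ ≤ C₁ * (K * x * (C₀ * dyadicWeight w (a + 1)) +
          K * y * (C₀ * dyadicWeight w (a + b + 3))) := by
          refine (h₁ _ _).trans ?_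
          rw [dyadicNorm_const_mul hq, dyadicNorm_const_mul hq]
          gcongr
          · exact h₀ _
          · exact h₀ _
      _ = _ := by ring
  have hW3 : dyadicWeight w (a + b + 3) ≤ C₂ * (C₂ * W) :=
    (h₂ _).trans (by gcongr; exact h₂ _)
  have hWb : (2 * M : NNReal) * dyadicWeight w (a + 1) ≤ W := by
    have := hb (a + 1)
    rwa [show a + 1 + b = a + b + 1 by ring] at this
  have main : W * x ≤ M * (dyadicWeight w (a + 1) * x + C₂ * (C₂ * W) * y) := by
    calc W * x ≤ c * (C * (C₁ * (K * C₀) *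
          (dyadicWeight w (a + 1) * x + dyadicWeight w (a + b + 3) * y))) := by
          refine lower.trans ?_
          gcongr
          exact (hC _ _ hmem).trans (by gcongr)
      _ ≤ c * (C * (C₁ * (K * C₀) * (dyadicWeight w (a + 1) * x + C₂ * (C₂ * W) * y))) := by
          gcongr
      _ = _ := by rw [hM]; push_cast; ring
  -- Doubling `main` and using the factor `2 * M` in the choice of `b` bounds the term in `x` by `W
  -- * x`, which is finite and cancels.
  have main2 : W * x + W * x ≤ W * x + W * ((2 * M * (C₂ * C₂) : NNReal) * y) := by
    calc W * x + W * x ≤ 2 * (M * (dyadicWeight w (a + 1) * x + C₂ * (C₂ * W) * y)) := by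
          rw [← two_mul]; gcongr
      _ = (2 * M : NNReal) * dyadicWeight w (a + 1) * x +
          W * ((2 * M * (C₂ * C₂) : NNReal) * y) := by push_cast; ring
      _ ≤ _ := by gcongr
  have hWtop : W ≠ ∞ := dyadicWeight_ne_top _
  have hxtop : W * x ≠ ∞ := ENNReal.mul_ne_top hWtop (N.en_ne_top u)
  have main3 := (ENNReal.add_le_add_iff_left hxtop).1 main2
  exact (ENNReal.mul_le_mul_iff_right (hw.dyadicWeight_ne_zero _) hWtop).1 main3

theorem indicator_rpow_le_of_forall_subset (ε : ℕ → 𝕜) (M : ℕ) {t : ℝ} (r : ℕ) (A : Finset ℕ)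
    (hA : A.card ≤ r * M) (h : ∀ A' ⊆ A, A'.card ≤ M → N (B.indicator ε A') ≤ t) :
    N (B.indicator ε A) ^ p ≤ r * t ^ p := by
  classical
  induction r generalizing A with
  | zero =>
    obtain rfl : A = ∅ := by simpa using hA
    simp [indicator, N.map_zero, Real.zero_rpow N.pos_p.ne']
  | succ r ih =>
    obtain ⟨A', hA', hcard⟩ := Finset.exists_subset_card_eq (min_le_right M A.card)
    have h1 : N (B.indicator ε A') ≤ t := h A' hA' (hcard ▸ min_le_left _ _)
    have h2 := ih (A \ A') (by
      rw [Finset.card_sdiff_of_subset hA', hcard]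
      rw [add_mul, one_mul] at hA
      rcases le_total M A.card with hM | hM
      · rw [min_eq_left hM]; omega
      · rw [min_eq_right hM]; simp) fun A'' hA'' => h A'' (hA''.trans Finset.sdiff_subset)
    have h3 : B.indicator ε A = B.indicator ε A' + B.indicator ε (A \ A') := by
      rw [← B.indicator_union Finset.disjoint_sdiff, Finset.union_sdiff_of_subset hA']
    rw [h3]
    refine (N.add_rpow_le _ _).trans ?_
    have := Real.rpow_le_rpow (N.nonneg _) h1 N.pos_p.le
    push_cast
    linarith

/-- With `|D|` between `2 ^ (a + b)` and `2 ^ (a + b + 1)`, the set `A` splits into `2 ^ (b + 1)`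
pieces of at most `2 ^ a` elements. If `|D| < 2 ^ b`, boundedness of the vectors and of the
functionals suffices. -/
theorem exists_indicator_le_of_card_le (hw : IsWeightIDPlus w) (hq : 0 < q) {C : NNReal}
    (hC : ∀ A, ∀ g ∈ B.spanOn A, B.gnorm w q g ≤ C * B.anorm w q g) (c : NNReal) :
    ∃ C' : ℝ, 0 < C' ∧ ∀ (A D : Finset ℕ) (ε ε' : ℕ → 𝕜), Disjoint A D →
      (∀ n, ‖ε n‖ = 1) → (∀ n, ‖ε' n‖ = 1) →
      (∀ A' ⊆ A, ∀ u ∈ B.spanOn D, N.en (B.indicator ε A') ≤ c * N.en (B.indicator ε A' + u)) →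
      A.card ≤ D.card → N (B.indicator ε A) ≤ C' * N (B.indicator ε' D) := by
  obtain ⟨b, C', h⟩ := B.exists_indicator_le_of_dyadic_card hw hq hC c
  have hv := B.vecConst_pos
  have hcc := B.coordConst_pos
  have hp := N.pos_p
  set c₁ : ℝ := (2 ^ (b + 1) : ℝ) ^ (1 / p) * C' with hc₁
  set c₂ : ℝ := (2 ^ b : ℝ) ^ (1 / p) * (B.vecConst * B.coordConst) with hc₂
  have hc₁' : 0 ≤ c₁ := by positivity
  have hc₂' : 0 < c₂ := by positivity
  refine ⟨c₁ + c₂, by positivity, fun A D ε ε' hAD hε hε' hsep hcard => ?_⟩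
  have hy := N.nonneg (B.indicator ε' D)
  by_cases hb : 2 ^ b ≤ D.card
  · have hlog : b ≤ Nat.log 2 D.card := Nat.le_log_of_pow_le one_lt_two hb
    have hD0 : D.card ≠ 0 := by have := Nat.one_le_two_pow (n := b); omega
    obtain ⟨a, ha⟩ : ∃ a, Nat.log 2 D.card = a + b := ⟨Nat.log 2 D.card - b, by omega⟩
    have hD1 : 2 ^ (a + b) ≤ D.card := ha ▸ Nat.pow_log_le_self 2 hD0
    have hD2 : D.card ≤ 2 ^ (a + b + 1) := by
      have := (Nat.lt_pow_succ_log_self one_lt_two D.card).le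
      rwa [ha] at this
    have h1 := B.indicator_rpow_le_of_forall_subset ε (2 ^ a) (t := C' * N (B.indicator ε' D))
      (2 ^ (b + 1)) A (hcard.trans (hD2.trans (le_of_eq (by ring)))) fun A' hA' hA'c => by
        rw [← N.en_le_mul_en_iff]
        exact h a A' D ε ε' (hAD.mono_left hA') hε hε' (hsep A' hA') hA'c hD1 hD2
    have h2 := N.le_of_rpow_le (by positivity) (by positivity) h1
    push_cast at h2
    rw [← mul_assoc] at h2
    refine h2.trans ?_
    gcongr
    linarith
  · rcases D.eq_empty_or_nonempty with rfl | ⟨n, hn⟩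
    · obtain rfl : A = ∅ := by simpa using hcard
      simp [indicator, N.map_zero]
    have h1 := B.coord_le n (B.indicator ε' D)
    rw [B.coord_indicator, if_pos hn, hε'] at h1
    have h2 := B.indicator_le ε A zero_le_one fun n _ => (hε n).le
    have hA : (A.card : ℝ) ≤ 2 ^ b := by exact_mod_cast hcard.trans (not_le.1 hb).le
    calc N (B.indicator ε A) ≤ (A.card : ℝ) ^ (1 / p) * (B.vecConst * 1) := h2
      _ ≤ (2 ^ b : ℝ) ^ (1 / p) * (B.vecConst * (B.coordConst * N (B.indicator ε' D))) := by
          gcongr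
      _ = c₂ * N (B.indicator ε' D) := by rw [hc₂]; ring
      _ ≤ _ := by gcongr; linarith

/-- The sets `A` and `D` may overlap and need not be separated; an auxiliary set `E` of cardinality
`|D|`, separated from both, mediates between them. -/
theorem SeparatesIndicators.superdemocratic {B : Basis N} (hsep : B.SeparatesIndicators)
    (hw : IsWeightIDPlus w) (hq : 0 < q) {C : NNReal}
    (hC : ∀ A, ∀ g ∈ B.spanOn A, B.gnorm w q g ≤ C * B.anorm w q g) : B.Superdemocratic := by
  classical
  obtain ⟨c, hsep⟩ := hsep
  obtain ⟨C', hC', h⟩ := B.exists_indicator_le_of_card_le hw hq hC c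
  refine ⟨C' * C', by positivity, fun A D ε ε' hcard hε hε' => ?_⟩
  obtain ⟨E, hE, hdisj, h1, h2⟩ := hsep (A ∪ D) D.card
  have hEA : Disjoint A E := hdisj.mono_left Finset.subset_union_left
  have hED : Disjoint E D := (hdisj.mono_left Finset.subset_union_right).symm
  calc N (B.indicator ε A) ≤ C' * N (B.indicator ε E) :=
        h A E ε ε hEA hε hε (fun A' hA' => h1 A' (hA'.trans Finset.subset_union_left) ε hε)
          (hE ▸ hcard)
    _ ≤ C' * (C' * N (B.indicator ε' D)) := by
        gcongr
        exact h E D ε ε' hED hε hε' (fun E' hE' u hu => h2 E' hE' ε hε u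
          (B.spanOn_mono Finset.subset_union_right hu)) hE.le
    _ = _ := by ring

end Basis

namespace Basis

variable {N : PNorm 𝕜 X p} (B : Basis N) {w : ℕ+ → ℝ} {q : ℝ≥0∞}

/-! ### Extension of the boundedness from the span to the whole space -/

/-- Approximation by vectors of the span that are bounded in the class quasi-norm. -/
theorem exists_span_approx_anorm_le (hw : IsWeightIDPlus w) (hq : 0 < q) :
    ∃ C : NNReal, ∀ (f : X) (M : NNReal), 0 < M → B.anorm w q f ≤ M → ∀ δ : ℝ, 0 < δ →
      ∃ A, ∃ h ∈ B.spanOn A, N (f - h) < δ ∧ B.anorm w q h ≤ C * M := by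
  obtain ⟨C₁, h₁⟩ := dyadicNorm_add_le w hq
  set K := N.quasiConst
  refine ⟨K * (C₁ * 3), fun f M hM hf δ hδ => ?_⟩
  obtain ⟨m, hm⟩ := B.tendsto_bestError f (δ := ENNReal.ofReal δ) (by simpa using hδ)
  set V := dyadicNorm w q (fun k => if k < m + 1 then 1 else 0) with hV
  have hVtop : V ≠ ∞ := hw.dyadicNorm_truncation_ne_top hq _
  set τ : NNReal := M / (V.toNNReal + 1) with hτ
  have hτpos : 0 < τ := by positivity
  have hτV : (τ : ℝ≥0∞) * V ≤ M := by
    rw [← ENNReal.coe_toNNReal hVtop, ← ENNReal.coe_mul]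
    refine ENNReal.coe_le_coe.2 ?_
    calc τ * V.toNNReal ≤ τ * (V.toNNReal + 1) := by gcongr; exact le_self_add
      _ = M := by rw [hτ]; field_simp
  -- A nearly best approximant `h` with `2 ^ m` terms is taken. Up to `2 ^ m` terms its errors
  -- exceed those of `f` by about `‖f - h‖`, itself at most the error of `f` plus `τ`; afterwards
  -- they vanish.
  have hlt : B.bestError f (2 ^ m) <
      min (ENNReal.ofReal δ) (B.bestError f (2 ^ m) + τ) :=
    lt_min ((B.bestError_antitone f m.lt_two_pow_self.le).trans_lt hm)
      (ENNReal.lt_add_right (B.bestError_ne_top _ _) (by simpa using hτpos.ne'))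
  obtain ⟨A, hA, h, hh, hfh⟩ := B.exists_of_bestError_lt hlt
  rw [lt_min_iff] at hfh
  refine ⟨A, h, hh, (ENNReal.ofReal_lt_ofReal_iff hδ).1 hfh.1, ?_⟩
  have hpt : ∀ k, (B.bestError h ∘ dyadic) k ≤ K * (2 * (B.bestError f ∘ dyadic) k +
      τ * (if k < m + 1 then 1 else 0)) := by
    intro k
    split_ifs with hk
    · have h2 : dyadic k ≤ 2 ^ m := by
        rw [← dyadic_succ]; exact dyadic_strictMono.monotone hk.le
      have h3 := B.bestError_add_le f (h - f) (dyadic k) 0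
      rw [B.bestError_zero, N.en_sub_comm, add_zero, add_sub_cancel] at h3
      refine h3.trans ?_
      rw [mul_one, two_mul, add_assoc]
      have h4 := B.bestError_antitone f h2
      simp only [Function.comp_apply]
      gcongr
      exact hfh.2.le.trans (by gcongr)
    · obtain ⟨j, rfl⟩ : ∃ j, k = j + 1 := ⟨k - 1, by omega⟩
      rw [Function.comp_apply, dyadic_succ, B.bestError_eq_zero
        (hA.trans (Nat.pow_le_pow_right two_pos (by omega))) hh]
      exact zero_le
  calc B.anorm w q h ≤ _ := dyadicNorm_mono hpt
    _ = K * _ := dyadicNorm_const_mul hq _ _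
    _ ≤ K * (C₁ * (2 * M + M)) := by
        gcongr
        refine (h₁ _ _).trans ?_
        rw [dyadicNorm_const_mul hq, dyadicNorm_const_mul hq]
        gcongr
        exact hf
    _ = _ := by push_cast; ring

/-- Up to the constant `c`, finitely many Chebyshev-greedy errors of `f` are realized by sets that
can be made greedy sets by small perturbations on finitely many coordinates. -/
def GreedilyPerturbable (c : NNReal) (f : X) : Prop :=
  ∀ L : ℕ, ∃ (G : ℕ → Finset ℕ) (S : Finset ℕ),
    (∀ k < L, (G k).card = dyadic k ∧ G k ⊆ S ∧
      B.chebyshevError f (dyadic k) ≤ c * B.distOn f (G k)) ∧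
    ∀ η : ℝ, 0 < η → ∃ (v : ℕ → 𝕜) (τ τ' : ℝ), τ' < τ ∧
      (∀ n ∈ S, ‖v n - B.coord n f‖ ≤ η) ∧ (∀ n ∉ S, ‖B.coord n f‖ ≤ τ') ∧
      (∀ n ∈ S, τ ≤ ‖v n‖) ∧ ∀ k < L, ∀ n ∈ G k, ∀ i ∈ S, i ∉ G k → ‖v i‖ ≤ ‖v n‖

/-- An approximant of `f` in the span is corrected on `S` to have exactly the coordinates `v`. The
prescribed sets become greedy for it, so the bound on the span controls the corresponding errors of
`f`. -/
theorem exists_gnorm_le_of_greedilyPerturbable (hw : IsWeightIDPlus w) (hq : 0 < q) {C : NNReal}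
    (hC : ∀ A, ∀ g ∈ B.spanOn A, B.gnorm w q g ≤ C * B.anorm w q g) (c : NNReal) :
    ∃ C' : NNReal, ∀ (f : X) (M : NNReal), 0 < M → B.anorm w q f ≤ M →
      B.GreedilyPerturbable c f → B.gnorm w q f ≤ C' * M := by
  classical
  obtain ⟨C₁, h₁⟩ := dyadicNorm_add_le w hq
  obtain ⟨C₂, -, h₂⟩ := B.exists_anorm_add_le hw hq
  obtain ⟨C₃, h₃⟩ := B.exists_span_approx_anorm_le hw hq
  set K := N.quasiConst
  have hv := B.vecConst_pos
  have hcc := B.coordConst_pos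
  have hp := N.pos_p
  have hKpos : (0 : ℝ) < K := by
    have := zero_lt_one.trans_le N.one_le_quasiConst
    exact_mod_cast this
  refine ⟨c * K * (C₁ * (C * (C₂ * (C₃ + 1)) + 1)), fun f M hM hf hpert => ?_⟩
  refine dyadicNorm_le_of_truncations hq fun L => ?_
  obtain ⟨G, S, hG, hpert⟩ := hpert L
  obtain ⟨C₄, h₄⟩ := B.exists_anorm_le_en hw hq S.card
  set V := dyadicNorm w q (fun k => if k < L then 1 else 0) with hV
  have hVtop : V ≠ ∞ := hw.dyadicNorm_truncation_ne_top hq _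
  -- The first bound keeps `anorm` of the correction below `M`; the second keeps the cost of
  -- replacing `f` by `g` in `L` entries below `M`.
  obtain ⟨ζ, hζ, hζ1, hζ2⟩ : ∃ ζ : ℝ, 0 < ζ ∧ C₄ * ζ ≤ M ∧ K * (ζ + ζ) * V.toReal ≤ M := by
    have hVn : 0 ≤ V.toReal := ENNReal.toReal_nonneg
    have hM' : (0 : ℝ) < M := hM
    refine ⟨M / (C₄ + 2 * K * V.toReal + 1), by positivity, ?_, ?_⟩
    · rw [mul_div_assoc', div_le_iff₀ (by positivity)]
      have : 0 ≤ (K : ℝ) * V.toReal := by positivity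
      nlinarith
    · rw [show K * (M / (C₄ + 2 * K * V.toReal + 1) + M / (C₄ + 2 * K * V.toReal + 1)) * V.toReal
        = (2 * K * V.toReal * M) / (C₄ + 2 * K * V.toReal + 1) by ring, div_le_iff₀ (by positivity)]
      have : (0 : ℝ) ≤ C₄ := C₄.2
      nlinarith
  set cS : ℝ := (S.card : ℝ) ^ (1 / p) * B.vecConst + 1 with hcS
  have hcSpos : 0 < cS := by positivity
  obtain ⟨v, τ, τ', hττ, hv1, hv2, hv3, hv4⟩ := hpert (ζ / (2 * cS)) (by positivity)
  have hττ' : 0 < τ - τ' := by linarith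
  -- The three bounds keep the approximant close to `f`, keep the correction on `S` small, and keep
  -- the coordinates off `S` from exceeding `τ`.
  set δ := min ζ (min (ζ / (2 * cS * B.coordConst)) ((τ - τ') / B.coordConst)) with hδ
  have hδpos : 0 < δ := lt_min hζ (lt_min (by positivity) (by positivity))
  obtain ⟨A, h, hh, hfh, ha⟩ := h₃ f M hM hf δ hδpos
  have hδ1 : δ ≤ ζ := min_le_left _ _
  have hδ2 : B.coordConst * δ ≤ ζ / (2 * cS) := by
    have : δ ≤ ζ / (2 * cS * B.coordConst) := (min_le_right _ _).trans (min_le_left _ _)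
    calc B.coordConst * δ ≤ B.coordConst * (ζ / (2 * cS * B.coordConst)) := by gcongr
      _ = _ := by field_simp
  have hδ3 : B.coordConst * δ ≤ τ - τ' := by
    have : δ ≤ (τ - τ') / B.coordConst := (min_le_right _ _).trans (min_le_right _ _)
    rwa [le_div_iff₀ hcc, mul_comm] at this
  have hcoord : ∀ n, ‖B.coord n f - B.coord n h‖ ≤ B.coordConst * δ := by
    intro n
    rw [← map_sub]
    exact (B.coord_le n _).trans (by gcongr)
  set u := B.indicator (fun n => v n - B.coord n h) S with hu
  have huS : u ∈ B.spanOn S := B.indicator_mem_spanOn _ _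
  have huN : N u ≤ ζ := by
    have hζ' : 0 ≤ ζ / cS := by positivity
    have h5 := B.indicator_le (fun n => v n - B.coord n h) S (t := ζ / cS) hζ' fun n hn => by
      calc ‖v n - B.coord n h‖ = ‖(v n - B.coord n f) + (B.coord n f - B.coord n h)‖ := by
            congr 1; ring
        _ ≤ ζ / (2 * cS) + ζ / (2 * cS) :=
            (norm_add_le _ _).trans (add_le_add (hv1 n hn) ((hcoord n).trans hδ2))
        _ = ζ / cS := by field_simp; norm_num
    calc N u ≤ _ := h5
      _ = ((S.card : ℝ) ^ (1 / p) * B.vecConst) * (ζ / cS) := by ring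
      _ ≤ cS * (ζ / cS) := by gcongr; rw [hcS]; linarith
      _ = ζ := by field_simp
  set g := h + u with hg
  have hgmem : g ∈ B.spanOn (A ∪ S) :=
    Submodule.add_mem _ (B.spanOn_mono Finset.subset_union_left hh)
      (B.spanOn_mono Finset.subset_union_right huS)
  have hgS : ∀ n ∈ S, B.coord n g = v n := fun n hn => by
    simp [hg, hu, B.coord_indicator, hn]
  have hgnS : ∀ n ∉ S, ‖B.coord n g‖ ≤ τ := fun n hn => by
    have e : B.coord n g = B.coord n f - (B.coord n f - B.coord n h) := by
      simp [hg, hu, B.coord_indicator, hn]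
    rw [e]
    have := norm_sub_le (B.coord n f) (B.coord n f - B.coord n h)
    have := hv2 n hn
    have := hcoord n
    linarith
  have hgreedy : ∀ k < L, B.IsGreedySet g (dyadic k) (G k) := by
    intro k hk
    refine ⟨(hG k hk).1, fun n hn i hi => ?_⟩
    have hnS := (hG k hk).2.1 hn
    rw [hgS n hnS]
    by_cases hiS : i ∈ S
    · rw [hgS i hiS]; exact hv4 k hk n hn i hiS hi
    · exact (hgnS i hiS).trans (hv3 n hnS)
  have hfgN : N (f - g) ≤ K * (ζ + ζ) := by
    rw [hg, ← sub_sub]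
    refine (N.sub_le _ _).trans ?_
    gcongr
    exact hfh.le.trans hδ1
  have hfgV : N.en (f - g) * V ≤ M := by
    rw [← ENNReal.ofReal_toReal hVtop, PNorm.en, ← ENNReal.ofReal_mul (N.nonneg _),
      ← ENNReal.ofReal_coe_nnreal]
    exact ENNReal.ofReal_le_ofReal (le_trans (by gcongr) hζ2)
  have hga : B.anorm w q g ≤ C₂ * (C₃ * M + M) := by
    refine (h₂ _ _).trans ?_
    gcongr
    refine (h₄ S u le_rfl huS).trans ?_
    rw [PNorm.en, ← ENNReal.ofReal_coe_nnreal, ← ENNReal.ofReal_coe_nnreal,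
      ← ENNReal.ofReal_mul NNReal.zero_le_coe]
    exact ENNReal.ofReal_le_ofReal (le_trans (by gcongr) hζ1)
  calc dyadicNorm w q (fun k => if k < L then (B.chebyshevError f ∘ dyadic) k else 0)
      ≤ dyadicNorm w q (fun k => ((c * K : NNReal) : ℝ≥0∞) * ((B.chebyshevError g ∘ dyadic) k +
          N.en (f - g) * (if k < L then 1 else 0))) := by
        refine dyadicNorm_mono fun k => ?_
        split_ifs with hk
        · rw [mul_one, ENNReal.coe_mul, mul_assoc]
          refine ((hG k hk).2.2).trans ?_
          gcongr
          have := B.distOn_add_le g (f - g) (G k)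
          rw [add_sub_cancel] at this
          refine this.trans ?_
          gcongr
          exact (hgreedy k hk).distOn_le
        · exact zero_le
    _ = (c * K : NNReal) * dyadicNorm w q (fun k => (B.chebyshevError g ∘ dyadic) k +
          N.en (f - g) * (if k < L then 1 else 0)) := dyadicNorm_const_mul hq _ _
    _ ≤ (c * K : NNReal) * (C₁ * (C * (C₂ * (C₃ * M + M)) + M)) := by
        gcongr
        refine (h₁ _ _).trans ?_
        rw [dyadicNorm_const_mul hq]
        gcongr
        exact (hC _ _ hgmem).trans (by gcongr)
    _ = _ := by push_cast; ring

/-- A greedy set of such `f` contains no index with zero coordinate, since all coordinates outside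
it would vanish too. Hence the coordinates on finitely many greedy sets lie above some `t > 0`, and
fixing the coordinates of modulus at least `t` preserves these sets. -/
theorem greedilyPerturbable_of_infinite {f : X} (hf : {n | B.coord n f ≠ 0}.Infinite) :
    B.GreedilyPerturbable 2 f := by
  classical
  intro L
  choose G hG hle using fun k => B.exists_isGreedySet_chebyshevError_le f (dyadic k)
  have hne : ∀ k, ∀ n ∈ G k, B.coord n f ≠ 0 := by
    intro k n hn h0
    refine hf ((G k).finite_toSet.subset fun i hi => ?_)
    by_contra hiG
    have := (hG k).2 n hn i hiG
    rw [h0, norm_zero] at this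
    exact hi (norm_le_zero_iff.1 this)
  obtain ⟨t, ht, htU⟩ := exists_pos_forall_le_of_finset ((Finset.range L).biUnion G)
    (fun n => ‖B.coord n f‖) fun n hn => by
      obtain ⟨k, -, hk⟩ := Finset.mem_biUnion.1 hn
      exact norm_pos_iff.2 (hne k n hk)
  obtain ⟨τ', -, hτ', hgap⟩ := B.exists_gap f ht
  set S := (B.finite_le_coord f ht).toFinset with hS
  have hmem : ∀ n, n ∈ S ↔ t ≤ ‖B.coord n f‖ := by simp [hS]
  refine ⟨G, S, fun k hk => ⟨(hG k).1, fun n hn => ?_, hle k⟩, fun η hη => ?_⟩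
  · exact (hmem n).2 (htU n (Finset.mem_biUnion.2 ⟨k, Finset.mem_range.2 hk, hn⟩))
  · refine ⟨fun n => B.coord n f, t, τ', hτ', fun n _ => by simpa using hη.le, fun n hn => ?_,
      fun n hn => (hmem n).1 hn, fun k _ n hn i _ hi => (hG k).2 n hn i hi⟩
    rw [hmem, not_le] at hn
    exact hgap n hn

/-- Beyond the support `S₀`, every greedy set contains `S₀` and its error is at most the distance to
the span over `S₀`. Padding `S₀` by separated indices does not lower that distance by more than a
factor, and tiny coordinates there make the padded sets greedy. -/
theorem exists_greedilyPerturbable_of_hasFDSP (hsep : N.Separable Set.univ)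
    (h : N.HasFDSP B.vec) :
    ∃ c : NNReal, ∀ f, {n | B.coord n f ≠ 0}.Finite → B.GreedilyPerturbable c f := by
  classical
  obtain ⟨c, hc⟩ := exists_separated_of_hasFDSP hsep h
  refine ⟨2 + c, fun f hfin L => ?_⟩
  set S₀ := hfin.toFinset with hS₀
  have hne : ∀ n ∈ S₀, B.coord n f ≠ 0 := by simp [hS₀]
  have hz : ∀ n ∉ S₀, B.coord n f = 0 := by simp [hS₀]
  -- The vector `f` is included because it need not lie in the span over `S₀`; the separation is
  -- applied to `f - y` with `y` in that span. The size `2 ^ L` is ample for padding up to the first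
  -- `L` dyadic cardinalities.
  obtain ⟨D, hD, hdisj, hsepD⟩ := hc (B.spanOn S₀ ⊔ Submodule.span 𝕜 {f}) (by
    have := finiteDimensional_spanOn (B := B) S₀
    infer_instance) S₀ (2 ^ L)
  have hDk : ∀ k < L, ∃ E ⊆ D, E.card = dyadic k - S₀.card := by
    intro k hk
    refine Finset.exists_subset_card_eq ?_
    rw [hD]
    have := dyadic_strictMono.monotone (show k ≤ L + 1 by omega)
    rw [dyadic_succ] at this
    omega
  have hGk : ∀ k, ∃ G : Finset ℕ, k < L → G.card = dyadic k ∧ G ⊆ S₀ ∪ D ∧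
      B.chebyshevError f (dyadic k) ≤ (2 + c : NNReal) * B.distOn f G ∧
      ((G ⊆ S₀ ∧ B.IsGreedySet f (dyadic k) G) ∨ S₀ ⊆ G) := by
    intro k
    by_cases hk : k < L
    swap
    · exact ⟨∅, fun h => absurd h hk⟩
    rcases le_total (dyadic k) S₀.card with hle | hle
    · obtain ⟨G, hG, hGle⟩ := B.exists_isGreedySet_chebyshevError_le f (dyadic k)
      have hGS := hG.subset_support hz hne hle
      refine ⟨G, fun _ => ⟨hG.1, hGS.trans Finset.subset_union_left, hGle.trans ?_,
        Or.inl ⟨hGS, hG⟩⟩⟩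
      gcongr
      push_cast
      exact le_self_add
    · obtain ⟨E, hED, hE⟩ := hDk k hk
      have hdisjE : Disjoint S₀ E := hdisj.mono_right hED
      refine ⟨S₀ ∪ E, fun _ => ⟨?_, Finset.union_subset_union_right hED, ?_,
        Or.inr Finset.subset_union_left⟩⟩
      · rw [Finset.card_union_of_disjoint hdisjE, hE]; omega
      refine B.chebyshevError_le fun G hG =>
        (B.distOn_anti f (hG.support_subset hz hne hle)).trans ?_
      have := B.le_mul_distOn_add (f := f) (A := S₀ ∪ E) (C := 2 + c) (c := 0)
        (x := B.distOn f S₀) fun u hu => by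
          have hu' := B.eq_indicator_of_mem_spanOn hu
          rw [B.indicator_union hdisjE] at hu'
          set y := B.indicator (fun n => B.coord n u) S₀
          set z := B.indicator (fun n => B.coord n u) E
          have hy : y ∈ B.spanOn S₀ := B.indicator_mem_spanOn _ _
          have hzE : z ∈ B.spanOn D := B.spanOn_mono hED (B.indicator_mem_spanOn _ _)
          have hfy : f - y ∈ B.spanOn S₀ ⊔ Submodule.span 𝕜 {f} :=
            Submodule.sub_mem _ (Submodule.mem_sup_right (Submodule.mem_span_singleton_self f))
              (Submodule.mem_sup_left hy)
          have h1 := hsepD _ hfy (-z) (Submodule.neg_mem _ hzE)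
          rw [add_zero]
          refine (B.distOn_le hy).trans (h1.trans ?_)
          rw [show f - y + -z = f - u by rw [hu']; abel]
          gcongr
          exact le_add_self
      simpa using this
  choose G hG using hGk
  obtain ⟨t, ht, htS⟩ := exists_pos_forall_le_of_finset S₀ (fun n => ‖B.coord n f‖)
    fun n hn => norm_pos_iff.2 (hne n hn)
  refine ⟨G, S₀ ∪ D, fun k hk => ⟨(hG k hk).1, (hG k hk).2.1, (hG k hk).2.2.1⟩, fun η hη => ?_⟩
  -- The coordinates added on `D` all equal `δ`: they tie with each other, so any choice of padding
  -- is greedy, and they do not exceed those on `S₀`.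
  set δ := min η t with hδ
  have hδpos : 0 < δ := lt_min hη ht
  have hnδ : ‖((δ : ℝ) : 𝕜)‖ = δ := by rw [RCLike.norm_ofReal, abs_of_pos hδpos]
  set v : ℕ → 𝕜 := fun n => if n ∈ S₀ then B.coord n f else ((δ : ℝ) : 𝕜) with hv
  have hvS : ∀ n ∈ S₀, v n = B.coord n f := fun n hn => if_pos hn
  have hvn : ∀ n ∉ S₀, ‖v n‖ = δ := fun n hn => by rw [hv]; simp only [if_neg hn]; exact hnδ
  have hvle : ∀ n, δ ≤ ‖v n‖ := by
    intro n
    by_cases hn : n ∈ S₀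
    · rw [hvS n hn]; exact (min_le_right _ _).trans (htS n hn)
    · rw [hvn n hn]
  refine ⟨v, δ, 0, hδpos, fun n _ => ?_, fun n hn => ?_, fun n _ => hvle n, ?_⟩
  · by_cases hn : n ∈ S₀
    · rw [hvS n hn]; simpa using hη.le
    · rw [hz n hn, sub_zero, hvn n hn]; exact min_le_left _ _
  · rw [hz n fun h => hn (Finset.mem_union_left _ h), norm_zero]
  · intro k hk n hn i _ hiG
    by_cases hi : i ∈ S₀
    · rcases (hG k hk).2.2.2 with ⟨hsub, hgr⟩ | hsub
      · rw [hvS i hi, hvS n (hsub hn)]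
        exact hgr.2 n hn i hiG
      · exact absurd (hsub hi) hiG
    · rw [hvn i hi]; exact hvle n

/-! ### Truncation quasi-greedy bases: vectors of the class with finitely many coordinates -/

/-- Binary expansion of the coefficients: `t / 2` is peeled off on the level set where `b` is at
least `t / 2`, at cost `Q`, and the remaining coefficients are at most `t / 2`. After `J` rounds the
rest is estimated term by term. -/
theorem indicator_rpow_le_of_levels (ε : ℕ → 𝕜) (hε : ∀ n, ‖ε n‖ = 1) (A : Finset ℕ) {Q : ℝ}
    (hQ : 0 ≤ Q) (J : ℕ) : ∀ (b : ℕ → ℝ) (t : ℝ), 0 ≤ t → (∀ n ∈ A, 0 ≤ b n ∧ b n ≤ t) →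
      (∀ s : ℝ, 0 < s → ∀ A' ⊆ A, (∀ n ∈ A', s ≤ b n) → s * N (B.indicator ε A') ≤ Q) →
      N (B.indicator (fun n => ((b n : ℝ) : 𝕜) * ε n) A) ^ p ≤
        J * Q ^ p + A.card * (B.vecConst * (t / 2 ^ J)) ^ p := by
  have hp := N.pos_p
  have hv := B.vecConst_pos
  induction J with
  | zero =>
    intro b t ht hb _
    simp only [Nat.cast_zero, zero_mul, zero_add, pow_zero, div_one]
    refine (N.sum_rpow_le _ _).trans ?_
    rw [← nsmul_eq_mul, ← Finset.sum_const]
    refine Finset.sum_le_sum fun n hn => Real.rpow_le_rpow (N.nonneg _) ?_ hp.le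
    rw [N.smul, norm_mul, hε, mul_one, RCLike.norm_ofReal, abs_of_nonneg (hb n hn).1, mul_comm]
    exact mul_le_mul (B.vec_le n) (hb n hn).2 (hb n hn).1 hv.le
  | succ J ih =>
    intro b t ht hb hlev
    classical
    set A' := A.filter (fun n => t / 2 ≤ b n) with hA'
    set b' : ℕ → ℝ := fun n => if t / 2 ≤ b n then b n - t / 2 else b n with hb'
    have hb'0 : ∀ n ∈ A, 0 ≤ b' n ∧ b' n ≤ t / 2 := by
      intro n hn
      have := hb n hn
      simp only [hb']
      split_ifs with h
      · constructor <;> linarith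
      · exact ⟨this.1, (not_le.1 h).le⟩
    have hb'le : ∀ n, b' n ≤ b n := by
      intro n
      simp only [hb']
      split_ifs
      · linarith
      · exact le_rfl
    have h1 := ih b' (t / 2) (by positivity) hb'0 fun s hs D hD hDs =>
      hlev s hs D hD fun n hn => (hDs n hn).trans (hb'le n)
    have h2 : N (((t / 2 : ℝ) : 𝕜) • B.indicator ε A') ≤ Q := by
      rw [N.smul, RCLike.norm_ofReal, abs_of_nonneg (by positivity)]
      rcases ht.eq_or_lt with h0 | h0
      · rw [← h0]; simpa using hQ
      · exact hlev (t / 2) (by positivity) A' (Finset.filter_subset _ _)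
          fun n hn => (Finset.mem_filter.1 hn).2
    have h3 : B.indicator (fun n => ((b n : ℝ) : 𝕜) * ε n) A =
        ((t / 2 : ℝ) : 𝕜) • B.indicator ε A' +
          B.indicator (fun n => ((b' n : ℝ) : 𝕜) * ε n) A := by
      simp only [indicator, hA', Finset.smul_sum, Finset.sum_filter]
      rw [← Finset.sum_add_distrib]
      refine Finset.sum_congr rfl fun n _ => ?_
      simp only [hb']
      split_ifs
      · rw [smul_smul, ← add_smul]
        congr 1
        push_cast
        ring
      · simp
    rw [h3]
    refine (N.add_rpow_le _ _).trans ?_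
    have h4 := Real.rpow_le_rpow (N.nonneg _) h2 hp.le
    have h5 : t / 2 / 2 ^ J = t / 2 ^ (J + 1) := by rw [pow_succ]; field_simp
    rw [h5] at h1
    rw [Nat.cast_succ, add_mul, one_mul]
    linarith

variable {B}

/-- If `z` has no coordinates, an approximant `g` has the same coordinates as the error `g - z`, so
`‖g‖` is governed by the error up to a factor growing like a power of `log₂` of the number of terms.
The weight makes the errors decay geometrically on the dyadic scale, so `g`, and with it `z`, tends
to zero. -/
theorem TruncationQuasiGreedy.eq_zero_of_coord_eq_zero (h : B.TruncationQuasiGreedy)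
    (hw : IsWeightIDPlus w) (hq : 0 < q) {z : X} (hz : B.anorm w q z ≠ ∞)
    (h0 : ∀ n, B.coord n z = 0) : z = 0 := by
  obtain ⟨C, hC, h⟩ := h.exists_sgn_indicator_le
  have hp := N.pos_p
  have hv := B.vecConst_pos
  have hcc := B.coordConst_pos
  set M := (B.anorm w q z).toReal with hM
  have hM0 : 0 ≤ M := ENNReal.toReal_nonneg
  -- After `k * P` halvings the at most `2 ^ k` remaining coefficients contribute a bounded amount,
  -- because `P * p ≥ 1`.
  obtain ⟨P, hP⟩ := exists_nat_ge (1 / p)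
  have hPp : 1 ≤ (P : ℝ) * p := by rwa [div_le_iff₀ hp] at hP
  have key : ∀ k : ℕ, N z ^ p ≤
      (1 + (k * P : ℕ) * C ^ p + (B.vecConst * B.coordConst) ^ p) *
        ((M + 1) / w (2 ^ k)) ^ p := by
    intro k
    have hwk := hw.pos (2 ^ k)
    set e := (M + 1) / w (2 ^ k) with he
    have hepos : 0 < e := by positivity
    have hσ : B.bestError z (2 ^ k) < ENNReal.ofReal e := by
      have h1 := le_dyadicNorm (w := w) hq (B.bestError z ∘ dyadic) (k + 1)
      rw [Function.comp_apply, dyadic_succ, dyadicWeight, Nat.add_sub_cancel] at h1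
      rw [he, ENNReal.ofReal_div_of_pos hwk]
      rw [ENNReal.lt_div_iff_mul_lt (by simp [hwk]) (by simp), mul_comm]
      refine lt_of_le_of_lt h1 ?_
      change B.anorm w q z < _
      rw [← ENNReal.ofReal_toReal hz, ENNReal.ofReal_lt_ofReal_iff (by positivity)]
      linarith
    obtain ⟨A, hA, g, hg, hzg⟩ := B.exists_of_bestError_lt hσ
    rw [PNorm.en, ENNReal.ofReal_lt_ofReal_iff hepos] at hzg
    have hcoord : ∀ n, B.coord n (g - z) = B.coord n g := fun n => by rw [map_sub, h0, sub_zero]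
    have hgz : N (g - z) ≤ e := by rw [N.map_sub_comm]; exact hzg.le
    have hgexp : g = B.indicator (fun n => ((‖B.coord n g‖ : ℝ) : 𝕜) * sgn (B.coord n g)) A := by
      simp only [norm_mul_sgn]
      exact B.eq_indicator_of_mem_spanOn hg
    have hlev := B.indicator_rpow_le_of_levels (fun n => sgn (B.coord n g))
      (fun n => norm_sgn _) A (Q := C * e) (by positivity) (k * P) (fun n => ‖B.coord n g‖)
      (B.coordConst * e) (by positivity)
      (fun n _ => ⟨norm_nonneg _, by
        rw [← hcoord]
        exact (B.coord_le n _).trans (by gcongr)⟩)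
      (fun s hs A' _ hA's => by
        have h1 := h (g - z) s A' hs fun n hn => by rw [hcoord]; exact hA's n hn
        simp only [hcoord] at h1
        exact h1.trans (by gcongr))
    rw [← hgexp] at hlev
    have hrem : (A.card : ℝ) * (B.vecConst * (B.coordConst * e / 2 ^ (k * P))) ^ p ≤
        (B.vecConst * B.coordConst) ^ p * e ^ p := by
      have e1 : B.vecConst * (B.coordConst * e / 2 ^ (k * P)) =
          (B.vecConst * B.coordConst) * e * ((2 : ℝ) ^ (k * P))⁻¹ := by ring
      rw [e1, Real.mul_rpow (by positivity) (by positivity), Real.mul_rpow (by positivity)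
        (by positivity), Real.inv_rpow (by positivity)]
      have e2 : (A.card : ℝ) ≤ ((2 : ℝ) ^ (k * P)) ^ p := by
        calc (A.card : ℝ) ≤ 2 ^ k := by exact_mod_cast hA
          _ = (2 : ℝ) ^ (k : ℝ) := (Real.rpow_natCast _ _).symm
          _ ≤ (2 : ℝ) ^ (k * (P * p)) := by
              refine Real.rpow_le_rpow_of_exponent_le one_le_two ?_
              exact le_mul_of_one_le_right (Nat.cast_nonneg k) hPp
          _ = _ := by
              rw [← Real.rpow_natCast, ← Real.rpow_mul zero_le_two]
              push_cast
              ring_nf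
      have e3 : (0 : ℝ) < ((2 : ℝ) ^ (k * P)) ^ p := by positivity
      calc (A.card : ℝ) * ((B.vecConst * B.coordConst) ^ p * e ^ p * (((2 : ℝ) ^ (k * P)) ^ p)⁻¹)
          = ((A.card : ℝ) / ((2 : ℝ) ^ (k * P)) ^ p) *
              ((B.vecConst * B.coordConst) ^ p * e ^ p) := by ring
        _ ≤ 1 * ((B.vecConst * B.coordConst) ^ p * e ^ p) := by
            gcongr
            rw [div_le_one e3]
            exact e2
        _ = _ := one_mul _
    have hz' : N z ^ p ≤ N (z - g) ^ p + N g ^ p := by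
      have := N.add_rpow_le (z - g) g
      rwa [sub_add_cancel] at this
    have hzg' : N (z - g) ^ p ≤ e ^ p := Real.rpow_le_rpow (N.nonneg _) hzg.le hp.le
    rw [Real.mul_rpow hC.le hepos.le] at hlev
    calc N z ^ p ≤ e ^ p + ((k * P : ℕ) * (C ^ p * e ^ p) +
          (B.vecConst * B.coordConst) ^ p * e ^ p) := by linarith
      _ = _ := by ring
  -- Along `k = j * b` the `p`-th power of the error decays like `2 ^ (-j)`, which beats the number
  -- of levels, linear in `j`.
  obtain ⟨b, hb⟩ := hw.exists_growth (2 ^ (1 / p))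
  have hw1 := hw.pos 1
  set α : ℝ := 1 + (B.vecConst * B.coordConst) ^ p with hα
  set β : ℝ := b * P * C ^ p with hβ
  set γ : ℝ := ((M + 1) / w 1) ^ p with hγ
  have hα0 : 0 ≤ α := by positivity
  have hβ0 : 0 ≤ β := by positivity
  have hbound : ∀ j : ℕ, N z ^ p ≤ γ * (α * (1 / 2) ^ j + β * (j * (1 / 2) ^ j)) := by
    intro j
    refine (key (j * b)).trans ?_
    have h1 : ((M + 1) / w (2 ^ (j * b))) ^ p ≤ γ * (1 / 2) ^ j := by
      have h2 : (M + 1) / w (2 ^ (j * b)) ≤ (M + 1) / w 1 * (((2 : ℝ) ^ (1 / p)) ^ j)⁻¹ := by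
        rw [← div_eq_mul_inv, div_div]
        have h3 := hb j
        push_cast at h3
        rw [mul_comm] at h3
        gcongr
      have h4 : (((2 : ℝ) ^ (1 / p)) ^ j) ^ p = 2 ^ j := by
        rw [← Real.rpow_natCast, ← Real.rpow_mul zero_le_two, ← Real.rpow_mul zero_le_two,
          show 1 / p * (j : ℝ) * p = j by field_simp, Real.rpow_natCast]
      have hwj := hw.pos (2 ^ (j * b))
      refine (Real.rpow_le_rpow (by positivity) h2 hp.le).trans (le_of_eq ?_)
      rw [Real.mul_rpow (by positivity) (by positivity), Real.inv_rpow (by positivity), h4,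
        one_div, inv_pow]
    calc _ ≤ (1 + (j * b * P : ℕ) * C ^ p + (B.vecConst * B.coordConst) ^ p) *
          (γ * (1 / 2) ^ j) := by gcongr
      _ = _ := by rw [hα, hβ]; push_cast; ring
  have hlim : Filter.Tendsto (fun j : ℕ => γ * (α * (1 / 2 : ℝ) ^ j + β * (j * (1 / 2) ^ j)))
      Filter.atTop (nhds (γ * (α * 0 + β * 0))) := by
    refine Filter.Tendsto.const_mul _ (Filter.Tendsto.add (Filter.Tendsto.const_mul _ ?_)
      (Filter.Tendsto.const_mul _ ?_))
    · exact tendsto_pow_atTop_nhds_zero_of_lt_one (by norm_num) (by norm_num)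
    · exact tendsto_self_mul_const_pow_of_lt_one (by norm_num) (by norm_num)
  have hle := ge_of_tendsto' hlim hbound
  simp only [mul_zero, add_zero] at hle
  refine N.eq_zero z ?_
  by_contra hne
  have := Real.rpow_pos_of_pos (lt_of_le_of_ne (N.nonneg z) (Ne.symm hne)) p
  linarith

theorem TruncationQuasiGreedy.mem_spanOn (h : B.TruncationQuasiGreedy)
    (hw : IsWeightIDPlus w) (hq : 0 < q) {f : X} (hf : B.anorm w q f ≠ ∞)
    (hfin : {n | B.coord n f ≠ 0}.Finite) : f ∈ B.spanOn hfin.toFinset := by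
  obtain ⟨C, hC⟩ := B.exists_anorm_sub_proj_le hw hq hfin.toFinset
  set P := B.indicator (fun n => B.coord n f) hfin.toFinset with hP
  have hz : f - P = 0 := by
    refine h.eq_zero_of_coord_eq_zero hw hq (w := w) (q := q)
      (ne_top_of_le_ne_top (ENNReal.mul_ne_top ENNReal.coe_ne_top hf) (hC f)) fun n => ?_
    rw [map_sub, hP, B.coord_indicator]
    split_ifs with hn
    · exact sub_self _
    · simpa using hn
  have hmem : P ∈ B.spanOn hfin.toFinset := B.indicator_mem_spanOn _ _
  rwa [← sub_eq_zero.1 hz] at hmem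

/-- Every vector of the class either lies in the span, where the bound is known, or is perturbable
with a uniform constant. -/
theorem exists_gnorm_le_anorm (hsep : N.Separable Set.univ) (hw : IsWeightIDPlus w) (hq : 0 < q)
    {C : NNReal} (hC : ∀ A, ∀ g ∈ B.spanOn A, B.gnorm w q g ≤ C * B.anorm w q g)
    (hB : B.TruncationQuasiGreedy ∨ N.HasFDSP B.vec) :
    ∃ C' : NNReal, ∀ f, B.gnorm w q f ≤ C' * B.anorm w q f := by
  obtain ⟨c, hc⟩ : ∃ c : NNReal, ∀ f, B.anorm w q f ≠ ∞ →
      B.gnorm w q f ≤ C * B.anorm w q f ∨ B.GreedilyPerturbable c f := by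
    rcases hB with h | h
    · refine ⟨2, fun f hf => ?_⟩
      by_cases hfin : {n | B.coord n f ≠ 0}.Finite
      · exact Or.inl (hC _ f (h.mem_spanOn hw hq hf hfin))
      · exact Or.inr (B.greedilyPerturbable_of_infinite hfin)
    · obtain ⟨c, hc⟩ := B.exists_greedilyPerturbable_of_hasFDSP hsep h
      refine ⟨2 + c, fun f _ => Or.inr ?_⟩
      have mono : ∀ c₁ c₂ : NNReal, c₁ ≤ c₂ → B.GreedilyPerturbable c₁ f →
          B.GreedilyPerturbable c₂ f := by
        intro c₁ c₂ h12 hp L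
        obtain ⟨G, S, hG, hrest⟩ := hp L
        refine ⟨G, S, fun k hk => ⟨(hG k hk).1, (hG k hk).2.1, (hG k hk).2.2.trans ?_⟩, hrest⟩
        gcongr
      by_cases hfin : {n | B.coord n f ≠ 0}.Finite
      · exact mono _ _ le_add_self (hc f hfin)
      · exact mono _ _ le_self_add (B.greedilyPerturbable_of_infinite hfin)
  obtain ⟨C', hC'⟩ := B.exists_gnorm_le_of_greedilyPerturbable hw hq hC c
  refine ⟨C + C' + 1, fun f => ?_⟩
  rcases eq_or_ne (B.anorm w q f) ∞ with htop | htop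
  · rw [htop, ENNReal.mul_top (by simp)]
    exact le_top
  rcases hc f htop with h | h
  · refine h.trans ?_
    gcongr
    rw [add_assoc]
    exact le_self_add
  · rcases eq_or_ne (B.anorm w q f) 0 with h0 | h0
    · have h1 := B.en_le_anorm hw hq f
      rw [h0, mul_zero] at h1
      have h2 : f = 0 := N.en_eq_zero (le_antisymm h1 zero_le)
      rw [h2, B.gnorm_zero hq]
      exact zero_le
    · have h1 := hC' f (B.anorm w q f).toNNReal (ENNReal.toNNReal_pos h0 htop)
        (ENNReal.coe_toNNReal htop).ge h
      rw [ENNReal.coe_toNNReal htop] at h1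
      refine h1.trans ?_
      gcongr
      rw [add_right_comm]
      exact le_add_self

end Basis

end GreedyClasses

end

/-! ### The theorem. -/

theorem mainTheorem4 {𝕜 : Type*} [RCLike 𝕜] {X : Type*} [AddCommGroup X] [Module 𝕜 X] {p : ℝ}
    (N : GreedyClasses.PNorm 𝕜 X p) (hcomplete : N.Complete) (hsep : N.Separable Set.univ)
    (B : GreedyClasses.Basis N)
    (w : ℕ+ → ℝ) (hw : GreedyClasses.IsWeightIDPlus w) (q : ℝ≥0∞) (hq : 0 < q)
    (heq : B.approxClass w q = B.chebyshevClass w q)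
    (hB : B.TruncationQuasiGreedy ∨ N.HasFDSP B.vec) :
    GreedyClasses.EquivNorms (B.approxNorm w q) (B.chebyshevNorm w q) ∧ B.Superdemocratic := by
  obtain ⟨a₁, ha₁⟩ := B.exists_approxNorm_le_anorm hw hq
  obtain ⟨a₂, ha₂⟩ := B.exists_anorm_le_approxNorm hw hq
  obtain ⟨g₁, hg₁⟩ := B.exists_chebyshevNorm_le_gnorm hw hq
  obtain ⟨g₂, hg₂⟩ := B.exists_gnorm_le_chebyshevNorm hw hq
  -- This is the only place where the equality of the two sets enters.
  have hsub : ∀ f, B.anorm w q f ≠ ∞ → B.gnorm w q f ≠ ∞ := by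
    intro f hf
    have h1 : f ∈ B.approxClass w q :=
      lt_of_le_of_lt (ha₁ f) (ENNReal.mul_lt_top ENNReal.coe_lt_top hf.lt_top)
    rw [heq] at h1
    exact (lt_of_le_of_lt (hg₂ f) (ENNReal.mul_lt_top ENNReal.coe_lt_top h1)).ne
  obtain ⟨C, hC⟩ := B.exists_gnorm_le_anorm_on_span hcomplete hw hq hsub
  obtain ⟨C', hC'⟩ := GreedyClasses.Basis.exists_gnorm_le_anorm hsep hw hq hC hB
  have embeds : ∀ {n₁ n₂ : X → ℝ≥0∞} (c : NNReal), (∀ f, n₂ f ≤ c * n₁ f) →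
      GreedyClasses.Embeds n₁ n₂ := by
    intro n₁ n₂ c h
    refine ⟨c + 1, by positivity, fun f => (h f).trans ?_⟩
    gcongr
    rw [← ENNReal.ofReal_coe_nnreal]
    exact ENNReal.ofReal_le_ofReal (by linarith)
  refine ⟨⟨embeds (g₁ * (C' * a₂)) fun f => ?_, embeds (a₁ * g₂) fun f => ?_⟩, ?_⟩
  · calc B.chebyshevNorm w q f ≤ g₁ * (C' * (a₂ * B.approxNorm w q f)) :=
          (hg₁ f).trans (by gcongr; exact (hC' f).trans (by gcongr; exact ha₂ f))
      _ = _ := by push_cast; ring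
  · calc B.approxNorm w q f ≤ a₁ * (g₂ * B.chebyshevNorm w q f) :=
          (ha₁ f).trans (by gcongr; exact (B.anorm_le_gnorm f).trans (hg₂ f))
      _ = _ := by push_cast; ring
  · rcases hB with h | h
    · exact h.separatesIndicators.superdemocratic hw hq hC
    · exact (GreedyClasses.Basis.separatesIndicators_of_hasFDSP hsep h).superdemocratic hw hq hC
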